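/- Let $p$ be an odd prime and let $L$ be a non-degenerate even lattice of signature $(b^+,b^-)$, with quadratic form $Q$ (integral on $L$), bilinear form $(x,y)=Q(x+y)-Q(x)-Q(y)$ and dual lattice $L'$. Suppose that $L'/L\cong\mathbb Z/p\mathbb Z$ and that, under this isomorphism, the discriminant form is $Q(\gamma)=\lambda\gamma^2/p \bmod \mathbb Z$ with $\lambda\in\mathbb Z$ (necessarily $p\nmid\lambda$). Then $b^+-b^-$ is even. Let $k$ be an integer with $k\equiv\frac{b^+-b^-}{2}\pmod 2$, and put $\epsilon=\left(\frac{\lambda}{p}\right)$, $\delta=\left(\frac{-1}{p}\right)\epsilon$. Write $\tau=x+iy\in\mathbb H$, $e(z)=e^{2\pi iz}$, $q=e(\tau)$. *Scalar forms.* $H_k(\Gamma_0(p),(\frac{\cdot}{p}))$ is the space of smooth $f:\mathbb H\to\mathbb C$ such that (i) $f(\frac{a\tau+b}{c\tau+d})=\left(\frac dp\right)(c\tau+d)^kf(\tau)$ for all $\begin{pmatrix}a&b\\c&d\end{pmatrix}\in\Gamma_0(p)$; (ii) $\Delta_kf=0$, where $\Delta_k=-y^2(\partial_x^2+\partial_y^2)+iky(\partial_x+i\partial_y)$;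 (iii) $f(\tau)=P(\tau)+O(e^{-\varepsilon y})$ as $y\to\infty$ for some $\varepsilon>0$ and some polynomial $P$ in $q^{-1}$, and analogously at all cusps. Such an $f$ has a unique Fourier expansion $f=\sum_{n\in\mathbb Z}c_f(n,y)q^n$ with $c_f(n,y)=c_f^+(n)+c_f^-(n)\,\Gamma(1-k,4\pi|n|y)$, where $c_f^+(n)=0$ for $n\ll0$, $c_f^-(n)=0$ for $n\ge0$, and $\Gamma(a,y)=\int_y^\infty e^{-t}t^{a-1}\,dt$. For $\eta\in\{\pm1\}$ let $H_k^{\eta}(\Gamma_0(p),(\frac{\cdot}{p}))$ be the subspace of those $f$ with $c_f^{\pm}(n)=0$ whenever $\left(\frac np\right)=-\eta$. *Vector valued forms.* $\mathrm{Mp}_2(\mathbb Z)$ is the group of pairs $(M,\phi)$ with $M=\begin{pmatrix}a&b\\c&d\end{pmatrix}\in\mathrm{SL}_2(\mathbb Z)$ and $\phi:\mathbb H\to\mathbb C$ holomorphic with $\phi(\tau)^2=c\tau+d$. Let $\rho_L$ be the Weil representation of $\mathrm{Mp}_2(\mathbb Z)$ on $\mathbb C[L'/L]=\bigoplus_{\gamma}\mathbb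 C\,\mathfrak e_\gamma$, determined by $\rho_L(T)\mathfrak e_\gamma=e(Q(\gamma))\mathfrak e_\gamma$ and $\rho_L(S)\mathfrak e_\gamma=\frac{e((b^--b^+)/8)}{\sqrt{|L'/L|}}\sum_{\gamma'\in L'/L}e(-(\gamma,\gamma'))\mathfrak e_{\gamma'}$, where $T=(\begin{pmatrix}1&1\\0&1\end{pmatrix},1)$ and $S=(\begin{pmatrix}0&-1\\1&0\end{pmatrix},\sqrt\tau)$, and let $\bar\rho_L$ be its dual representation. $H_{k,\rho_L}$ (resp. $H_{k,\bar\rho_L}$) is the space of smooth $F=\sum_\gamma F_\gamma\mathfrak e_\gamma:\mathbb H\to\mathbb C[L'/L]$ such that (i) $F(M\tau)=\phi(\tau)^{2k}\rho(M,\phi)F(\tau)$ for all $(M,\phi)\in\mathrm{Mp}_2(\mathbb Z)$, with $\rho=\rho_L$ (resp. $\rho=\bar\rho_L$); (ii) $\Delta_kF=0$; (iii) $F(\tau)=P(\tau)+O(e^{-\varepsilon y})$ as $y\to\infty$ for some $\varepsilon>0$ and some finite sum $P(\tau)=\sum_\gamma\sum_{n\le0}c(\gamma,n)e(n\tau)\mathfrak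 e_\gamma$ over $n\in\mathbb Z+Q(\gamma)$ (resp. $n\in\mathbb Z-Q(\gamma)$). Put $s(\gamma)=2$ if $\gamma=0$ and $s(\gamma)=1$ otherwise. Then the map $f\mapsto F=\sum_\gamma F_\gamma\mathfrak e_\gamma$ with $$F_\gamma(\tau)=s(\gamma)\sum_{\substack{n\in\mathbb Z\\ n\equiv pQ(\gamma)\bmod p}}c_f\!\left(n,\tfrac yp\right)q^{n/p}$$ is a $\mathbb C$-linear isomorphism of $H_k^{\epsilon}(\Gamma_0(p),(\frac{\cdot}{p}))$ onto $H_{k,\rho_L}$. Likewise, the map given by the same formula with $Q$ replaced by $-Q$, that is, with the sum over $n\equiv-pQ(\gamma)\bmod p$, is a $\mathbb C$-linear isomorphism of $H_k^{\delta}(\Gamma_0(p),(\frac{\cdot}{p}))$ onto $H_{k,\bar\rho_L}$. -/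

import Mathlib

open UpperHalfPlane ModularGroup
open scoped Manifold ContDiff MatrixGroups

noncomputable section

namespace MaassLift

/-! ### Even lattices and their discriminant forms -/

/-- A non-degenerate even lattice in the rational quadratic space `(V, Q)`: the `ℤ`-span of a
`ℚ`-basis of `V` on which `Q` takes integral values. -/
structure EvenLattice (V : Type*) [AddCommGroup V] [Module ℚ V] where
  Q : QuadraticForm ℚ V
  nondegenerate : LinearMap.BilinForm.Nondegenerate (QuadraticMap.polarBilin Q)
  carrier : Submodule ℤ V
  isLattice : ∃ (n : ℕ) (b : Module.Basis (Fin n) ℚ V),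
    carrier = Submodule.span ℤ (Set.range b)
  even : ∀ x ∈ carrier, ∃ m : ℤ, Q x = m

namespace EvenLattice

variable {V : Type*} [AddCommGroup V] [Module ℚ V] (L : EvenLattice V)

/-- The bilinear form `(x, y) = Q (x + y) - Q x - Q y`. -/
abbrev bilin : LinearMap.BilinForm ℚ V := QuadraticMap.polarBilin L.Q

/-- The dual lattice `L'`. -/
def dual : Submodule ℤ V := L.bilin.dualSubmodule L.carrier

/-- The discriminant group `L' / L`. -/
abbrev Disc : Type _ := L.dual ⧸ L.carrier.submoduleOf L.dual

/-- The number `b⁺` in the signature `(b⁺, b⁻)` of `L`. -/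
def bPlus : ℕ := sigPos L.Q

/-- The number `b⁻` in the signature `(b⁺, b⁻)` of `L`. -/
def bMinus : ℕ := sigNeg L.Q

theorem Q_congr (x y : L.dual) (h : x - y ∈ L.carrier.submoduleOf L.dual) :
    (((L.Q x : ℚ) : ℝ) : UnitAddCircle) = (((L.Q y : ℚ) : ℝ) : UnitAddCircle) := by
  have h' : (x : V) - y ∈ L.carrier := h
  obtain ⟨m, hm⟩ := L.even _ h'
  obtain ⟨r, hr⟩ := Submodule.mem_one.mp (y.2 _ h')
  have key : L.Q x = L.Q y + ((r + m : ℤ) : ℚ) := by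
    have h1 : QuadraticMap.polar L.Q (y : V) ((x : V) - y) = (r : ℚ) := by
      simpa using hr.symm
    simp only [QuadraticMap.polar, add_sub_cancel, hm] at h1
    push_cast
    linarith
  rw [key, Rat.cast_add, AddCircle.coe_add, add_eq_left, AddCircle.coe_eq_zero_iff]
  exact ⟨r + m, by simp⟩

/-- The discriminant quadratic form `L' / L → ℚ / ℤ`, with values taken in `ℝ / ℤ`. -/
def discQ : L.Disc → UnitAddCircle :=
  Quotient.lift (fun x : L.dual => (((L.Q x : ℚ) : ℝ) : UnitAddCircle))
    (fun x y h => L.Q_congr x y ((Submodule.quotientRel_def _).mp h))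

theorem finite_disc : Finite L.Disc := by
  classical
  obtain ⟨n, b, hb⟩ := L.isLattice
  have hfg : (L.dual).FG := by
    rw [dual, hb, LinearMap.BilinForm.dualSubmodule_span_of_basis _ L.nondegenerate]
    exact Submodule.fg_span (Set.finite_range _)
  have : Module.Finite ℤ L.dual := Module.Finite.iff_fg.mpr hfg
  have : Module.Finite ℤ L.Disc := inferInstance
  refine Module.finite_of_fg_torsion _ ?_
  intro x
  obtain ⟨x, rfl⟩ := Submodule.Quotient.mk_surjective _ x
  obtain ⟨d, hd⟩ := IsLocalization.exist_integer_multiples_of_finite (nonZeroDivisors ℤ)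
    (fun i => b.repr (x : V) i)
  refine ⟨d, ?_⟩
  rw [Submonoid.smul_def, ← Submodule.Quotient.mk_smul, Submodule.Quotient.mk_eq_zero]
  change (d : ℤ) • (x : V) ∈ L.carrier
  rw [hb, ← b.sum_repr (x : V), Finset.smul_sum]
  refine Submodule.sum_mem _ fun i _ => ?_
  obtain ⟨m, hm⟩ := hd i
  have : (d : ℤ) • (b.repr (x : V) i • b i) = m • b i := by
    rw [← smul_assoc, ← hm]
    exact Int.cast_smul_eq_zsmul ℚ m (b i)
  rw [this]
  exact Submodule.smul_mem _ _ (Submodule.subset_span ⟨i, rfl⟩)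

instance : Fintype L.Disc := @Fintype.ofFinite _ L.finite_disc

end EvenLattice

/-! ### The integral metaplectic group -/

/-- The automorphy factor `c τ + d`. -/
def cocyc (M : SL(2, ℤ)) (τ : ℍ) : ℂ := (M 1 0 : ℂ) * τ + (M 1 1 : ℂ)

theorem cocyc_eq (M : SL(2, ℤ)) (τ : ℍ) : cocyc M τ = denom M τ := (denom_apply M τ).symm

theorem cocyc_mul (M N : SL(2, ℤ)) (τ : ℍ) :
    cocyc (M * N) τ = cocyc M (N • τ) * cocyc N τ := by
  simp only [cocyc_eq]
  have := denom_cocycle_σ (M : GL (Fin 2) ℝ) (N : GL (Fin 2) ℝ) τ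
  rw [← map_mul, ← map_mul] at this
  rw [this]
  simp [σ]

theorem cocyc_ne_zero (M : SL(2, ℤ)) (τ : ℍ) : cocyc M τ ≠ 0 := by
  rw [cocyc_eq]; exact denom_ne_zero _ _

/-- The group `Mp₂(ℤ)` of pairs `(M, φ)` with `M ∈ SL₂(ℤ)` and `φ` holomorphic on `ℍ`,
`φ(τ)² = c τ + d`. -/
@[ext] structure Mp2Z where
  mat : SL(2, ℤ)
  phi : ℍ → ℂ
  holo : MDifferentiable 𝓘(ℂ) 𝓘(ℂ) phi
  sq : ∀ τ, phi τ ^ 2 = cocyc mat τ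

namespace Mp2Z

theorem phi_ne_zero (g : Mp2Z) (τ : ℍ) : g.phi τ ≠ 0 := by
  intro h
  have := g.sq τ
  rw [h] at this
  exact cocyc_ne_zero g.mat τ (by rw [← this]; simp)

theorem holo_smul (g : Mp2Z) (N : SL(2, ℤ)) :
    MDifferentiable 𝓘(ℂ) 𝓘(ℂ) (fun τ : ℍ => g.phi (N • τ)) :=
  g.holo.comp (mdifferentiable_smul (by simp))

/-- `(M, φ(τ)) (M', φ'(τ)) = (M M', φ(M' τ) φ'(τ))`. -/
instance : Mul Mp2Z where
  mul g h :=
    { mat := g.mat * h.mat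
      phi := fun τ => g.phi (h.mat • τ) * h.phi τ
      holo := (g.holo_smul h.mat).mul h.holo
      sq := fun τ => by rw [mul_pow, g.sq, h.sq, cocyc_mul] }

instance : One Mp2Z where
  one :=
    { mat := 1
      phi := fun _ => 1
      holo := mdifferentiable_const
      sq := fun τ => by simp [cocyc] }

instance : Inv Mp2Z where
  inv g :=
    { mat := g.mat⁻¹
      phi := fun τ => (g.phi (g.mat⁻¹ • τ))⁻¹
      holo := by
        have h := g.holo_smul g.mat⁻¹
        rw [mdifferentiable_iff] at h ⊢
        exact h.inv fun z _ => g.phi_ne_zero _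
      sq := fun τ => by
        rw [inv_pow, g.sq]
        have := cocyc_mul g.mat g.mat⁻¹ τ
        rw [mul_inv_cancel] at this
        have h1 : cocyc 1 τ = 1 := by simp [cocyc]
        rw [h1] at this
        exact inv_eq_of_mul_eq_one_right this.symm }

instance : Group Mp2Z :=
  Group.ofLeftAxioms
    (fun a b c => by
      ext τ
      · change ((a.mat * b.mat * c.mat : SL(2, ℤ))) _ _ = (a.mat * (b.mat * c.mat) : SL(2, ℤ)) _ _
        rw [mul_assoc]
      · change a.phi (b.mat • c.mat • τ) * b.phi (c.mat • τ) * c.phi τ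
          = a.phi ((b.mat * c.mat) • τ) * (b.phi (c.mat • τ) * c.phi τ)
        rw [mul_smul, mul_assoc])
    (fun a => by
      ext τ
      · change ((1 * a.mat : SL(2, ℤ))) _ _ = _
        rw [one_mul]
      · exact one_mul _)
    (fun a => by
      ext τ
      · change ((a.mat⁻¹ * a.mat : SL(2, ℤ))) _ _ = (1 : SL(2, ℤ)) _ _
        rw [inv_mul_cancel]
      · change (a.phi (a.mat⁻¹ • a.mat • τ))⁻¹ * a.phi τ = 1
        rw [inv_smul_smul, inv_mul_cancel₀ (a.phi_ne_zero τ)])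

/-- The generator `T = ((1 1; 0 1), 1)`. -/
def T : Mp2Z where
  mat := ModularGroup.T
  phi := fun _ => 1
  holo := mdifferentiable_const
  sq := fun τ => by simp [cocyc, ModularGroup.T]

/-- The generator `S = ((0 -1; 1 0), √τ)`, with the principal branch of the square root. -/
def S : Mp2Z where
  mat := ModularGroup.S
  phi := fun τ => (τ : ℂ) ^ (1 / 2 : ℂ)
  holo := by
    rw [mdifferentiable_iff]
    have h : DifferentiableOn ℂ (fun z : ℂ => z ^ (1 / 2 : ℂ)) {z | 0 < z.im} := fun z hz =>
      (DifferentiableAt.cpow_const differentiableAt_id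
        (Or.inr (ne_of_gt hz))).differentiableWithinAt
    exact h.congr fun z hz => by simp [ofComplex_apply_of_im_pos hz]
  sq := fun τ => by
    rw [← Complex.cpow_nat_mul]
    simp [cocyc, ModularGroup.S]

end Mp2Z

/-! ### The Weil representation -/

section Weil

variable {A : Type*} [AddCommGroup A] [Fintype A]

/-- `e(z) = exp(2 π i z)`. -/
def e (z : ℂ) : ℂ := Complex.exp (2 * Real.pi * Complex.I * z)

/-- `e` on `ℝ / ℤ`. -/
def eCircle (x : UnitAddCircle) : ℂ := (AddCircle.toCircle x : ℂ)

open Classical in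
/-- The matrix of `ρ(T) : 𝔢_γ ↦ e(Q(γ)) 𝔢_γ`. -/
def weilT (Q : A → UnitAddCircle) : Matrix A A ℂ := Matrix.diagonal fun γ => eCircle (Q γ)

/-- The matrix of `ρ(S) : 𝔢_γ ↦ e((b⁻ - b⁺) / 8) / √|A| * ∑ δ, e(-(γ, δ)) 𝔢_δ`, where
`sig = b⁺ - b⁻` and `(γ, δ) = Q(γ + δ) - Q(γ) - Q(δ)`. -/
def weilS (Q : A → UnitAddCircle) (sig : ℤ) : Matrix A A ℂ :=
  Matrix.of fun δ γ =>
    e (-(sig : ℂ) / 8) / (Real.sqrt (Fintype.card A) : ℂ) * eCircle (-(Q (γ + δ) - Q γ - Q δ))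

/-- The Weil representation `ρ` of `Mp₂(ℤ)` on `ℂ[A]`, given by its graph: `IsWeil Q sig g R` says
that `ρ(g)` has the matrix `R` in the basis `(𝔢_γ)`. The representation is determined by `ρ(T)`,
`ρ(S)` and multiplicativity; the elements `S` and `T` generate `Mp₂(ℤ)`, also as a monoid, because
`S` has order `8` and `(S T)³ = S²`. -/
inductive IsWeil (Q : A → UnitAddCircle) (sig : ℤ) : Mp2Z → Matrix A A ℂ → Prop
  | T : IsWeil Q sig Mp2Z.T (weilT Q)
  | S : IsWeil Q sig Mp2Z.S (weilS Q sig)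
  | mul {g h : Mp2Z} {R R' : Matrix A A ℂ} :
      IsWeil Q sig g R → IsWeil Q sig h R' → IsWeil Q sig (g * h) (R * R')

/-- The dual representation `ρ̄`, with the matrix `ρ(g⁻¹)ᵀ` at `g`, again given by its graph. -/
def IsWeilDual (Q : A → UnitAddCircle) (sig : ℤ) (g : Mp2Z) (R : Matrix A A ℂ) : Prop :=
  ∃ R' : Matrix A A ℂ, IsWeil Q sig g⁻¹ R' ∧ R = R'.transpose

end Weil

/-! ### Harmonic weak Maass forms -/

/-- The function `f` on `ℍ`, viewed as a function of a complex variable, is `C^∞` in the real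
sense on the upper half plane. -/
def IsSmooth (f : ℍ → ℂ) : Prop := ContDiffOn ℝ ∞ (f ∘ ofComplex) {z : ℂ | 0 < z.im}

/-- `∂F/∂x` for a function `F` of `z = x + i y`. -/
def partialX (F : ℂ → ℂ) (z : ℂ) : ℂ := fderiv ℝ F z 1

/-- `∂F/∂y` for a function `F` of `z = x + i y`. -/
def partialY (F : ℂ → ℂ) (z : ℂ) : ℂ := fderiv ℝ F z Complex.I

/-- The weight `k` Laplace operator
`Δ_k = -y² (∂²/∂x² + ∂²/∂y²) + i k y (∂/∂x + i ∂/∂y)`. -/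
def laplace (k : ℤ) (f : ℍ → ℂ) (τ : ℍ) : ℂ :=
  -(τ.im : ℂ) ^ 2 * (partialX (partialX (f ∘ ofComplex)) τ + partialY (partialY (f ∘ ofComplex)) τ)
    + Complex.I * k * τ.im *
      (partialX (f ∘ ofComplex) τ + Complex.I * partialY (f ∘ ofComplex) τ)

/-- There is a Fourier polynomial `P(τ) = ∑ c(n) e(n τ)`, with finitely many exponents `n ≤ 0`, all
of them in `E`, such that `f(τ) = P(τ) + O(exp(-ε y))` as `y → ∞`, for some `ε > 0`. -/
def HasPrincipalPart (E : Set ℝ) (f : ℍ → ℂ) : Prop :=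
  ∃ c : ℝ →₀ ℂ, (∀ n ∈ c.support, n ∈ E ∧ n ≤ 0) ∧ ∃ ε : ℝ, 0 < ε ∧
    (fun τ : ℍ => f τ - c.sum fun n a => a * e (n * τ)) =O[atImInfty]
      fun τ : ℍ => Real.exp (-ε * τ.im)

/-- The slash operator `(f |_k M)(τ) = (c τ + d)^{-k} f(M τ)`. -/
def slashSL (k : ℤ) (M : SL(2, ℤ)) (f : ℍ → ℂ) (τ : ℍ) : ℂ := cocyc M τ ^ (-k) * f (M • τ)

section closure

theorem isOpen_im_pos : IsOpen {z : ℂ | 0 < z.im} := isOpen_lt continuous_const Complex.continuous_im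

theorem IsSmooth.add {f g : ℍ → ℂ} (hf : IsSmooth f) (hg : IsSmooth g) : IsSmooth (f + g) :=
  ContDiffOn.add hf hg

theorem IsSmooth.smul {f : ℍ → ℂ} (a : ℂ) (hf : IsSmooth f) : IsSmooth (a • f) :=
  ContDiffOn.const_smul a hf

theorem fderiv_apply_add {F G : ℂ → ℂ} (hF : ContDiffOn ℝ ∞ F {z : ℂ | 0 < z.im})
    (hG : ContDiffOn ℝ ∞ G {z : ℂ | 0 < z.im}) (v : ℂ) :
    Set.EqOn (fun z => fderiv ℝ (F + G) z v) ((fun z => fderiv ℝ F z v) + fun z => fderiv ℝ G z v)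
      {z : ℂ | 0 < z.im} := by
  intro z hz
  have h1 := ((hF.contDiffAt (isOpen_im_pos.mem_nhds hz)).differentiableAt (by simp))
  have h2 := ((hG.contDiffAt (isOpen_im_pos.mem_nhds hz)).differentiableAt (by simp))
  simp [fderiv_add h1 h2]

theorem contDiffOn_fderiv_apply {F : ℂ → ℂ} (hF : ContDiffOn ℝ ∞ F {z : ℂ | 0 < z.im}) (v : ℂ) :
    ContDiffOn ℝ ∞ (fun z => fderiv ℝ F z v) {z : ℂ | 0 < z.im} :=
  (hF.fderiv_of_isOpen isOpen_im_pos (by simp)).clm_apply contDiffOn_const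

theorem fderiv_fderiv_apply_add {F G : ℂ → ℂ} (hF : ContDiffOn ℝ ∞ F {z : ℂ | 0 < z.im})
    (hG : ContDiffOn ℝ ∞ G {z : ℂ | 0 < z.im}) (v : ℂ) {z : ℂ} (hz : 0 < z.im) :
    fderiv ℝ (fun z => fderiv ℝ (F + G) z v) z v =
      fderiv ℝ (fun z => fderiv ℝ F z v) z v + fderiv ℝ (fun z => fderiv ℝ G z v) z v := by
  rw [((fderiv_apply_add hF hG v).eventuallyEq_of_mem (isOpen_im_pos.mem_nhds hz)).fderiv_eq]
  exact fderiv_apply_add (contDiffOn_fderiv_apply hF v) (contDiffOn_fderiv_apply hG v) v hz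

theorem laplace_add (k : ℤ) {f g : ℍ → ℂ} (hf : IsSmooth f) (hg : IsSmooth g) (τ : ℍ) :
    laplace k (f + g) τ = laplace k f τ + laplace k g τ := by
  have hτ : 0 < (τ : ℂ).im := τ.im_pos
  have hc : (f + g) ∘ ofComplex = (f ∘ ofComplex) + (g ∘ ofComplex) := rfl
  have h1 := fderiv_apply_add hf hg 1 hτ
  have h2 := fderiv_apply_add hf hg Complex.I hτ
  have h3 := fderiv_fderiv_apply_add hf hg 1 hτ
  have h4 := fderiv_fderiv_apply_add hf hg Complex.I hτ
  simp only [Pi.add_apply] at h1 h2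
  simp only [laplace, partialX, partialY, hc]
  unfold partialX partialY
  rw [h1, h2, h3, h4]
  ring

theorem laplace_smul (k : ℤ) (a : ℂ) (f : ℍ → ℂ) (τ : ℍ) :
    laplace k (a • f) τ = a * laplace k f τ := by
  have hc : (a • f) ∘ ofComplex = a • (f ∘ ofComplex) := rfl
  have h (F : ℂ → ℂ) (v : ℂ) : (fun z => fderiv ℝ (a • F) z v) = a • fun z => fderiv ℝ F z v := by
    funext z
    simp [fderiv_const_smul_field]
  have hX (F : ℂ → ℂ) : partialX (a • F) = a • partialX F := h F 1
  have hY (F : ℂ → ℂ) : partialY (a • F) = a • partialY F := h F Complex.I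
  simp only [laplace, hc, hX, hY, Pi.smul_apply, smul_eq_mul]
  ring

theorem hasPrincipalPart_zero (E : Set ℝ) : HasPrincipalPart E 0 :=
  ⟨0, by simp, 1, one_pos, by simpa using! Asymptotics.isBigO_zero _ _⟩

theorem HasPrincipalPart.add {E : Set ℝ} {f g : ℍ → ℂ} (hf : HasPrincipalPart E f)
    (hg : HasPrincipalPart E g) : HasPrincipalPart E (f + g) := by
  classical
  obtain ⟨c, hc, ε, hε, h⟩ := hf
  obtain ⟨c', hc', ε', hε', h'⟩ := hg
  refine ⟨c + c', fun n hn => ?_, min ε ε', lt_min hε hε', ?_⟩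
  · rcases Finset.mem_union.mp (Finsupp.support_add hn) with h1 | h1
    exacts [hc n h1, hc' n h1]
  · have mono {δ : ℝ} (hδ : min ε ε' ≤ δ) : (fun τ : ℍ => Real.exp (-δ * τ.im)) =O[atImInfty]
        fun τ : ℍ => Real.exp (-(min ε ε') * τ.im) := by
      refine Asymptotics.IsBigO.of_bound 1 (Filter.Eventually.of_forall fun τ => ?_)
      rw [one_mul, Real.norm_eq_abs, Real.norm_eq_abs, Real.abs_exp, Real.abs_exp, Real.exp_le_exp]
      nlinarith [τ.im_pos]
    refine ((h.trans (mono (min_le_left _ _))).add (h'.trans (mono (min_le_right _ _)))).congr_left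
      fun τ => ?_
    rw [Finsupp.sum_add_index' (by simp) (by intros; ring)]
    simp only [Pi.add_apply]
    ring

theorem HasPrincipalPart.smul {E : Set ℝ} {f : ℍ → ℂ} (a : ℂ) (hf : HasPrincipalPart E f) :
    HasPrincipalPart E (a • f) := by
  obtain ⟨c, hc, ε, hε, h⟩ := hf
  refine ⟨a • c, fun n hn => hc n (Finsupp.support_smul hn), ε, hε, ?_⟩
  refine (h.const_mul_left a).congr_left fun τ => ?_
  rw [Finsupp.sum_smul_index' (by simp), Finsupp.sum, Finsupp.sum, mul_sub, Finset.mul_sum]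
  simp only [Pi.smul_apply, smul_eq_mul, mul_assoc]

theorem slashSL_add (k : ℤ) (M : SL(2, ℤ)) (f g : ℍ → ℂ) :
    slashSL k M (f + g) = slashSL k M f + slashSL k M g := by
  funext τ; simp [slashSL, mul_add]

theorem slashSL_smul (k : ℤ) (M : SL(2, ℤ)) (a : ℂ) (f : ℍ → ℂ) :
    slashSL k M (a • f) = a • slashSL k M f := by
  funext τ; simp [slashSL]; ring

theorem slashSL_zero (k : ℤ) (M : SL(2, ℤ)) : slashSL k M 0 = 0 := by
  funext τ; simp [slashSL]

theorem isSmooth_zero : IsSmooth 0 := contDiffOn_const (c := (0 : ℂ))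

theorem laplace_zero (k : ℤ) (τ : ℍ) : laplace k 0 τ = 0 := by
  have := laplace_smul k 0 0 τ
  simpa using this

end closure

/-- The space `H_k(Γ₀(N), χ)` of harmonic weak Maass forms of weight `k` for `Γ₀(N)` with
Nebentypus `χ`. At the cusp `∞` the principal part has integral exponents; at the cusp `M ∞`,
`M ∈ SL₂(ℤ)`, it is the principal part of `f |_k M`, a Fourier polynomial in `e(-τ / N)`. -/
def maassForms (N : ℕ) (χ : DirichletCharacter ℂ N) (k : ℤ) : Submodule ℂ (ℍ → ℂ) where
  carrier := {f | IsSmooth f ∧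
    (∀ M ∈ CongruenceSubgroup.Gamma0 N, ∀ τ : ℍ,
      f (M • τ) = χ ((M 1 1 : ℤ) : ZMod N) * cocyc M τ ^ k * f τ) ∧
    (∀ τ, laplace k f τ = 0) ∧
    HasPrincipalPart (Set.range fun n : ℤ => (n : ℝ)) f ∧
    ∀ M : SL(2, ℤ), HasPrincipalPart (Set.range fun n : ℤ => (n : ℝ) / N) (slashSL k M f)}
  zero_mem' := ⟨isSmooth_zero, by simp, laplace_zero k, hasPrincipalPart_zero _, fun M => by
    rw [slashSL_zero]; exact hasPrincipalPart_zero _⟩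
  add_mem' := by
    rintro f g ⟨h1, h2, h3, h4, h5⟩ ⟨h1', h2', h3', h4', h5'⟩
    refine ⟨h1.add h1', fun M hM τ => ?_, fun τ => ?_, h4.add h4', fun M => ?_⟩
    · simp only [Pi.add_apply, h2 M hM τ, h2' M hM τ]; ring
    · rw [laplace_add k h1 h1', h3, h3', add_zero]
    · rw [slashSL_add]; exact (h5 M).add (h5' M)
  smul_mem' := by
    rintro a f ⟨h1, h2, h3, h4, h5⟩
    refine ⟨h1.smul a, fun M hM τ => ?_, fun τ => ?_, h4.smul a, fun M => ?_⟩
    · simp only [Pi.smul_apply, smul_eq_mul, h2 M hM τ]; ring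
    · rw [laplace_smul, h3, mul_zero]
    · rw [slashSL_smul]; exact (h5 M).smul a

/-- The space of `ℂ[A]`-valued harmonic weak Maass forms of weight `k` for a representation of
`Mp₂(ℤ)` with the graph `ρ` (`ρ g R`: the element `g` acts by the matrix `R`), with Fourier
exponents of the component at `γ` in `ℤ + Q(γ)`. A function `f = ∑ f_γ 𝔢_γ` is given by its
components `f τ γ = f_γ(τ)`. -/
def vectorMaassForms {A : Type*} [Fintype A] (ρ : Mp2Z → Matrix A A ℂ → Prop)
    (Q : A → UnitAddCircle) (k : ℤ) : Submodule ℂ (ℍ → A → ℂ) where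
  carrier := {f | (∀ γ, IsSmooth fun τ => f τ γ) ∧
    (∀ g R, ρ g R → ∀ τ : ℍ, f (g.mat • τ) = g.phi τ ^ (2 * k) • R.mulVec (f τ)) ∧
    (∀ γ τ, laplace k (fun τ => f τ γ) τ = 0) ∧
    ∀ γ, HasPrincipalPart {n : ℝ | (n : UnitAddCircle) = Q γ} fun τ => f τ γ}
  zero_mem' := ⟨fun _ => isSmooth_zero, by simp, fun _ => laplace_zero k,
    fun _ => hasPrincipalPart_zero _⟩
  add_mem' := by
    rintro f g ⟨h1, h2, h3, h4⟩ ⟨h1', h2', h3', h4'⟩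
    refine ⟨fun γ => (h1 γ).add (h1' γ), fun g R hR τ => ?_, fun γ τ => ?_,
      fun γ => (h4 γ).add (h4' γ)⟩
    · simp only [Pi.add_apply, h2 g R hR τ, h2' g R hR τ, Matrix.mulVec_add, smul_add]
    · exact (laplace_add k (h1 γ) (h1' γ) τ).trans (by rw [h3, h3', add_zero])
  smul_mem' := by
    rintro a f ⟨h1, h2, h3, h4⟩
    refine ⟨fun γ => (h1 γ).smul a, fun g R hR τ => ?_, fun γ τ => ?_, fun γ => (h4 γ).smul a⟩
    · simp only [Pi.smul_apply, h2 g R hR τ, Matrix.mulVec_smul, smul_comm a]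
    · exact (laplace_smul k a _ τ).trans (by rw [h3, mul_zero])

/-- `H_{k, ρ_L}`. -/
def vectorMaass {V : Type*} [AddCommGroup V] [Module ℚ V] (L : EvenLattice V) (k : ℤ) :
    Submodule ℂ (ℍ → L.Disc → ℂ) :=
  vectorMaassForms (IsWeil L.discQ ((L.bPlus : ℤ) - L.bMinus)) L.discQ k

/-- `H_{k, ρ̄_L}`; here the Fourier exponents of the component at `γ` lie in `ℤ - Q(γ)`. -/
def vectorMaassDual {V : Type*} [AddCommGroup V] [Module ℚ V] (L : EvenLattice V) (k : ℤ) :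
    Submodule ℂ (ℍ → L.Disc → ℂ) :=
  vectorMaassForms (IsWeilDual L.discQ ((L.bPlus : ℤ) - L.bMinus)) (fun γ => -L.discQ γ) k

/-! ### Fourier expansions and the map `f ↦ F` -/

/-- The incomplete Gamma function `Γ(a, y) = ∫_y^∞ exp(-t) t^(a - 1) dt`. -/
def incGamma (a y : ℝ) : ℝ := ∫ t in Set.Ioi y, Real.exp (-t) * t ^ (a - 1)

/-- `c_f(n, y) = c_f⁺(n) + c_f⁻(n) Γ(1 - k, 4 π |n| y)`, for coefficients `cp = c_f⁺` and
`cm = c_f⁻`. -/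
def coeff (k : ℤ) (cp cm : ℤ → ℂ) (n : ℤ) (y : ℝ) : ℂ :=
  cp n + cm n * (incGamma (1 - k) (4 * Real.pi * |(n : ℝ)| * y) : ℂ)

/-- `f = f⁺ + f⁻` with `f⁺ = ∑_{n ≫ -∞} cp(n) qⁿ` and
`f⁻ = ∑_{n < 0} cm(n) Γ(1 - k, 4 π |n| y) qⁿ`. -/
def IsFourierExpansion (k : ℤ) (f : ℍ → ℂ) (cp cm : ℤ → ℂ) : Prop :=
  (∃ n₀ : ℤ, ∀ n < n₀, cp n = 0) ∧ (∀ n, 0 ≤ n → cm n = 0) ∧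
  ∃ fp fm : ℍ → ℂ,
    (∀ τ : ℍ, HasSum (fun n : ℤ => cp n * e (n * τ)) (fp τ)) ∧
    (∀ τ : ℍ, HasSum (fun n : ℤ =>
      cm n * (incGamma (1 - k) (4 * Real.pi * |(n : ℝ)| * τ.im) : ℂ) * e (n * τ)) (fm τ)) ∧
    ∀ τ, f τ = fp τ + fm τ

/-- The character `(· / p)`, with complex values. -/
def legendreChar (p : ℕ) [Fact p.Prime] : DirichletCharacter ℂ p :=
  (quadraticChar (ZMod p)).ringHomComp (Int.castRingHom ℂ)

/-- `H_k^ε(Γ₀(p), (· / p))`: the coefficients `c_f^±(n)` vanish if `(n / p) = -ε`. -/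
def maassPlus (p : ℕ) [Fact p.Prime] (k ε : ℤ) : Submodule ℂ (ℍ → ℂ) where
  carrier := {f | f ∈ maassForms p (legendreChar p) k ∧
    ∃ cp cm : ℤ → ℂ, IsFourierExpansion k f cp cm ∧
      ∀ n : ℤ, legendreSym p n = -ε → cp n = 0 ∧ cm n = 0}
  zero_mem' := ⟨zero_mem _, 0, 0, ⟨⟨0, by simp⟩, by simp, 0, 0, fun τ => by simp,
    fun τ => by simp, by simp⟩, by simp⟩
  add_mem' := by
    rintro f g ⟨hf, cp, cm, ⟨⟨n₀, h1⟩, h2, fp, fm, h3, h4, h5⟩, h6⟩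
      ⟨hg, cp', cm', ⟨⟨n₀', h1'⟩, h2', fp', fm', h3', h4', h5'⟩, h6'⟩
    refine ⟨add_mem hf hg, cp + cp', cm + cm', ⟨⟨min n₀ n₀', fun n hn => ?_⟩, fun n hn => ?_,
      fp + fp', fm + fm', fun τ => ?_, fun τ => ?_, fun τ => ?_⟩, fun n hn => ?_⟩
    · simp [h1 n (lt_of_lt_of_le hn (min_le_left _ _)), h1' n (lt_of_lt_of_le hn (min_le_right _ _))]
    · simp [h2 n hn, h2' n hn]
    · simpa [add_mul] using (h3 τ).add (h3' τ)
    · simpa [add_mul] using (h4 τ).add (h4' τ)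
    · simp only [Pi.add_apply, h5, h5']; ring
    · simp [h6 n hn, h6' n hn]
  smul_mem' := by
    rintro a f ⟨hf, cp, cm, ⟨⟨n₀, h1⟩, h2, fp, fm, h3, h4, h5⟩, h6⟩
    refine ⟨Submodule.smul_mem _ a hf, a • cp, a • cm, ⟨⟨n₀, fun n hn => ?_⟩, fun n hn => ?_,
      a • fp, a • fm, fun τ => ?_, fun τ => ?_, fun τ => ?_⟩, fun n hn => ?_⟩
    · simp [h1 n hn]
    · simp [h2 n hn]
    · simpa [mul_assoc] using (h3 τ).mul_left a
    · simpa [mul_assoc] using (h4 τ).mul_left a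
    · simp only [Pi.smul_apply, smul_eq_mul, h5]; ring
    · simp [h6 n hn]

open Classical in
/-- `F` is the image of `f` under `f ↦ F = ∑ F_γ 𝔢_γ`,
`F_γ(τ) = s(γ) ∑_{n ≡ p Q(γ) mod p} c_f(n, y / p) q^{n / p}`,
where `s(0) = 2` and `s(γ) = 1` for `γ ≠ 0`. The congruence says `n / p = Q(γ)` in `ℝ / ℤ`. -/
def IsLift {A : Type*} [AddCommGroup A] (p : ℕ) (Q : A → UnitAddCircle) (k : ℤ) (f : ℍ → ℂ)
    (F : ℍ → A → ℂ) : Prop :=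
  ∀ cp cm : ℤ → ℂ, IsFourierExpansion k f cp cm → ∀ (τ : ℍ) (γ : A),
    HasSum (fun n : {n : ℤ // (((n : ℝ) / p : ℝ) : UnitAddCircle) = Q γ} =>
      (if γ = 0 then 2 else 1) * (coeff k cp cm n (τ.im / p) * e (((n : ℤ) : ℂ) / p * τ))) (F τ γ)

end MaassLift

end

/-! For `j` mod `p` put t_j(τ) = f((τ + j)/p) (`translate`) and s_r = ∑_j e(-jr/p) t_j
(`translateSum`), which is `p` times the part of f(τ/p) with exponents n/p, n ≡ r. Identifying the
discriminant group with ℤ/p, the lift is F_x = s(x) p⁻¹ s_{λx²}. Smoothness, harmonicity and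
principal parts pass from f to F, and the law under `T` is immediate. The law under `S` is the
substance.

For j ≠ 0 a matrix of Γ₀(p) gives t_j(-1/τ) = (j/p) τ^k t_{-1/j}(τ) (`translate_S`). Only t_0(-1/τ)
= f(-1/(pτ)) is out of reach of Γ₀(p). The plus condition supplies the missing relation. Evaluating
∑_y s_{λy²} once by Gauss sums and once by counting square roots expresses s_0 through t_0 and ∑
(j/p) t_j (`translateSum_zero_eq`). Used at τ and at -1/τ, this yields t_0(-1/τ) = τ^k g⁻¹ s_0(τ),
where g = ∑ e(λx²/p) (`translate_zero_S`). The whole `S`-law follows (`liftComp_S`).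

The inverse is f(τ) = ½ ∑_x F_x(pτ). Here ∑ F_x is g times the pairing of F with the row vector
𝔢₀ρ(S), and the rows 𝔢₀ρ(M) depend only on the bottom row of M mod p (`weilRow`). Hence f is
covariant under Γ₀(p), and at the other cusp it is governed by F_0 alone. The plus condition holds
because F_x(pτ) has only exponents ≡ λx². That the two maps are mutually inverse uses F_{-x} = F_x,
which comes from S² and the parity of k.

Two further inputs are needed. The constant e(-sig/8)/√p in ρ(S) must equal g⁻¹. This is Milgram's
formula, proved by passing to an orthogonal sublattice and evaluating ∑ e(t²/4a) from the behaviour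
of a theta series near a rational point. Moreover, ½ ∑ F_x(pτ) must have an expansion in qⁿ and
Γ(1-k, 4π|n|y) qⁿ; each Fourier mode solves an ordinary differential equation whose solutions are of
this kind once the growth condition is imposed. The dual representation is the same case with -Q, -λ
and -sig. -/

noncomputable section

namespace MaassLift

/-! ### Quadratic Gauss sums modulo `p` -/

section GaussSums

variable {p : ℕ} [Fact p.Prime]

local notation "ψ" => ZMod.stdAddChar
local notation "χ" => legendreChar p

theorem two_ne_zero_zmod (hp : p ≠ 2) : (2 : ZMod p) ≠ 0 := by
  intro h
  have h' : ((2 : ℕ) : ZMod p) = 0 := by exact_mod_cast h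
  rw [ZMod.natCast_eq_zero_iff] at h'
  exact hp ((Nat.prime_dvd_prime_iff_eq Fact.out Nat.prime_two).mp h')

theorem legendreChar_apply (x : ZMod p) : χ x = ((quadraticChar (ZMod p) x : ℤ) : ℂ) := rfl

theorem legendreChar_isQuadratic : (χ).IsQuadratic :=
  (quadraticChar_isQuadratic (ZMod p)).comp _

theorem legendreChar_ne_one (hp : p ≠ 2) : χ ≠ 1 := by
  intro h
  obtain ⟨a, ha⟩ := quadraticChar_exists_neg_one' (F := ZMod p)
    (by rwa [ZMod.ringChar_zmod_n])
  have h1 : χ (a : ZMod p) = 1 := by rw [h, MulChar.one_apply_coe]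
  rw [legendreChar_apply, ha] at h1
  norm_num at h1

theorem legendreChar_zero : χ 0 = 0 := by simp [legendreChar_apply]

theorem legendreChar_sq {x : ZMod p} (hx : x ≠ 0) : χ x * χ x = 1 := by
  rw [legendreChar_apply, ← Int.cast_mul, ← sq, quadraticChar_sq_one hx, Int.cast_one]

theorem legendreChar_inv (x : ZMod p) : χ x⁻¹ = χ x := by
  rcases eq_or_ne x 0 with rfl | hx
  · simp
  · have h : χ x * χ x⁻¹ = 1 := by rw [← map_mul, mul_inv_cancel₀ hx, map_one]
    have h' := legendreChar_sq hx
    have h0 : χ x ≠ 0 := fun h0 => by simp [h0] at h'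
    exact mul_left_cancel₀ h0 (h.trans h'.symm)

theorem legendreChar_intCast (n : ℤ) : χ (n : ZMod p) = (legendreSym p n : ℂ) := rfl

theorem sum_stdAddChar_mul (a : ZMod p) :
    ∑ d : ZMod p, ψ (a * d) = if a = 0 then (p : ℂ) else 0 := by
  have h := AddChar.sum_mulShift a (ZMod.isPrimitive_stdAddChar p)
  simp only [ZMod.card] at h
  rw [← Nat.cast_zero (R := ℂ), ← Nat.cast_ite, ← h]
  exact Finset.sum_congr rfl fun d _ => by rw [mul_comm]

/-- A residue `r` has exactly `1 + χ r` square roots. -/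
theorem sum_sq_eq_sum (hp : p ≠ 2) (D : ZMod p → ℂ) :
    ∑ x : ZMod p, D (x ^ 2) = ∑ r : ZMod p, (1 + χ r) * D r := by
  rw [← Finset.sum_fiberwise_of_maps_to (g := fun x : ZMod p => x ^ 2) (t := Finset.univ)
    (fun _ _ => Finset.mem_univ _)]
  refine Finset.sum_congr rfl fun r _ => ?_
  rw [Finset.sum_congr rfl fun x hx => by rw [(Finset.mem_filter.mp hx).2], Finset.sum_const,
    nsmul_eq_mul]
  congr 1
  have h := quadraticChar_card_sqrts (F := ZMod p) (by rwa [ZMod.ringChar_zmod_n]) r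
  have h2 : ({x : ZMod p | x ^ 2 = r} : Set (ZMod p)).toFinset
      = Finset.univ.filter fun x : ZMod p => x ^ 2 = r := by ext; simp
  rw [h2] at h
  rw [legendreChar_apply, add_comm]
  exact_mod_cast h

/-- The Gauss sum `∑ x, e(l x² / p)`. -/
def quadGauss (l : ZMod p) : ℂ := ∑ x : ZMod p, ψ (l * x ^ 2)

/-- In the weight `1 + χ r` the constant part sums to zero by orthogonality; the part with `χ r` is
the Gauss sum of `χ` twisted by `l`. -/
theorem quadGauss_eq_gaussSum (hp : p ≠ 2) {l : ZMod p} (hl : l ≠ 0) :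
    quadGauss l = χ l * gaussSum χ ψ := by
  have h := sum_sq_eq_sum hp (fun r => ψ (l * r))
  have h0 := sum_stdAddChar_mul l
  rw [if_neg hl] at h0
  rw [quadGauss, h]
  simp only [add_mul, one_mul, Finset.sum_add_distrib, h0, zero_add]
  have h2 : ∑ r : ZMod p, χ r * ψ (l * r) = gaussSum χ ((ψ : AddChar (ZMod p) ℂ).mulShift l) := by
    simp [gaussSum]
  rw [h2]
  have h3 := gaussSum_mulShift χ (ψ : AddChar (ZMod p) ℂ) (Units.mk0 l hl)
  simp only [Units.val_mk0] at h3
  rw [← h3, ← mul_assoc, legendreChar_sq hl, one_mul]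

theorem quadGauss_mul (hp : p ≠ 2) {l t : ZMod p} (hl : l ≠ 0) (ht : t ≠ 0) :
    quadGauss (t * l) = χ t * quadGauss l := by
  rw [quadGauss_eq_gaussSum hp hl, quadGauss_eq_gaussSum hp (mul_ne_zero ht hl), map_mul, mul_assoc]

theorem quadGauss_sq (hp : p ≠ 2) {l : ZMod p} (hl : l ≠ 0) :
    quadGauss l * quadGauss l = χ (-1) * p := by
  have h := gaussSum_sq (legendreChar_ne_one hp) legendreChar_isQuadratic
    (ZMod.isPrimitive_stdAddChar p)
  rw [ZMod.card, sq] at h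
  rw [quadGauss_eq_gaussSum hp hl, mul_mul_mul_comm, legendreChar_sq hl, one_mul]
  exact h

theorem quadGauss_ne_zero (hp : p ≠ 2) {l : ZMod p} (hl : l ≠ 0) : quadGauss l ≠ 0 := by
  intro h
  have h1 := quadGauss_sq hp hl
  rw [h, mul_zero] at h1
  have h2 := legendreChar_sq (p := p) (x := -1) (by simp)
  rcases mul_eq_zero.mp h1.symm with h3 | h3
  · simp [h3] at h2
  · exact (Fact.out : p.Prime).ne_zero (by exact_mod_cast h3)

/-- Completing the square: the shift `d ↦ d + c / t` removes the linear term. -/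
theorem sum_stdAddChar_quadratic (hp : p ≠ 2) {l t : ZMod p} (hl : l ≠ 0) (ht : t ≠ 0)
    (c : ZMod p) :
    ∑ d : ZMod p, ψ (t * l * d ^ 2 - 2 * l * c * d)
      = χ t * quadGauss l * ψ (-(l * c ^ 2 * t⁻¹)) := by
  rw [← quadGauss_mul hp hl ht, quadGauss, Finset.sum_mul,
    ← Equiv.sum_comp (Equiv.addRight (c * t⁻¹))]
  refine Finset.sum_congr rfl fun d _ => ?_
  rw [← AddChar.map_add_eq_mul]
  congr 1
  simp only [Equiv.coe_addRight]
  field_simp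
  ring

/-- The weight `1 + χ r` is 2 at every nonzero `r` where `D (l * r)` may be nonzero, and 1 at `r =
0`. The deficit at 0 is what the factor `s(0) = 2` of the lift compensates. -/
theorem sum_mul_sq_of_eq_zero (hp : p ≠ 2) {l : ZMod p} (hl : l ≠ 0) (D : ZMod p → ℂ)
    (hD : ∀ r, χ r = -χ l → D r = 0) :
    ∑ x : ZMod p, D (l * x ^ 2) = 2 * ∑ r : ZMod p, D r - D 0 := by
  rw [sum_sq_eq_sum hp fun r => D (l * r), ← Equiv.sum_comp (Equiv.mulLeft₀ l hl) D]
  change _ = 2 * ∑ r, D (l * r) - D 0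
  rw [Finset.mul_sum, eq_sub_iff_add_eq,
    ← Finset.add_sum_erase _ _ (Finset.mem_univ (0 : ZMod p)),
    ← Finset.add_sum_erase _ (fun r => 2 * D (l * r)) (Finset.mem_univ (0 : ZMod p))]
  have h : ∑ r ∈ Finset.univ.erase (0 : ZMod p), (1 + χ r) * D (l * r)
      = ∑ r ∈ Finset.univ.erase (0 : ZMod p), 2 * D (l * r) := by
    refine Finset.sum_congr rfl fun r hr => ?_
    have hr0 := Finset.ne_of_mem_erase hr
    rcases mul_self_eq_one_iff.mp (legendreChar_sq hr0) with h1 | h1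
    · rw [h1]; norm_num
    · rw [hD (l * r) (by rw [map_mul, h1]; ring)]; simp
  rw [h, mul_zero, legendreChar_zero]
  ring

end GaussSums

/-! ### The row vectors `𝔢₀ ρ(M)` -/

section Rows

variable {p : ℕ} [Fact p.Prime]

local notation "ψ" => ZMod.stdAddChar
local notation "χ" => legendreChar p

open Classical in
/-- The row of index `0` of the Weil representation modulo `p`, at a matrix with bottom row
`(c, d)`. -/
def weilRow (l c d x : ZMod p) : ℂ :=
  if c = 0 then (if x = 0 then χ d else 0)
  else (quadGauss l)⁻¹ * χ c * ψ (d * c⁻¹ * l * x ^ 2)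

/-- Together with `weilRow_mul_S`, this shows that right multiplication by `ρ(T)` and `ρ(S)` moves
the rows as `(c, d) ↦ (c, c + d)` and `(c, d) ↦ (d, -c)`. No matrix of a general `ρ(M)` has to be
computed. -/
theorem weilRow_mul_T (l c d x : ZMod p) :
    weilRow l c d x * ψ (l * x ^ 2) = weilRow l c (c + d) x := by
  unfold weilRow
  split_ifs with hc hx
  · simp [hc, hx]
  · simp
  · rw [mul_assoc, ← AddChar.map_add_eq_mul]
    congr 2
    field_simp
    ring

/-- For `c = 0` the row is supported at 0. For `d = 0` it is constant, and orthogonality with `g² =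
χ(-1) p` returns a row supported at 0. Otherwise complete the square. -/
theorem weilRow_mul_S (hp : p ≠ 2) {l : ZMod p} (hl : l ≠ 0) {c d : ZMod p} (hcd : c ≠ 0 ∨ d ≠ 0)
    (x : ZMod p) :
    ∑ y : ZMod p, weilRow l c d y * ((quadGauss l)⁻¹ * ψ (-(2 * l * x * y)))
      = weilRow l d (-c) x := by
  have hg := quadGauss_ne_zero hp hl
  have h2 := two_ne_zero_zmod hp
  rcases eq_or_ne c 0 with rfl | hc
  · have hd : d ≠ 0 := by simpa using hcd
    simp [weilRow, hd, mul_comm]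
  rcases eq_or_ne d 0 with rfl | hd
  · have h := sum_stdAddChar_mul (-(2 * l * x))
    have h1 : (-(2 * l * x) = 0) ↔ x = 0 := by simp [h2, hl]
    simp only [h1] at h
    have h3 : ∀ y : ZMod p, weilRow l c 0 y * ((quadGauss l)⁻¹ * ψ (-(2 * l * x * y)))
        = (quadGauss l)⁻¹ * (quadGauss l)⁻¹ * χ c * ψ (-(2 * l * x) * y) := by
      intro y
      simp only [weilRow, if_neg hc, zero_mul, AddChar.map_zero_eq_one, neg_mul]
      ring
    simp only [h3]
    rw [← Finset.mul_sum, h, ← mul_inv, quadGauss_sq hp hl]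
    have h4 := legendreChar_sq (p := p) (x := -1) (by simp)
    have hp0 : (p : ℂ) ≠ 0 := by exact_mod_cast (Fact.out : p.Prime).ne_zero
    have h5 : χ (-1) ≠ 0 := fun h => by simp [h] at h4
    unfold weilRow
    rw [if_pos rfl]
    split_ifs with hx
    · rw [show -c = (-1) * c by ring, map_mul]
      field_simp
      rw [sq, h4, one_mul]
    · simp
  · have h3 : ∀ y : ZMod p, weilRow l c d y * ((quadGauss l)⁻¹ * ψ (-(2 * l * x * y)))
        = (quadGauss l)⁻¹ * (quadGauss l)⁻¹ * χ c
          * ψ ((d * c⁻¹) * l * y ^ 2 - 2 * l * x * y) := by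
      intro y
      simp only [weilRow, if_neg hc]
      rw [sub_eq_add_neg, AddChar.map_add_eq_mul]
      ring
    simp only [h3]
    rw [← Finset.mul_sum, sum_stdAddChar_quadratic hp hl (mul_ne_zero hd (inv_ne_zero hc)),
      map_mul, legendreChar_inv]
    simp only [weilRow, if_neg hd]
    have h4 := legendreChar_sq hc
    have h5 : -(l * x ^ 2 * (d * c⁻¹)⁻¹) = -c * d⁻¹ * l * x ^ 2 := by
      field_simp
    rw [h5]
    field_simp
    rw [sq, h4, one_mul]

end Rows

/-! ### The Gauss sums `∑ t mod 2a, e(t² / 4a)` -/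

section ThetaGauss

open Filter Topology Complex

theorem summable_exp_neg_int_sq : Summable fun n : ℤ => Real.exp (-(n : ℝ) ^ 2) := by
  -- At the point `i / π` the theta term `exp(π i n² τ)` is `exp(-n²)`.
  have h := (summable_jacobiTheta₂_term_iff 0 (Complex.I / Real.pi)).mpr
    (by simpa [Complex.div_im] using Real.pi_pos)
  refine h.norm.congr fun n => ?_
  rw [jacobiTheta₂_term, Complex.norm_exp]
  congr 1
  have : (2 * Real.pi * Complex.I * n * 0 + Real.pi * Complex.I * n ^ 2 * (Complex.I / Real.pi) : ℂ)
      = ((-(n : ℝ) ^ 2 : ℝ) : ℂ) := by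
    have hp : (Real.pi : ℂ) ≠ 0 := by exact_mod_cast Real.pi_ne_zero
    push_cast
    field_simp
    ring_nf
    simp
  rw [this, ofReal_re]

/-- Dominated convergence against `exp(-n²)`: as the Gaussian narrows, only the term `n = 0`
survives. -/
theorem tendsto_tsum_of_norm_le_exp {α : ℝ → ℝ} (hα : Tendsto α atTop atTop) (f : ℝ → ℤ → ℂ)
    (hf : ∀ᶠ s in atTop, ∀ n, ‖f s n‖ ≤ Real.exp (-α s * (n : ℝ) ^ 2)) (h0 : ∀ᶠ s in atTop, f s 0 = 1) :
    Tendsto (fun s => ∑' n, f s n) atTop (𝓝 1) := by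
  have key := tendsto_tsum_of_dominated_convergence (𝓕 := atTop) (f := f)
    (g := fun n => if n = 0 then 1 else 0) summable_exp_neg_int_sq (fun n => ?_) ?_
  · simpa using key
  · split_ifs with hn
    · subst hn
      exact tendsto_const_nhds.congr' (h0.mono fun s hs => hs.symm)
    · have hn' : 0 < (n : ℝ) ^ 2 := by positivity
      refine squeeze_zero_norm' (hf.mono fun s hs => hs n) ?_
      refine Real.tendsto_exp_atBot.comp ?_
      simp only [neg_mul]
      exact tendsto_neg_atTop_atBot.comp (hα.atTop_mul_const hn')
  · filter_upwards [hf, hα.eventually_ge_atTop 1] with s hs h1 n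
    refine (hs n).trans (Real.exp_le_exp.mpr ?_)
    nlinarith [sq_nonneg (n : ℝ)]

/-- The splitting of a theta series into residue classes. -/
theorem tsum_exp_eq_sum_residues (N : ℕ) [NeZero N] (hN : Even N) {ε : ℝ} (hε : 0 < ε) :
    ∑' n : ℤ, cexp (-Real.pi * (ε - Complex.I / N) * (n : ℂ) ^ 2)
      = ∑ t ∈ Finset.range N, cexp (Real.pi * Complex.I * t ^ 2 / N)
        * ∑' m : ℤ, cexp (-Real.pi * ε * (t + N * m) ^ 2) := by
  have hN0 : (N : ℂ) ≠ 0 := by exact_mod_cast NeZero.ne N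
  have hs : Summable fun n : ℤ => cexp (-Real.pi * (ε - Complex.I / N) * (n : ℂ) ^ 2) := by
    have h := (summable_jacobiTheta₂_term_iff 0 (Complex.I * (ε - Complex.I / N))).mpr (by
      simpa [Complex.div_re] using hε)
    refine h.congr fun n => ?_
    rw [jacobiTheta₂_term]
    congr 1
    linear_combination (Real.pi * n ^ 2 * (ε - Complex.I / N) : ℂ) * Complex.I_sq
  rw [← (Int.divModEquiv N).symm.tsum_eq, ← (Equiv.prodComm (Fin N) ℤ).tsum_eq]
  rw [Summable.tsum_prod, tsum_fintype,
    ← Fin.sum_univ_eq_sum_range (fun t => cexp (Real.pi * Complex.I * t ^ 2 / N)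
        * ∑' m : ℤ, cexp (-Real.pi * ε * (t + N * m) ^ 2))]
  · refine Finset.sum_congr rfl fun t _ => ?_
    rw [← tsum_mul_left]
    refine tsum_congr fun m => ?_
    have h1 : (Int.divModEquiv N).symm (Equiv.prodComm (Fin N) ℤ (t, m)) = m * N + (t : ℕ) := rfl
    obtain ⟨a, ha⟩ := hN
    rw [h1, ← Complex.exp_add, Complex.exp_eq_exp_iff_exists_int]
    -- With `N = 2a`, `(mN + t)² / N - t² / N = 2 (m² a + m t)`; evenness of `N` is what makes the
    -- phase depend on `t` alone.
    refine ⟨m * t + m ^ 2 * a, ?_⟩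
    have ha' : (N : ℂ) = a + a := by exact_mod_cast ha
    push_cast
    field_simp
    rw [ha']
    ring
  · exact ((Equiv.prodComm (Fin N) ℤ).summable_iff).mpr
      (((Int.divModEquiv N).symm.summable_iff).mpr hs)

/-- Poisson summation turns the sum over one residue class into `s / N` times a series whose
constant term is 1 and whose other terms die as `s → ∞`. Every class therefore has the same limit.
-/
theorem tendsto_residue_theta (N : ℕ) [NeZero N] (t : ℕ) :
    Tendsto (fun s : ℝ => (s : ℂ)⁻¹ * ∑' m : ℤ, cexp (-Real.pi * ((s ^ 2)⁻¹ : ℝ) * (t + N * m) ^ 2))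
      atTop (𝓝 (N : ℂ)⁻¹) := by
  have hN : (0 : ℝ) < N := by exact_mod_cast NeZero.pos N
  have hN0 : (N : ℂ) ≠ 0 := by exact_mod_cast NeZero.ne N
  have key := tendsto_tsum_of_norm_le_exp (α := fun s => Real.pi * (s / N) ^ 2)
    (f := fun s n => cexp (-Real.pi * ((s / N : ℝ) : ℂ) ^ 2 * (n : ℂ) ^ 2
      + 2 * Real.pi * (-Complex.I * t / N) * n)) ?_ ?_ ?_
  · have := key.const_mul (N : ℂ)⁻¹
    rw [mul_one] at this
    refine this.congr' ?_
    filter_upwards [eventually_gt_atTop 0] with s hs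
    have ha : (0 : ℝ) < s / N := div_pos hs hN
    have hre : 0 < (((s / N : ℝ) : ℂ) ^ 2).re := by
      rw [← ofReal_pow, ofReal_re]; positivity
    have hsq : ((((s / N : ℝ) : ℂ) ^ 2) ^ (1 / 2 : ℂ)) = ((s / N : ℝ) : ℂ) := by
      rw [← ofReal_pow, show (1 / 2 : ℂ) = ((1 / 2 : ℝ) : ℂ) by norm_num,
        ← ofReal_cpow (by positivity), ← Real.sqrt_eq_rpow, Real.sqrt_sq ha.le]
    have hs0 : (s : ℂ) ≠ 0 := by exact_mod_cast hs.ne'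
    rw [Complex.tsum_exp_neg_quadratic hre, hsq, ← mul_assoc]
    congr 1
    · push_cast
      field_simp
    · refine tsum_congr fun m => ?_
      congr 1
      push_cast
      field_simp
      linear_combination (2 * N * m * t + (1 - Complex.I ^ 2) * (t : ℂ) ^ 2) * Complex.I_sq
  · refine Tendsto.const_mul_atTop Real.pi_pos ?_
    exact (tendsto_pow_atTop two_ne_zero).comp (tendsto_id.atTop_div_const hN)
  · refine Eventually.of_forall fun s n => ?_
    rw [Complex.norm_exp]
    refine le_of_eq (congrArg Real.exp ?_)
    have : (-Real.pi * ((s / N : ℝ) : ℂ) ^ 2 * (n : ℂ) ^ 2 + 2 * Real.pi * (-Complex.I * t / N) * n)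
      = ((-(Real.pi * (s / N) ^ 2) * n ^ 2 : ℝ) : ℂ)
        + ((-(2 * Real.pi * t / N * n) : ℝ) : ℂ) * Complex.I := by
      push_cast; ring
    rw [this]
    simp only [add_re, ofReal_re, re_ofReal_mul, Complex.I_re, mul_zero, add_zero]
  · exact Eventually.of_forall fun s => by simp

/-- The other evaluation of the same limit inverts twice. With `z = s⁻² - i / N` one has `1 / z = i
N + w`, where `w = N² / (s² + i N)`; the summand `i N` is invisible to the theta series, and
inverting `w` gives a series tending to 1. -/
theorem tendsto_theta (N : ℕ) [NeZero N] (hN : Even N) :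
    Tendsto (fun s : ℝ => (s : ℂ)⁻¹
      * ∑' n : ℤ, cexp (-Real.pi * (((s ^ 2)⁻¹ : ℝ) - Complex.I / N) * (n : ℂ) ^ 2))
      atTop (𝓝 ((1 / (-Complex.I / N) ^ (1 / 2 : ℂ)) * (N : ℂ)⁻¹)) := by
  have hNpos : (0 : ℝ) < N := by exact_mod_cast NeZero.pos N
  have hN0 : (N : ℂ) ≠ 0 := by exact_mod_cast NeZero.ne N
  have hsq : Tendsto (fun s : ℝ => s ^ 2) atTop atTop := tendsto_pow_atTop two_ne_zero
  have key := tendsto_tsum_of_norm_le_exp (α := fun s => Real.pi * (s ^ 2 / (N : ℝ) ^ 2))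
    (f := fun s n => cexp (-Real.pi / (N ^ 2 / (s ^ 2 + Complex.I * N)) * (n : ℂ) ^ 2)) ?_ ?_ ?_
  · have hz : Tendsto (fun s : ℝ => ((((s ^ 2)⁻¹ : ℝ) : ℂ) - Complex.I / N) ^ (1 / 2 : ℂ)) atTop
        (𝓝 ((-Complex.I / N) ^ (1 / 2 : ℂ))) := by
      have h1 : Tendsto (fun s : ℝ => (((s ^ 2)⁻¹ : ℝ) : ℂ) - Complex.I / N) atTop
          (𝓝 (-Complex.I / N)) := by
        have := ((continuous_ofReal.tendsto 0).comp (tendsto_inv_atTop_zero.comp hsq)).sub_const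
          (Complex.I / N)
        simpa [neg_div] using! this
      refine ((continuousAt_id.cpow continuousAt_const ?_).tendsto).comp h1
      right
      simp [Complex.div_im, NeZero.ne N]
    have hw : Tendsto (fun s : ℝ => ((N ^ 2 / (1 + Complex.I * N * ((s ^ 2)⁻¹ : ℝ)) : ℂ)) ^ (1 / 2 : ℂ))
        atTop (𝓝 (N : ℂ)) := by
      have h1 : Tendsto (fun s : ℝ => (N ^ 2 / (1 + Complex.I * N * ((s ^ 2)⁻¹ : ℝ)) : ℂ)) atTop
          (𝓝 ((N : ℂ) ^ 2)) := by
        have := ((continuous_ofReal.tendsto 0).comp (tendsto_inv_atTop_zero.comp hsq)).const_mul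
          (Complex.I * N)
        have := (this.const_add 1)
        have := (tendsto_const_nhds (x := (N : ℂ) ^ 2)).div this (by simp)
        simpa using! this
      have h2 : ((N : ℂ) ^ 2) ^ (1 / 2 : ℂ) = N := by
        rw [← ofReal_natCast, ← ofReal_pow, show (1 / 2 : ℂ) = ((1 / 2 : ℝ) : ℂ) by norm_num,
          ← ofReal_cpow (by positivity), ← Real.sqrt_eq_rpow, Real.sqrt_sq hNpos.le]
      suffices h3 : Tendsto (fun s : ℝ => ((N ^ 2 / (1 + Complex.I * N * ((s ^ 2)⁻¹ : ℝ)) : ℂ))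
          ^ (1 / 2 : ℂ)) atTop (𝓝 (((N : ℂ) ^ 2) ^ (1 / 2 : ℂ))) by rwa [h2] at h3
      refine ((continuousAt_id.cpow continuousAt_const ?_).tendsto).comp h1
      left
      simp only [id_eq]
      rw [← ofReal_natCast, ← ofReal_pow, ofReal_re]
      positivity
    have hlim := ((((tendsto_const_nhds (x := (1 : ℂ))).div hz ?_)).mul (hw.inv₀ hN0)).mul key
    · rw [mul_one] at hlim
      refine hlim.congr' ?_
      filter_upwards [eventually_gt_atTop 0] with s hs
      have hs0 : (s : ℂ) ≠ 0 := by exact_mod_cast hs.ne'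
      have hzre : 0 < ((((s ^ 2)⁻¹ : ℝ) : ℂ) - Complex.I / N).re := by
        simp only [sub_re, ofReal_re, Complex.div_re]
        simp only [Complex.I_re, Complex.I_im, natCast_im, mul_zero, zero_mul, zero_div, add_zero,
          sub_zero]
        positivity
      have hsI : (s : ℂ) ^ 2 + Complex.I * N ≠ 0 := by
        intro h
        have := congrArg Complex.re h
        rw [← ofReal_pow, add_re, ofReal_re] at this
        simp [hs.ne'] at this
      set w : ℂ := N ^ 2 / (s ^ 2 + Complex.I * N) with hw_def
      have hw0 : w ≠ 0 := div_ne_zero (pow_ne_zero 2 hN0) hsI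
      have hwinv : w⁻¹ = ((s ^ 2 / (N : ℝ) ^ 2 : ℝ) : ℂ) + ((1 / N : ℝ) : ℂ) * Complex.I := by
        rw [hw_def, inv_div]
        push_cast
        field_simp
      have hwre : 0 < w.re := by
        have h1 : 0 < (w⁻¹).re := by
          rw [hwinv]
          simp only [add_re, ofReal_re, re_ofReal_mul, Complex.I_re, mul_zero, add_zero]
          positivity
        rw [Complex.inv_re] at h1
        exact (div_pos_iff_of_pos_right (normSq_pos.mpr hw0)).mp h1
      have hz0 : (((s ^ 2)⁻¹ : ℝ) : ℂ) - Complex.I / N ≠ 0 := fun h => by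
        rw [h] at hzre; simp at hzre
      have hzinv : ((((s ^ 2)⁻¹ : ℝ) : ℂ) - Complex.I / N)⁻¹ = Complex.I * N + w := by
        refine inv_eq_of_mul_eq_one_right ?_
        rw [hw_def]
        push_cast
        field_simp
        linear_combination ((N : ℂ) ^ 2 - s ^ 4 - N * s ^ 2 * Complex.I) * Complex.I_sq
      rw [Complex.tsum_exp_neg_mul_int_sq hzre]
      -- The dropped factor is `exp(-π i N n²)`, which is 1 because `N` is even.
      have hperiod : ∀ n : ℤ, cexp (-Real.pi / ((((s ^ 2)⁻¹ : ℝ) : ℂ) - Complex.I / N) * (n : ℂ) ^ 2)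
          = cexp (-Real.pi * w * (n : ℂ) ^ 2) := by
        intro n
        obtain ⟨a, ha⟩ := hN
        rw [div_eq_mul_inv, hzinv, Complex.exp_eq_exp_iff_exists_int]
        refine ⟨-(a * n ^ 2), ?_⟩
        have ha' : (N : ℂ) = a + a := by exact_mod_cast ha
        rw [ha']
        push_cast
        ring
      rw [tsum_congr hperiod, Complex.tsum_exp_neg_mul_int_sq hwre]
      -- A positive real factor can be taken out of the principal square root; `s⁻²` contributes
      -- `s⁻¹`.
      have hroot : w ^ (1 / 2 : ℂ)
          = (s : ℂ)⁻¹ * ((N ^ 2 / (1 + Complex.I * N * ((s ^ 2)⁻¹ : ℝ)) : ℂ)) ^ (1 / 2 : ℂ) := by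
        have h1 : w = (((s ^ 2)⁻¹ : ℝ) : ℂ) * (N ^ 2 / (1 + Complex.I * N * ((s ^ 2)⁻¹ : ℝ)) : ℂ) := by
          rw [hw_def]
          push_cast
          field_simp
        have h2 : (N ^ 2 / (1 + Complex.I * N * ((s ^ 2)⁻¹ : ℝ)) : ℂ) ≠ 0 := fun h => by
          rw [h, mul_zero] at h1; exact hw0 h1
        have hpos : 0 < (s ^ 2)⁻¹ := by positivity
        rw [h1, Complex.cpow_def_of_ne_zero (by rwa [← h1]), Complex.cpow_def_of_ne_zero h2,
          Complex.log_ofReal_mul hpos h2, add_mul, Complex.exp_add]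
        congr 1
        rw [Real.log_inv, Real.log_pow]
        have : (((-(((2 : ℕ) : ℝ) * Real.log s) : ℝ) : ℂ) * (1 / 2)) = ((-Real.log s : ℝ) : ℂ) := by
          push_cast; ring
        rw [this, ← ofReal_exp, Real.exp_neg, Real.exp_log hs, ofReal_inv]
      rw [hroot, Pi.div_apply]
      generalize ((N ^ 2 / (1 + Complex.I * N * ((s ^ 2)⁻¹ : ℝ)) : ℂ)) ^ (1 / 2 : ℂ) = W
      generalize ((((s ^ 2)⁻¹ : ℝ) : ℂ) - Complex.I / N) ^ (1 / 2 : ℂ) = Z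
      field_simp
    · rw [Ne, Complex.cpow_eq_zero_iff]
      simp [hN0]
  · refine Tendsto.const_mul_atTop Real.pi_pos ?_
    exact hsq.atTop_div_const (by positivity)
  · refine Eventually.of_forall fun s n => ?_
    rw [Complex.norm_exp]
    refine le_of_eq (congrArg Real.exp ?_)
    have : (-Real.pi / (N ^ 2 / (s ^ 2 + Complex.I * N)) * (n : ℂ) ^ 2 : ℂ)
      = ((-(Real.pi * (s ^ 2 / (N : ℝ) ^ 2)) * n ^ 2 : ℝ) : ℂ)
        + ((-(Real.pi / N * n ^ 2) : ℝ) : ℂ) * Complex.I := by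
      push_cast; field_simp; ring
    rw [this]
    simp only [add_re, ofReal_re, re_ofReal_mul, Complex.I_re, mul_zero, add_zero]
  · exact Eventually.of_forall fun s => by simp

/-- Both evaluations of the limit carry the factor `1 / N`; cancelling it leaves `(-i / N)^(-1/2)`,
whose principal value is `√N e(1/8)`. -/
theorem sum_exp_sq_div (N : ℕ) [NeZero N] (hN : Even N) :
    ∑ t ∈ Finset.range N, cexp (Real.pi * Complex.I * t ^ 2 / N)
      = (Real.sqrt N : ℂ) * e (1 / 8) := by
  have hNpos : (0 : ℝ) < N := by exact_mod_cast NeZero.pos N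
  have hN0 : (N : ℂ) ≠ 0 := by exact_mod_cast NeZero.ne N
  have h1 := tendsto_theta N hN
  have h2 := tendsto_finsetSum (Finset.range N) fun t _ =>
    (tendsto_residue_theta N t).const_mul (cexp (Real.pi * Complex.I * t ^ 2 / N))
  have h3 := tendsto_nhds_unique (h2.congr' ?_) h1
  · rw [← Finset.sum_mul] at h3
    rw [mul_right_cancel₀ (inv_ne_zero hN0) h3, Complex.cpow_def_of_ne_zero (by simp [hN0])]
    have : (-Complex.I / N : ℂ) = (((N : ℝ)⁻¹ : ℝ) : ℂ) * (-Complex.I) := by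
      push_cast; ring
    rw [this, Complex.log_ofReal_mul (by positivity) (by simp), Complex.log_neg_I, Real.log_inv,
      one_div, ← Complex.exp_neg, e, Real.sqrt_eq_rpow, Real.rpow_def_of_pos hNpos, ofReal_exp,
      ← Complex.exp_add]
    congr 1
    push_cast
    ring
  · filter_upwards [eventually_gt_atTop 0] with s hs
    rw [tsum_exp_eq_sum_residues N hN (by positivity), Finset.mul_sum]
    refine Finset.sum_congr rfl fun t _ => ?_
    ring

end ThetaGauss

/-! ### Characters of `ℝ / ℤ` -/

theorem e_add (z w : ℂ) : e (z + w) = e z * e w := by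
  rw [e, e, e, ← Complex.exp_add]; congr 1; ring

theorem e_zero : e 0 = 1 := by simp [e]

theorem e_neg (z : ℂ) : e (-z) = (e z)⁻¹ := by
  rw [e, e, ← Complex.exp_neg]; congr 1; ring

theorem e_intCast (n : ℤ) : e n = 1 := by
  rw [e, Complex.exp_eq_one_iff]; exact ⟨n, by ring⟩

theorem eCircle_coe (x : ℝ) : eCircle (x : UnitAddCircle) = e x := by
  rw [eCircle, AddCircle.toCircle_apply_mk, Circle.coe_exp, e]
  congr 1; push_cast; ring

theorem eCircle_add (x y : UnitAddCircle) : eCircle (x + y) = eCircle x * eCircle y := by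
  simp [eCircle, AddCircle.toCircle_add]

theorem eCircle_zero : eCircle 0 = 1 := by simp [eCircle]

theorem eCircle_ne_zero (x : UnitAddCircle) : eCircle x ≠ 0 := by simp [eCircle]

theorem eCircle_neg (x : UnitAddCircle) : eCircle (-x) = (eCircle x)⁻¹ :=
  eq_inv_of_mul_eq_one_left (by rw [← eCircle_add, neg_add_cancel, eCircle_zero])

theorem eCircle_neg_eq_star (x : UnitAddCircle) : eCircle (-x) = star (eCircle x) := by
  rw [eCircle, eCircle, AddCircle.toCircle_neg, Circle.coe_inv_eq_conj, Complex.star_def]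

theorem eCircle_eq_one_iff (x : UnitAddCircle) : eCircle x = 1 ↔ x = 0 := by
  rw [eCircle, Circle.coe_eq_one, ← AddCircle.toCircle_zero (T := (1 : ℝ))]
  exact (AddCircle.injective_toCircle one_ne_zero).eq_iff

theorem e_ratCast_eq_one_iff (r : ℚ) : e ((r : ℝ) : ℂ) = 1 ↔ ∃ m : ℤ, (m : ℚ) = r := by
  rw [← eCircle_coe, eCircle_eq_one_iff, AddCircle.coe_eq_zero_iff]
  refine exists_congr fun m => ?_
  rw [zsmul_one]
  exact_mod_cast Iff.rfl

theorem star_e_ofReal (x : ℝ) : star (e x) = e (-x) := by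
  rw [e, e, Complex.star_def, ← Complex.exp_conj]
  congr 1
  rw [map_mul, map_mul, map_mul, Complex.conj_ofReal, Complex.conj_ofReal, Complex.conj_I,
    Complex.conj_ofNat]
  ring

/-! ### Milgram's formula -/

section Milgram

/-- If `E` restricted to each coset of `H` is a multiple of a character of `H`, then only the
cosets with trivial character contribute to `∑ E`. -/
theorem sum_eq_sum_stable {G : Type*} [AddCommGroup G] [Fintype G] (E : G → ℂ) (hE : ∀ g, E g ≠ 0)
    (H : AddSubgroup G)
    (hmul : ∀ g, ∀ h ∈ H, ∀ h' ∈ H, E (g + (h + h')) * E g = E (g + h) * E (g + h'))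
    (K : Finset G) (hK : ∀ g, g ∈ K ↔ ∀ h ∈ H, E (g + h) = E g) :
    ∑ g, E g = ∑ g ∈ K, E g := by
  classical
  let β (g : G) : AddChar H ℂ :=
    { toFun := fun h => E (g + h) / E g
      map_zero_eq_one' := by simp [hE g]
      map_add_eq_mul' := fun h h' => by
        have := hmul g h h.2 h' h'.2
        have hg := hE g
        push_cast
        field_simp
        exact this }
  have hH : (Fintype.card H : ℂ) ≠ 0 := by exact_mod_cast Fintype.card_ne_zero
  refine mul_left_cancel₀ hH ?_
  -- Averaging over `H`: each translate by `h` has the same total sum, and the inner sum over `H`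
  -- vanishes where the character `β g` is nontrivial.
  have h1 : (Fintype.card H : ℂ) * ∑ g, E g = ∑ h : H, ∑ g, E (g + h) := by
    rw [← nsmul_eq_mul, ← Finset.card_univ, ← Finset.sum_const]
    refine Finset.sum_congr rfl fun h _ => ?_
    exact (Equiv.sum_comp (Equiv.addRight (h : G)) E).symm
  rw [h1, Finset.sum_comm, Finset.mul_sum, ← Finset.sum_filter_add_sum_filter_not _ (· ∈ K)]
  have h2 : ∀ g ∉ K, ∑ h : H, E (g + h) = 0 := by
    intro g hg
    have hne : β g ≠ 1 := by
      intro h1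
      refine hg ((hK g).mpr fun h hh => ?_)
      have := DFunLike.congr_fun h1 ⟨h, hh⟩
      exact (div_eq_one_iff_eq (hE g)).mp this
    have h3 := AddChar.sum_eq_zero_of_ne_one hne
    change ∑ h : H, E (g + h) / E g = 0 at h3
    rw [← Finset.sum_div] at h3
    exact (div_eq_zero_iff.mp h3).resolve_right (hE g)
  rw [Finset.sum_eq_zero (s := Finset.univ.filter (· ∉ K))
    fun g hg => h2 g (Finset.mem_filter.mp hg).2, add_zero, Finset.filter_mem_eq_inter,
    Finset.univ_inter]
  refine Finset.sum_congr rfl fun g hg => ?_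
  rw [Finset.sum_congr rfl fun (h : H) _ => (hK g).mp hg h h.2, Finset.sum_const, nsmul_eq_mul,
    Finset.card_univ]

variable {V : Type*} [AddCommGroup V] [Module ℚ V]

namespace EvenLattice

/-- The Gauss sum `∑ e(Q(γ))` over the discriminant group. -/
def gauss (L : EvenLattice V) : ℂ := ∑ γ : L.Disc, eCircle (L.discQ γ)

theorem mem_dual {L : EvenLattice V} {x : V} :
    x ∈ L.dual ↔ ∀ y ∈ L.carrier, ∃ m : ℤ, (m : ℚ) = QuadraticMap.polar L.Q x y := by
  rw [dual, LinearMap.BilinForm.mem_dualSubmodule]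
  simp only [Submodule.mem_one]
  exact Iff.rfl

theorem carrier_le_dual (L : EvenLattice V) : L.carrier ≤ L.dual := by
  intro x hx
  refine mem_dual.mpr fun y hy => ?_
  obtain ⟨a, ha⟩ := L.even _ (add_mem hx hy)
  obtain ⟨b, hb⟩ := L.even _ hx
  obtain ⟨c, hc⟩ := L.even _ hy
  exact ⟨a - b - c, by rw [QuadraticMap.polar, ha, hb, hc]; push_cast; ring⟩

theorem discQ_mk (L : EvenLattice V) (x : L.dual) :
    L.discQ (Submodule.Quotient.mk x) = (((L.Q x : ℚ) : ℝ) : UnitAddCircle) := rfl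

theorem eCircle_discQ_mk (L : EvenLattice V) (x : L.dual) :
    eCircle (L.discQ (Submodule.Quotient.mk x)) = e (((L.Q x : ℚ) : ℝ) : ℂ) := by
  rw [discQ_mk, eCircle_coe]

theorem Q_add (L : EvenLattice V) (x y : V) :
    L.Q (x + y) = L.Q x + L.Q y + QuadraticMap.polar L.Q x y := by
  rw [QuadraticMap.polar]; ring

theorem e_Q_add (L : EvenLattice V) (x : V) {y : V} (hy : y ∈ L.carrier) :
    e (((L.Q (x + y) : ℚ) : ℝ) : ℂ)
      = e (((L.Q x : ℚ) : ℝ) : ℂ) * e (((QuadraticMap.polar L.Q x y : ℚ) : ℝ) : ℂ) := by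
  obtain ⟨m, hm⟩ := L.even y hy
  rw [Q_add, hm, show (((L.Q x + (m : ℚ) + QuadraticMap.polar L.Q x y : ℚ) : ℝ) : ℂ)
    = ((L.Q x : ℝ) : ℂ) + ((m : ℂ) + ((QuadraticMap.polar L.Q x y : ℚ) : ℝ)) by push_cast; ring,
    e_add, e_add, e_intCast, one_mul]

/-- On a coset of `L / M` in `M' / M` the function `e(Q)` is a multiple of the character `e((x,
·))`, since `Q` is integral on `L`. Only the cosets in `L' / M` survive, and there the sum descends
to `L' / L` with fibres of constant size. The phase of the Gauss sum is thus insensitive to passing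
to a sublattice. -/
theorem gauss_eq_mul_of_le {M L : EvenLattice V} (hQ : M.Q = L.Q) (hle : M.carrier ≤ L.carrier) :
    ∃ c : ℕ, 0 < c ∧ M.gauss = c * L.gauss := by
  classical
  have hdual : L.dual ≤ M.dual := fun x hx => mem_dual.mpr fun y hy => by
    rw [hQ]; exact mem_dual.mp hx y (hle hy)
  let H : Submodule ℤ M.Disc :=
    (L.carrier.submoduleOf M.dual).map (M.carrier.submoduleOf M.dual).mkQ
  let inc : (L.dual ⧸ M.carrier.submoduleOf L.dual) →ₗ[ℤ] M.Disc :=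
    Submodule.mapQ _ _ (Submodule.inclusion hdual) (fun x hx => hx)
  let π : (L.dual ⧸ M.carrier.submoduleOf L.dual) →ₗ[ℤ] L.Disc :=
    Submodule.mapQ _ _ LinearMap.id (fun x hx => hle hx)
  have hinc : Function.Injective inc := by
    rw [injective_iff_map_eq_zero]
    intro x
    obtain ⟨x, rfl⟩ := Submodule.Quotient.mk_surjective _ x
    intro h
    change (Submodule.Quotient.mk (Submodule.inclusion hdual x) : M.Disc) = 0 at h
    have h' := (Submodule.Quotient.mk_eq_zero (M.carrier.submoduleOf M.dual)).mp h
    exact (Submodule.Quotient.mk_eq_zero _).mpr h'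
  have hπ : Function.Surjective π := by
    intro y
    obtain ⟨y, rfl⟩ := Submodule.Quotient.mk_surjective _ y
    exact ⟨Submodule.Quotient.mk y, rfl⟩
  have : Fintype (L.dual ⧸ M.carrier.submoduleOf L.dual) := Fintype.ofInjective inc hinc
  have hval (j) : eCircle (M.discQ (inc j)) = eCircle (L.discQ (π j)) := by
    obtain ⟨x, rfl⟩ := Submodule.Quotient.mk_surjective _ j
    have h := M.eCircle_discQ_mk (Submodule.inclusion hdual x)
    rw [hQ] at h
    exact h.trans (L.eCircle_discQ_mk x).symm
  have hH (x : M.dual) (y : V) (hy : y ∈ L.carrier) :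
      eCircle (M.discQ (Submodule.Quotient.mk x
        + Submodule.Quotient.mk ⟨y, hdual (L.carrier_le_dual hy)⟩))
      = eCircle (M.discQ (Submodule.Quotient.mk x))
        * e (((QuadraticMap.polar L.Q (x : V) y : ℚ) : ℝ) : ℂ) := by
    rw [← Submodule.Quotient.mk_add, eCircle_discQ_mk, eCircle_discQ_mk, hQ]
    exact L.e_Q_add x hy
  have hsum := sum_eq_sum_stable (fun γ => eCircle (M.discQ γ)) (fun γ => eCircle_ne_zero _)
    H.toAddSubgroup ?_ (Finset.univ.image inc) ?_
  · refine ⟨Fintype.card (LinearMap.ker π), Fintype.card_pos, ?_⟩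
    rw [gauss, hsum, Finset.sum_image (fun a _ b _ h => hinc h), gauss, Finset.mul_sum]
    rw [← Finset.sum_fiberwise_of_maps_to (g := π) (t := Finset.univ)
      (fun _ _ => Finset.mem_univ _)]
    refine Finset.sum_congr rfl fun γ _ => ?_
    rw [Finset.sum_congr rfl fun j hj => by rw [hval, (Finset.mem_filter.mp hj).2],
      Finset.sum_const, nsmul_eq_mul]
    congr 2
    have h1 := AddMonoidHom.card_fiber_eq_of_mem_range π.toAddMonoidHom (x := γ) (y := 0)
      (hπ γ) ⟨0, map_zero _⟩
    have h2 : Fintype.card (LinearMap.ker π)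
        = (Finset.univ.filter fun j => π.toAddMonoidHom j = 0).card := by
      rw [← Fintype.card_subtype]
      exact Fintype.card_congr (Equiv.refl _)
    rw [h2, ← h1]
    rfl
  · rintro g _ ⟨⟨y, hy0⟩, hy, rfl⟩ _ ⟨⟨y', hy0'⟩, hy', rfl⟩
    obtain ⟨x, rfl⟩ := Submodule.Quotient.mk_surjective _ g
    have h3 := hH x (y + y') (add_mem hy hy')
    have h1 := hH x y hy
    have h2 := hH x y' hy'
    rw [QuadraticMap.polar_add_right, Rat.cast_add, Complex.ofReal_add, e_add] at h3
    change eCircle (M.discQ (Submodule.Quotient.mk x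
        + Submodule.Quotient.mk ⟨y + y', hdual (L.carrier_le_dual (add_mem hy hy'))⟩)) * _
      = eCircle (M.discQ (Submodule.Quotient.mk x
        + Submodule.Quotient.mk ⟨y, hdual (L.carrier_le_dual hy)⟩)) *
        eCircle (M.discQ (Submodule.Quotient.mk x
        + Submodule.Quotient.mk ⟨y', hdual (L.carrier_le_dual hy')⟩))
    rw [h1, h2, h3]
    ring
  -- The classes with trivial character are those pairing integrally with `L`, that is, the image of
  -- `L' / M`.
  · intro g
    simp only [Finset.mem_image, Finset.mem_univ, true_and]
    constructor
    · rintro ⟨j, rfl⟩ _ ⟨⟨y, hy0⟩, hy, rfl⟩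
      obtain ⟨x, rfl⟩ := Submodule.Quotient.mk_surjective _ j
      have h1 := hH (Submodule.inclusion hdual x) y hy
      refine h1.trans ?_
      exact (congrArg _ ((e_ratCast_eq_one_iff _).mpr (mem_dual.mp x.2 y hy))).trans (mul_one _)
    · intro h
      obtain ⟨x, rfl⟩ := Submodule.Quotient.mk_surjective _ g
      refine ⟨Submodule.Quotient.mk ⟨x, mem_dual.mpr fun y hy => ?_⟩, rfl⟩
      have h1 := hH x y hy
      have h2 := h _ ⟨⟨y, hdual (L.carrier_le_dual hy)⟩, hy, rfl⟩
      rw [← e_ratCast_eq_one_iff]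
      exact (mul_eq_left₀ (eCircle_ne_zero _)).mp (h1.symm.trans h2)

/-! ### Milgram's formula via orthogonal sublattices -/

theorem sum_e_sq_div {a : ℤ} (ha : a ≠ 0) :
    ∑ t : Fin (2 * a.natAbs), e ((((t : ℕ) ^ 2 / (4 * a) : ℚ) : ℝ) : ℂ)
      = Real.sqrt (2 * a.natAbs : ℕ) * e ((a.sign / 8 : ℝ) : ℂ) := by
  have : NeZero (2 * a.natAbs) := ⟨by simpa using ha⟩
  have h := sum_exp_sq_div (2 * a.natAbs) (even_two_mul _)
  rw [← Fin.sum_univ_eq_sum_range (fun t : ℕ => Complex.exp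
    (Real.pi * Complex.I * (t : ℂ) ^ 2 / ((2 * a.natAbs : ℕ) : ℂ)))] at h
  have hterm (t : ℕ) : Complex.exp (Real.pi * Complex.I * (t : ℂ) ^ 2 / ((2 * a.natAbs : ℕ) : ℂ))
      = e ((t ^ 2 / (4 * a.natAbs) : ℝ) : ℂ) := by
    have h0 : (a.natAbs : ℂ) ≠ 0 := by exact_mod_cast Int.natAbs_ne_zero.mpr ha
    rw [e]
    congr 1
    push_cast
    field_simp
    ring
  simp only [hterm] at h
  rcases lt_or_gt_of_ne ha with hneg | hpos
  -- For negative `a` the sum is the complex conjugate of the one for `|a|`.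
  · have h1 := congrArg star h
    rw [star_sum] at h1
    simp only [star_e_ofReal] at h1
    have h2 : (a : ℝ) = -(a.natAbs : ℝ) := by
      rw [Nat.cast_natAbs, abs_of_neg hneg]; simp
    rw [star_mul', show (1 / 8 : ℂ) = ((1 / 8 : ℝ) : ℂ) by norm_num, star_e_ofReal,
      Complex.star_def, Complex.conj_ofReal, ← Complex.ofReal_neg] at h1
    rw [Int.sign_eq_neg_one_of_neg hneg, show (((-1 : ℤ) : ℝ) / 8) = -(1 / 8) by norm_num, ← h1]
    refine Finset.sum_congr rfl fun t _ => ?_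
    congr 1
    push_cast
    have h3 : (a : ℂ) = -(a.natAbs : ℂ) := by exact_mod_cast h2
    rw [h3, mul_neg, div_neg]
  · have h2 : (a : ℝ) = (a.natAbs : ℝ) := by
      rw [Nat.cast_natAbs, abs_of_pos hpos]
    rw [Int.sign_eq_one_of_pos hpos, show ((((1 : ℤ) : ℝ) / 8 : ℝ) : ℂ) = 1 / 8 by norm_num, ← h]
    refine Finset.sum_congr rfl fun t _ => ?_
    congr 1
    push_cast
    have h3 : (a : ℂ) = (a.natAbs : ℂ) := by
      rw [← Complex.ofReal_intCast, h2, Complex.ofReal_natCast]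
    rw [h3]

/-- Milgram's formula for a lattice with an orthogonal basis. -/
theorem gauss_of_orthogonal (M : EvenLattice V) {n : ℕ} (v : Module.Basis (Fin n) ℚ V)
    (hv : M.carrier = Submodule.span ℤ (Set.range v)) (a : Fin n → ℤ) (ha : ∀ i, a i ≠ 0)
    (hQ : ∀ t : Fin n → ℚ, M.Q (∑ i, t i • v i) = ∑ i, a i * t i ^ 2) :
    ∃ r : ℝ, 0 < r ∧ M.gauss = r * e (((∑ i, (a i).sign : ℤ) : ℂ) / 8) := by
  classical
  have hpolar (t s : Fin n → ℚ) :
      QuadraticMap.polar M.Q (∑ i, t i • v i) (∑ i, s i • v i) = ∑ i, 2 * a i * t i * s i := by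
    rw [QuadraticMap.polar, ← Finset.sum_add_distrib]
    simp only [← add_smul]
    rw [hQ (fun i => t i + s i), hQ, hQ, ← Finset.sum_sub_distrib, ← Finset.sum_sub_distrib]
    exact Finset.sum_congr rfl fun i _ => by ring
  have hmem (t : Fin n → ℚ) : ∑ i, t i • v i ∈ M.carrier ↔ ∀ i, ∃ m : ℤ, (m : ℚ) = t i := by
    rw [hv, v.mem_span_iff_repr_mem ℤ]
    refine forall_congr' fun i => ?_
    rw [v.repr_sum_self]
    exact Iff.rfl
  have ha' (i) : (a i : ℚ) ≠ 0 := by exact_mod_cast ha i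
  have hdual (t : Fin n → ℚ) : ∑ i, t i • v i ∈ M.dual ↔ ∀ i, ∃ m : ℤ, (m : ℚ) = 2 * a i * t i := by
    rw [mem_dual]
    constructor
    · intro h i
      have h1 := h _ ((hmem (Pi.single i 1)).mpr fun j => ⟨(Pi.single i 1 : Fin n → ℤ) j, by
        rcases eq_or_ne j i with rfl | hij <;> simp [*]⟩)
      rw [hpolar] at h1
      simpa [Pi.single_apply] using h1
    · intro h y hy
      rw [← v.sum_repr y] at hy ⊢
      rw [hpolar]
      have h2 := (hmem _).mp hy
      choose m hm using h
      choose m' hm' using h2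
      exact ⟨∑ i, m i * m' i, by push_cast; simp [hm, hm']⟩
  -- The polar form is `∑ 2 aᵢ tᵢ sᵢ`, so the vectors `vᵢ / (2 aᵢ)` form a basis of the dual
  -- lattice. The discriminant group is a product of groups `ℤ / 2aᵢ`, and the Gauss sum factors
  -- accordingly.
  let x (t : Fin n → ℤ) : M.dual := ⟨∑ i, ((t i : ℚ) / (2 * a i)) • v i,
    (hdual _).mpr fun i => ⟨t i, by have := ha' i; field_simp⟩⟩
  have hx (t s : Fin n → ℤ) : (Submodule.Quotient.mk (x t) : M.Disc) = Submodule.Quotient.mk (x s)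
      ↔ ∀ i, 2 * a i ∣ t i - s i := by
    rw [Submodule.Quotient.eq]
    change (∑ i, ((t i : ℚ) / (2 * a i)) • v i) - (∑ i, ((s i : ℚ) / (2 * a i)) • v i)
      ∈ M.carrier ↔ _
    rw [← Finset.sum_sub_distrib]
    simp only [← sub_smul]
    rw [hmem]
    refine forall_congr' fun i => ?_
    have := ha' i
    constructor
    · rintro ⟨m, hm⟩
      refine ⟨m, ?_⟩
      field_simp at hm
      have : ((t i - s i : ℤ) : ℚ) = ((2 * a i * m : ℤ) : ℚ) := by push_cast; linarith
      exact_mod_cast this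
    · rintro ⟨m, hm⟩
      refine ⟨m, ?_⟩
      field_simp
      have : ((t i - s i : ℤ) : ℚ) = ((2 * a i * m : ℤ) : ℚ) := by rw [hm]
      push_cast at this
      linarith
  let X (t : ∀ i, Fin (2 * (a i).natAbs)) : M.Disc := Submodule.Quotient.mk (x fun i => (t i : ℕ))
  have hXval (t) : eCircle (M.discQ (X t))
      = ∏ i, e (((((t i : ℕ) : ℚ) ^ 2 / (4 * a i) : ℚ) : ℝ) : ℂ) := by
    rw [eCircle_discQ_mk]
    change e (((M.Q (∑ i, ((((t i : ℕ) : ℤ) : ℚ) / (2 * a i)) • v i) : ℚ) : ℝ) : ℂ) = _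
    rw [hQ]
    simp only [e]
    rw [← Complex.exp_sum, ← Finset.mul_sum]
    congr 2
    push_cast
    refine Finset.sum_congr rfl fun i _ => ?_
    have h0 : (a i : ℂ) ≠ 0 := by exact_mod_cast ha i
    field_simp
    ring
  have hX : Function.Bijective X := by
    constructor
    · intro t s hts
      have h := (hx _ _).mp hts
      funext i
      have h1 := h i
      have h2 : ((2 * (a i).natAbs : ℕ) : ℤ) ∣ ((t i : ℕ) : ℤ) - ((s i : ℕ) : ℤ) := by
        rw [Nat.cast_mul, Int.natCast_natAbs]
        exact (mul_dvd_mul_left 2 ((abs_dvd _ _).mpr dvd_rfl)).trans h1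
      exact Fin.ext ((Nat.modEq_iff_dvd.mpr h2).symm.eq_of_lt_of_lt (t i).2 (s i).2)
    · intro γ
      obtain ⟨y, rfl⟩ := Submodule.Quotient.mk_surjective _ γ
      have h1 := (hdual (v.repr (y : V))).mp (by rw [v.sum_repr]; exact y.2)
      choose m hm using h1
      have hN (i) : 0 < 2 * (a i).natAbs := by have := Int.natAbs_pos.mpr (ha i); omega
      have hm0 (i) : 0 ≤ m i % ((2 * (a i).natAbs : ℕ) : ℤ) :=
        Int.emod_nonneg _ (by have := hN i; omega)
      refine ⟨fun i => ⟨(m i % ((2 * (a i).natAbs : ℕ) : ℤ)).toNat, ?_⟩, ?_⟩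
      · have := Int.emod_lt_of_pos (m i) (b := ((2 * (a i).natAbs : ℕ) : ℤ)) (by have := hN i; omega)
        have := hm0 i
        omega
      · have hy : y = x m := by
          refine Subtype.ext ?_
          change (y : V) = ∑ i, ((m i : ℚ) / (2 * a i)) • v i
          refine (v.sum_repr (y : V)).symm.trans (Finset.sum_congr rfl fun i _ => ?_)
          rw [hm]
          have := ha' i
          congr 1
          field_simp
        rw [hy]
        refine (hx _ _).mpr fun i => ?_
        simp only [Int.toNat_of_nonneg (hm0 i)]
        have h2 := Int.emod_add_mul_ediv (m i) ((2 * (a i).natAbs : ℕ) : ℤ)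
        have h3 : (2 * a i) ∣ ((2 * (a i).natAbs : ℕ) : ℤ) := by
          rw [Nat.cast_mul, Int.natCast_natAbs]
          exact mul_dvd_mul_left 2 ((dvd_abs _ _).mpr dvd_rfl)
        rw [show m i % ((2 * (a i).natAbs : ℕ) : ℤ) - m i
          = -(((2 * (a i).natAbs : ℕ) : ℤ) * (m i / ((2 * (a i).natAbs : ℕ) : ℤ))) by linarith]
        exact (dvd_neg.mpr (h3.mul_right _))
  refine ⟨∏ i, Real.sqrt (2 * (a i).natAbs : ℕ), Finset.prod_pos fun i _ => Real.sqrt_pos.mpr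
    (by have := Int.natAbs_pos.mpr (ha i); positivity), ?_⟩
  rw [gauss, ← Function.Bijective.sum_comp hX]
  simp only [hXval]
  rw [← Fintype.piFinset_univ, ← Finset.prod_univ_sum (fun _ => Finset.univ)
    (fun i (t : Fin (2 * (a i).natAbs)) => e (((((t : ℕ) : ℚ) ^ 2 / (4 * a i) : ℚ) : ℝ) : ℂ))]
  rw [Finset.prod_congr rfl fun i _ => sum_e_sq_div (ha i), Finset.prod_mul_distrib,
    Complex.ofReal_prod]
  congr 1
  simp only [e]
  rw [← Complex.exp_sum, ← Finset.mul_sum]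
  congr 2
  push_cast
  rw [Finset.sum_div]

/-- Milgram's formula, up to a positive factor. -/
theorem exists_gauss_eq (L : EvenLattice V) :
    ∃ r : ℝ, 0 < r ∧ L.gauss = r * e (((L.bPlus : ℤ) - L.bMinus : ℤ) / 8) := by
  classical
  obtain ⟨n, b, hb⟩ := L.isLattice
  have : FiniteDimensional ℚ V := b.finiteDimensional_of_finite
  have : Invertible (2 : ℚ) := invertibleOfNonzero two_ne_zero
  obtain ⟨w, ⟨φ⟩⟩ := QuadraticForm.equivalent_weightedSumSquares_units_of_nondegenerate' L.Q (by
    intro x hx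
    refine L.nondegenerate.1 x fun y => ?_
    have h := hx y
    rw [QuadraticMap.associated_apply, smul_eq_zero] at h
    exact h.resolve_left (Invertible.ne_zero _))
  let v₀ : Module.Basis _ ℚ V := (Pi.basisFun ℚ _).map φ.toLinearEquiv.symm
  have hφ (t : Fin (Module.finrank ℚ V) → ℚ) : L.Q (∑ i, t i • v₀ i) = ∑ i, (w i : ℚ) * t i ^ 2 := by
    have h1 : ∑ i, t i • v₀ i = φ.toLinearEquiv.symm t := by
      have := v₀.sum_equivFun (φ.toLinearEquiv.symm t)
      simpa [v₀, Module.Basis.equivFun_apply] using this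
    rw [h1, ← φ.map_app, QuadraticMap.weightedSumSquares_apply]
    refine Finset.sum_congr rfl fun i _ => ?_
    have h2 : φ (φ.toLinearEquiv.symm t) = t := φ.toLinearEquiv.apply_symm_apply t
    rw [h2, Units.smul_def, smul_eq_mul, sq]
  -- A common denominator `d` of the coordinates moves the orthogonal basis into `L`. The new
  -- coefficients `wᵢ d²` are values of `Q` on `L`, hence integers, and they have the signs of the
  -- `wᵢ`.
  obtain ⟨d, hd⟩ := IsLocalization.exist_integer_multiples_of_finite (nonZeroDivisors ℤ)
    (fun ij : Fin (Module.finrank ℚ V) × Fin n => b.repr (v₀ ij.1) ij.2)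
  have hd0 : ((d : ℤ) : ℚ) ≠ 0 := by exact_mod_cast nonZeroDivisors.ne_zero d.2
  let v := v₀.isUnitSMul (w := fun _ => ((d : ℤ) : ℚ)) fun _ => hd0.isUnit
  have hv (i) : v i = ((d : ℤ) : ℚ) • v₀ i := Module.Basis.isUnitSMul_apply _ i
  have hvL (i) : v i ∈ L.carrier := by
    rw [hb, b.mem_span_iff_repr_mem ℤ]
    intro j
    obtain ⟨m, hm⟩ := hd (i, j)
    refine ⟨m, ?_⟩
    rw [hm, hv, map_smul, Finsupp.smul_apply, zsmul_eq_mul, smul_eq_mul]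
  have hQ' (t : Fin (Module.finrank ℚ V) → ℚ) :
      L.Q (∑ i, t i • v i) = ∑ i, ((w i : ℚ) * (d : ℤ) ^ 2) * t i ^ 2 := by
    simp only [hv, smul_smul]
    rw [hφ fun i => t i * (d : ℤ)]
    exact Finset.sum_congr rfl fun i _ => by ring
  have haex (i) : ∃ m : ℤ, (w i : ℚ) * (d : ℤ) ^ 2 = m := by
    obtain ⟨m, hm⟩ := L.even _ (hvL i)
    refine ⟨m, ?_⟩
    have := hQ' (Pi.single i 1)
    simp only [Pi.single_apply, ite_smul, one_smul, zero_smul, Finset.sum_ite_eq',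
      Finset.mem_univ, if_true, ite_pow, one_pow, mul_ite, mul_one, zero_pow two_ne_zero,
      mul_zero] at this
    rw [← this, hm]
  choose a ha using haex
  have hd2 : 0 < ((d : ℤ) : ℚ) ^ 2 := by positivity
  have ha0 (i) : a i ≠ 0 := by
    intro h
    have := ha i
    rw [h, Int.cast_zero, mul_eq_zero] at this
    exact this.elim (w i).ne_zero hd2.ne'
  let M : EvenLattice V :=
    { Q := L.Q
      nondegenerate := L.nondegenerate
      carrier := Submodule.span ℤ (Set.range v)
      isLattice := ⟨_, v, rfl⟩
      even := fun x hx => L.even x ((Submodule.span_le.mpr (by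
        rintro _ ⟨i, rfl⟩; exact hvL i)) hx) }
  have hML : M.carrier ≤ L.carrier := Submodule.span_le.mpr (by rintro _ ⟨i, rfl⟩; exact hvL i)
  obtain ⟨c, hc, hc'⟩ := gauss_eq_mul_of_le (M := M) (L := L) rfl hML
  obtain ⟨r, hr, hr'⟩ := gauss_of_orthogonal M v rfl a ha0 (by
    intro t
    simp only [← ha]
    exact hQ' t)
  have hsig : (∑ i, (a i).sign : ℤ) = (L.bPlus : ℤ) - L.bMinus := by
    have h1 : L.bPlus = {i | 0 < (w i : ℚ)}.ncard :=
      QuadraticForm.sigPos_of_equiv_weightedSumSquares ⟨φ⟩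
    have h2 : L.bMinus = {i | (w i : ℚ) < 0}.ncard :=
      QuadraticForm.sigNeg_of_equiv_weightedSumSquares ⟨φ⟩
    rw [h1, h2, Set.ncard_eq_toFinset_card', Set.ncard_eq_toFinset_card', Set.toFinset_ofPred,
      Set.toFinset_ofPred, Finset.card_filter, Finset.card_filter]
    push_cast
    rw [← Finset.sum_sub_distrib]
    refine Finset.sum_congr rfl fun i _ => ?_
    rcases lt_or_gt_of_ne (ha0 i) with h | h
    · have hq : (w i : ℚ) < 0 := by
        have h3 : ((a i : ℤ) : ℚ) < 0 := by exact_mod_cast h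
        rw [← ha i] at h3
        exact (neg_iff_pos_of_mul_neg h3).mpr hd2
      rw [Int.sign_eq_neg_one_of_neg h, if_neg hq.not_gt, if_pos hq]
      rfl
    · have hq : 0 < (w i : ℚ) := by
        have h3 : 0 < ((a i : ℤ) : ℚ) := by exact_mod_cast h
        rw [← ha i] at h3
        exact (pos_iff_pos_of_mul_pos h3).mpr hd2
      rw [Int.sign_eq_one_of_pos h, if_neg hq.not_gt, if_pos hq]
      rfl
  have hc0 : (c : ℝ) ≠ 0 := by exact_mod_cast hc.ne'
  have hcC : (c : ℂ) ≠ 0 := by exact_mod_cast hc.ne'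
  refine ⟨r / c, by positivity, ?_⟩
  rw [← hsig]
  rw [hr'] at hc'
  push_cast at hc' ⊢
  field_simp
  rw [mul_comm, ← hc']

end EvenLattice

end Milgram

/-! ### The Weil representation of a discriminant form on `ℤ / p` -/

section WeilPrime

variable {p : ℕ} [Fact p.Prime]

local notation "ψ" => ZMod.stdAddChar
local notation "χ" => legendreChar p

theorem stdAddChar_intCast (n : ℤ) : ψ (n : ZMod p) = e ((n / p : ℝ) : ℂ) := by
  rw [ZMod.stdAddChar_coe, e]
  congr 1
  push_cast
  ring

/-- If `p` divided `λ`, then `Q` would be integral on `L'`, so `L'` would pair integrally with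
itself and lie in `(L')' = L`. The discriminant group would be trivial instead of having order `p`.
-/
theorem EvenLattice.intCast_ne_zero_of_disc {V : Type*} [AddCommGroup V] [Module ℚ V]
    (L : EvenLattice V) (ι : L.Disc ≃+ ZMod p) (lam : ℤ)
    (hlam : ∀ γ : L.Disc,
      L.discQ γ = (((lam : ℝ) * ((ι γ).val : ℝ) ^ 2 / (p : ℝ) : ℝ) : UnitAddCircle)) :
    (lam : ZMod p) ≠ 0 := by
  intro h0
  have hp0 : (p : ℝ) ≠ 0 := by exact_mod_cast (Fact.out : p.Prime).ne_zero
  obtain ⟨m, hm⟩ := (ZMod.intCast_zmod_eq_zero_iff_dvd lam p).mp h0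
  have hint (x : L.dual) : ∃ r : ℤ, (r : ℚ) = L.Q x := by
    rw [← e_ratCast_eq_one_iff, ← L.eCircle_discQ_mk, hlam, eCircle_coe, hm,
      show (((p * m : ℤ) : ℝ) * ((ι (Submodule.Quotient.mk x)).val : ℝ) ^ 2 / (p : ℝ) : ℝ)
        = ((m * (ι (Submodule.Quotient.mk x)).val ^ 2 : ℤ) : ℝ) by push_cast; field_simp,
      Complex.ofReal_intCast, e_intCast]
  obtain ⟨n, b, hb⟩ := L.isLattice
  have hdd : L.bilin.dualSubmodule L.dual = L.carrier := by
    rw [EvenLattice.dual, hb]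
    exact LinearMap.BilinForm.dualSubmodule_dualSubmodule_of_basis _ L.nondegenerate
      ⟨fun x y => QuadraticMap.polar_comm L.Q x y⟩ b
  have hle : L.dual ≤ L.carrier := by
    intro x hx
    rw [← hdd, LinearMap.BilinForm.mem_dualSubmodule]
    intro y hy
    rw [Submodule.mem_one]
    obtain ⟨r, hr⟩ := hint ⟨_, add_mem hx hy⟩
    obtain ⟨s, hs⟩ := hint ⟨x, hx⟩
    obtain ⟨t, ht⟩ := hint ⟨y, hy⟩
    refine ⟨r - s - t, ?_⟩
    rw [QuadraticMap.polarBilin_apply_apply, QuadraticMap.polar, ← hr, ← hs, ← ht]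
    simp
  have hzero (γ : L.Disc) : γ = 0 := by
    obtain ⟨x, rfl⟩ := Submodule.Quotient.mk_surjective _ γ
    exact (Submodule.Quotient.mk_eq_zero _).mpr (hle x.2)
  have h1 : ι.symm 1 = ι.symm 0 := (hzero _).trans (hzero _).symm
  exact one_ne_zero (ι.symm.injective h1)

theorem eCircle_eq_of_eq {A : Type*} [AddCommGroup A] (ι : A ≃+ ZMod p)
    (Q : A → UnitAddCircle) (lam : ℤ) (hQ : ∀ γ,
    Q γ = (((lam : ℝ) * ((ι γ).val : ℝ) ^ 2 / (p : ℝ) : ℝ) : UnitAddCircle)) (γ : A) :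
    eCircle (Q γ) = ψ ((lam : ZMod p) * ι γ ^ 2) := by
  have h : ((lam : ZMod p) * ι γ ^ 2) = ((lam * ((ι γ).val : ℤ) ^ 2 : ℤ) : ZMod p) := by
    push_cast
    rw [ZMod.natCast_zmod_val]
  rw [hQ, eCircle_coe, h, stdAddChar_intCast]
  push_cast
  rfl

variable {A : Type*} [AddCommGroup A] [Fintype A] (ι : A ≃+ ZMod p) (Q : A → UnitAddCircle)
  (l : ZMod p) (sig : ℤ)

/-- The discriminant form `Q` is `x ↦ l x² / p` and the normalising constant of the Weil
representation is the inverse of its Gauss sum. -/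
structure IsPrimeDisc : Prop where
  eCircle_eq : ∀ γ, eCircle (Q γ) = ψ (l * ι γ ^ 2)
  const_eq : e (-(sig : ℂ) / 8) / (Real.sqrt (Fintype.card A) : ℂ) = (quadGauss l)⁻¹

variable {ι Q l sig}

theorem sum_eCircle_eq (hQ : ∀ γ, eCircle (Q γ) = ψ (l * ι γ ^ 2)) :
    ∑ γ, eCircle (Q γ) = quadGauss l := by
  rw [quadGauss, ← Equiv.sum_comp ι.toEquiv]
  exact Finset.sum_congr rfl fun γ _ => hQ γ

theorem norm_quadGauss_sq (hp : p ≠ 2) (hl : l ≠ 0) : ‖quadGauss l‖ ^ 2 = p := by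
  have h := congrArg norm (quadGauss_sq hp hl)
  have h1 := congrArg norm (legendreChar_sq (p := p) (x := -1) (by simp))
  rw [norm_mul, norm_one] at h1
  have h2 : ‖χ (-1)‖ = 1 := by nlinarith [norm_nonneg (χ (-1))]
  rw [norm_mul, norm_mul, h2, one_mul, Complex.norm_natCast] at h
  rw [sq, h]

/-- Only the phase of the Gauss sum is needed from Milgram's formula: since `|g|² = p`, the positive
factor `r` must be `√p`. -/
theorem isPrimeDisc_of_sum (hp : p ≠ 2) (hl : l ≠ 0) (hQ : ∀ γ, eCircle (Q γ) = ψ (l * ι γ ^ 2))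
    {r : ℝ} (hr : 0 < r) (hsum : ∑ γ, eCircle (Q γ) = r * e ((sig : ℂ) / 8)) :
    IsPrimeDisc ι Q l sig := by
  refine ⟨hQ, ?_⟩
  rw [sum_eCircle_eq hQ] at hsum
  have hn := norm_quadGauss_sq hp hl
  have he : ‖e ((sig : ℂ) / 8)‖ = 1 := by
    rw [e, show 2 * Real.pi * Complex.I * ((sig : ℂ) / 8)
      = ((2 * Real.pi * (sig / 8) : ℝ) : ℂ) * Complex.I by push_cast; ring,
      Complex.norm_exp_ofReal_mul_I]
  rw [hsum, norm_mul, he, mul_one, Complex.norm_real, Real.norm_of_nonneg hr.le] at hn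
  have hcard : Fintype.card A = p := by
    rw [Fintype.card_congr ι.toEquiv, ZMod.card]
  rw [hcard, ← hn, Real.sqrt_sq hr.le, hsum, mul_inv, ← e_neg, neg_div, div_eq_mul_inv, mul_comm]

namespace IsPrimeDisc

variable (h : IsPrimeDisc ι Q l sig)
include h

/-- Complex conjugation of both relations. It lets the dual representation be treated as a Weil
representation with `Q`, `l` and `sig` negated. -/
theorem neg : IsPrimeDisc ι (fun γ => -Q γ) (-l) (-sig) := by
  have hQ (γ) : eCircle (-Q γ) = ψ (-l * ι γ ^ 2) := by
    rw [eCircle_neg, h.eCircle_eq, neg_mul, AddChar.map_neg_eq_inv]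
  refine ⟨hQ, ?_⟩
  rw [← sum_eCircle_eq hQ]
  simp only [eCircle_neg_eq_star]
  rw [← star_sum, sum_eCircle_eq h.eCircle_eq, ← star_inv₀, ← h.const_eq, star_div₀,
    show (-(sig : ℂ) / 8) = ((-sig / 8 : ℝ) : ℂ) by push_cast; ring, star_e_ofReal,
    Complex.star_def, Complex.conj_ofReal]
  congr 2
  push_cast
  ring

theorem weilT_mulVec (v : A → ℂ) (γ : A) :
    (weilT Q).mulVec v γ = ψ (l * ι γ ^ 2) * v γ := by
  classical
  rw [weilT, Matrix.mulVec_diagonal, h.eCircle_eq]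

theorem weilS_apply (γ δ : A) : weilS Q sig γ δ = (quadGauss l)⁻¹ * ψ (-(2 * l * ι γ * ι δ)) := by
  rw [weilS, Matrix.of_apply, h.const_eq, eCircle_neg, sub_eq_add_neg, sub_eq_add_neg, eCircle_add,
    eCircle_add, eCircle_neg, eCircle_neg, h.eCircle_eq, h.eCircle_eq, h.eCircle_eq, map_add,
    ← AddChar.map_neg_eq_inv, ← AddChar.map_neg_eq_inv, ← AddChar.map_add_eq_mul,
    ← AddChar.map_add_eq_mul, ← AddChar.map_neg_eq_inv]
  congr 2
  ring

theorem weilS_mulVec (v : A → ℂ) (γ : A) : (weilS Q sig).mulVec v γ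
    = ∑ y : ZMod p, (quadGauss l)⁻¹ * ψ (-(2 * l * ι γ * y)) * v (ι.symm y) := by
  rw [Matrix.mulVec, dotProduct, ← Equiv.sum_comp ι.symm.toEquiv]
  refine Finset.sum_congr rfl fun y _ => ?_
  rw [h.weilS_apply]
  simp

theorem weilS_transpose : (weilS Q sig).transpose = weilS Q sig := by
  ext γ δ
  rw [Matrix.transpose_apply, h.weilS_apply, h.weilS_apply, mul_right_comm _ (ι δ)]

/-- Orthogonality of characters, with `g(l) g(-l) = p`: the matrix for `-Q` is the inverse of that
for `Q`. -/
theorem weilS_mul_weilS_neg [DecidableEq A] (hp : p ≠ 2) (hl : l ≠ 0) :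
    weilS Q sig * weilS (fun γ => -Q γ) (-sig) = 1 := by
  have h' := h.neg
  ext γ δ
  have h2 := two_ne_zero_zmod hp
  have hg := quadGauss_ne_zero hp hl
  have hχ := legendreChar_sq (p := p) (x := -1) (by simp)
  have hgg : quadGauss l * quadGauss (-l) = p := by
    rw [← neg_one_mul l, quadGauss_mul hp hl (by simp), mul_left_comm, quadGauss_sq hp hl,
      ← mul_assoc, hχ, one_mul]
  have hp0 : (p : ℂ) ≠ 0 := by exact_mod_cast (Fact.out : p.Prime).ne_zero
  rw [Matrix.mul_apply, ← Equiv.sum_comp ι.symm.toEquiv]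
  have h3 (y : ZMod p) : weilS Q sig γ (ι.symm y) * weilS (fun γ => -Q γ) (-sig) (ι.symm y) δ
      = (p : ℂ)⁻¹ * ψ (2 * l * (ι δ - ι γ) * y) := by
    rw [h.weilS_apply, h'.weilS_apply, ← hgg, mul_inv, mul_mul_mul_comm,
      ← AddChar.map_add_eq_mul]
    congr 2
    simp only [AddEquiv.apply_symm_apply]
    ring
  refine (Finset.sum_congr rfl fun y _ => h3 y).trans ?_
  rw [← Finset.mul_sum, sum_stdAddChar_mul, Matrix.one_apply]
  have h4 : 2 * l * (ι δ - ι γ) = 0 ↔ γ = δ := by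
    rw [mul_eq_zero, or_iff_right (mul_ne_zero h2 hl), sub_eq_zero, ι.injective.eq_iff, eq_comm]
  simp only [h4]
  split_ifs
  · exact inv_mul_cancel₀ hp0
  · simp

end IsPrimeDisc

end WeilPrime

/-! ### Equivariance under the generators -/

section Equivariance

theorem Mp2Z.phi_zpow (g : Mp2Z) (k : ℤ) (τ : ℍ) : g.phi τ ^ (2 * k) = cocyc g.mat τ ^ k := by
  rw [zpow_mul, zpow_ofNat, g.sq]

theorem Mp2Z.mul_mat (g h : Mp2Z) : (g * h).mat = g.mat * h.mat := rfl

theorem Mp2Z.inv_mat (g : Mp2Z) : (g⁻¹).mat = g.mat⁻¹ := rfl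

theorem cocyc_T (τ : ℍ) : cocyc ModularGroup.T τ = 1 := by simp [cocyc, ModularGroup.T]

theorem cocyc_S (τ : ℍ) : cocyc ModularGroup.S τ = τ := by simp [cocyc, ModularGroup.S]

theorem cocyc_inv_smul (M : SL(2, ℤ)) (τ : ℍ) : cocyc M⁻¹ (M • τ) = (cocyc M τ)⁻¹ := by
  refine eq_inv_of_mul_eq_one_left ?_
  rw [← cocyc_mul, inv_mul_cancel]
  simp [cocyc]

variable {A : Type*} [AddCommGroup A] [Fintype A] {Q : A → UnitAddCircle} {sig : ℤ}

/-- As `k` is an integer, `φ^(2k) = (cτ + d)^k` involves no choice of root. Equivariance propagates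
along products by the cocycle relation, so induction over the graph suffices, whether or not the
graph is single valued. -/
theorem isWeil_equivariant_iff {k : ℤ} {F : ℍ → A → ℂ} :
    (∀ g R, IsWeil Q sig g R → ∀ τ : ℍ, F (g.mat • τ) = g.phi τ ^ (2 * k) • R.mulVec (F τ)) ↔
      (∀ τ : ℍ, F (ModularGroup.T • τ) = (weilT Q).mulVec (F τ)) ∧
      ∀ τ : ℍ, F (ModularGroup.S • τ) = (τ : ℂ) ^ k • (weilS Q sig).mulVec (F τ) := by
  simp only [Mp2Z.phi_zpow]
  constructor
  · intro h
    refine ⟨fun τ => ?_, fun τ => ?_⟩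
    · have := h _ _ IsWeil.T τ
      rwa [show Mp2Z.T.mat = ModularGroup.T from rfl, cocyc_T, one_zpow, one_smul] at this
    · have := h _ _ IsWeil.S τ
      rwa [show Mp2Z.S.mat = ModularGroup.S from rfl, cocyc_S] at this
  · rintro ⟨hT, hS⟩ g R hR
    induction hR with
    | T =>
      intro τ
      rw [show Mp2Z.T.mat = ModularGroup.T from rfl, cocyc_T, one_zpow, one_smul, hT]
    | S =>
      intro τ
      rw [show Mp2Z.S.mat = ModularGroup.S from rfl, cocyc_S, hS]
    | mul _ _ h1 h2 =>
      intro τ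
      rw [Mp2Z.mul_mat, mul_smul, h1, h2, cocyc_mul, mul_zpow, Matrix.mulVec_smul, smul_smul,
        Matrix.mulVec_mulVec]

theorem isWeilDual_equivariant_iff {p : ℕ} [Fact p.Prime] {ι : A ≃+ ZMod p} {l : ZMod p}
    (hp : p ≠ 2) (hl : l ≠ 0) (h : IsPrimeDisc ι Q l sig) {k : ℤ} {F : ℍ → A → ℂ} :
    (∀ g R, IsWeilDual Q sig g R → ∀ τ : ℍ,
        F (g.mat • τ) = g.phi τ ^ (2 * k) • R.mulVec (F τ)) ↔
      (∀ τ : ℍ, F (ModularGroup.T • τ) = (weilT fun γ => -Q γ).mulVec (F τ)) ∧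
      ∀ τ : ℍ, F (ModularGroup.S • τ)
        = (τ : ℂ) ^ k • (weilS (fun γ => -Q γ) (-sig)).mulVec (F τ) := by
  classical
  have h' := h.neg
  have hTT : weilT Q * weilT (fun γ => -Q γ) = 1 := by
    rw [weilT, weilT, Matrix.diagonal_mul_diagonal, ← Matrix.diagonal_one]
    congr 1
    funext γ
    rw [eCircle_neg, mul_inv_cancel₀ (eCircle_ne_zero _)]
  have hTT' : weilT (fun γ => -Q γ) * weilT Q = 1 := mul_eq_one_comm.mp hTT
  have hSS := h.weilS_mul_weilS_neg hp hl
  have hSS' : weilS (fun γ => -Q γ) (-sig) * weilS Q sig = 1 := mul_eq_one_comm.mp hSS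
  have hTt : (weilT Q).transpose = weilT Q := Matrix.diagonal_transpose _
  -- Moving the matrix to the left-hand side removes the inverse in the dual action, so that
  -- induction over the graph of `ρ` applies directly.
  have hiff : (∀ g R, IsWeilDual Q sig g R → ∀ τ : ℍ,
      F (g.mat • τ) = g.phi τ ^ (2 * k) • R.mulVec (F τ)) ↔
      ∀ g R, IsWeil Q sig g R → ∀ τ : ℍ,
        R.transpose.mulVec (F (g.mat • τ)) = cocyc g.mat τ ^ k • F τ := by
    simp only [Mp2Z.phi_zpow]
    constructor
    · intro H g R hR τ
      have h1 := H g⁻¹ R.transpose ⟨R, by rwa [inv_inv], rfl⟩ (g.mat • τ)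
      rw [Mp2Z.inv_mat, inv_smul_smul, cocyc_inv_smul, inv_zpow] at h1
      rw [h1, smul_smul, mul_inv_cancel₀ (zpow_ne_zero _ (cocyc_ne_zero _ _)), one_smul]
    · rintro H g _ ⟨R, hR, rfl⟩ τ
      have h1 := H g⁻¹ R hR (g.mat • τ)
      rw [Mp2Z.inv_mat, inv_smul_smul, cocyc_inv_smul, inv_zpow] at h1
      rw [h1, smul_smul, mul_inv_cancel₀ (zpow_ne_zero _ (cocyc_ne_zero _ _)), one_smul]
  rw [hiff]
  constructor
  · intro H
    refine ⟨fun τ => ?_, fun τ => ?_⟩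
    · have := H _ _ IsWeil.T τ
      rw [show Mp2Z.T.mat = ModularGroup.T from rfl, cocyc_T, one_zpow, one_smul, hTt] at this
      rw [← this, Matrix.mulVec_mulVec, hTT', Matrix.one_mulVec]
    · have := H _ _ IsWeil.S τ
      rw [show Mp2Z.S.mat = ModularGroup.S from rfl, cocyc_S, h.weilS_transpose] at this
      rw [← Matrix.mulVec_smul, ← this, Matrix.mulVec_mulVec, hSS', Matrix.one_mulVec]
  · rintro ⟨hT, hS⟩ g R hR
    induction hR with
    | T =>
      intro τ
      rw [show Mp2Z.T.mat = ModularGroup.T from rfl, cocyc_T, one_zpow, one_smul, hT, hTt,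
        Matrix.mulVec_mulVec, hTT, Matrix.one_mulVec]
    | S =>
      intro τ
      rw [show Mp2Z.S.mat = ModularGroup.S from rfl, cocyc_S, hS, h.weilS_transpose,
        Matrix.mulVec_smul, Matrix.mulVec_mulVec, hSS, Matrix.one_mulVec]
    | mul _ _ h1 h2 =>
      intro τ
      rw [Mp2Z.mul_mat, mul_smul, Matrix.transpose_mul, ← Matrix.mulVec_mulVec, h1,
        Matrix.mulVec_smul, h2, cocyc_mul, mul_zpow, smul_smul]

end Equivariance

/-! ### Fourier modes of smooth periodic functions on the upper half plane -/

section FourierMode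

open MeasureTheory intervalIntegral

/-- The `n`-th Fourier coefficient of `x ↦ G (x + i y)`. -/
def fourierMode (n : ℤ) (G : ℂ → ℂ) (y : ℝ) : ℂ :=
  ∫ x in (0 : ℝ)..1, e (-n * x) * G (x + y * Complex.I)

theorem continuous_e_mul (c : ℂ) : Continuous fun x : ℝ => e (c * x) := by
  unfold e; fun_prop

theorem hasDerivAt_e_mul (c : ℂ) (x : ℝ) :
    HasDerivAt (fun x : ℝ => e (c * x)) (2 * Real.pi * Complex.I * c * e (c * x)) x := by
  have h : HasDerivAt (fun x : ℝ => 2 * Real.pi * Complex.I * (c * x)) (2 * Real.pi * Complex.I * c) x := by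
    have := ((Complex.ofRealCLM.hasDerivAt (x := x)).const_mul c).const_mul (2 * Real.pi * Complex.I)
    simpa using! this
  exact h.cexp.congr_deriv (mul_comm _ _)

theorem im_add_mul_I (x y : ℝ) : ((x : ℂ) + y * Complex.I).im = y := by simp

theorem contDiffOn_partialX {G : ℂ → ℂ} (hG : ContDiffOn ℝ ∞ G {z : ℂ | 0 < z.im}) :
    ContDiffOn ℝ ∞ (partialX G) {z : ℂ | 0 < z.im} := contDiffOn_fderiv_apply hG 1

theorem contDiffOn_partialY {G : ℂ → ℂ} (hG : ContDiffOn ℝ ∞ G {z : ℂ | 0 < z.im}) :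
    ContDiffOn ℝ ∞ (partialY G) {z : ℂ | 0 < z.im} := contDiffOn_fderiv_apply hG Complex.I

theorem hasDerivAt_horizontal {G : ℂ → ℂ} (hG : ContDiffOn ℝ ∞ G {z : ℂ | 0 < z.im}) (x : ℝ) {y : ℝ}
    (hy : 0 < y) :
    HasDerivAt (fun x : ℝ => G (x + y * Complex.I)) (partialX G (x + y * Complex.I)) x := by
  have h1 := ((hG.contDiffAt (isOpen_im_pos.mem_nhds
    (show 0 < ((x : ℂ) + y * Complex.I).im by rwa [im_add_mul_I]))).differentiableAt
      (by simp)).hasFDerivAt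
  have h2 : HasDerivAt (fun x : ℝ => (x : ℂ) + y * Complex.I) 1 x := by
    simpa using! (Complex.ofRealCLM.hasDerivAt (x := x)).add_const (y * Complex.I)
  exact h1.comp_hasDerivAt x h2

theorem hasDerivAt_vertical {G : ℂ → ℂ} (hG : ContDiffOn ℝ ∞ G {z : ℂ | 0 < z.im}) (x : ℝ) {y : ℝ}
    (hy : 0 < y) :
    HasDerivAt (fun y : ℝ => G (x + y * Complex.I)) (partialY G (x + y * Complex.I)) y := by
  have h1 := ((hG.contDiffAt (isOpen_im_pos.mem_nhds
    (show 0 < ((x : ℂ) + y * Complex.I).im by rwa [im_add_mul_I]))).differentiableAt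
      (by simp)).hasFDerivAt
  have h2 : HasDerivAt (fun y : ℝ => (x : ℂ) + y * Complex.I) Complex.I y := by
    simpa using! ((Complex.ofRealCLM.hasDerivAt (x := y)).mul_const Complex.I).const_add (x : ℂ)
  exact h1.comp_hasDerivAt y h2

theorem continuous_horizontal {G : ℂ → ℂ} (hG : ContDiffOn ℝ ∞ G {z : ℂ | 0 < z.im}) {y : ℝ}
    (hy : 0 < y) : Continuous fun x : ℝ => G (x + y * Complex.I) :=
  continuous_iff_continuousAt.mpr fun x => (hasDerivAt_horizontal hG x hy).continuousAt

theorem hasDerivAt_fourierMode {G : ℂ → ℂ} (hG : ContDiffOn ℝ ∞ G {z : ℂ | 0 < z.im}) (n : ℤ) {y : ℝ}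
    (hy : 0 < y) : HasDerivAt (fourierMode n G) (fourierMode n (partialY G) y) y := by
  have hcont (H : ℂ → ℂ) (hH : ContDiffOn ℝ ∞ H {z : ℂ | 0 < z.im}) (t : ℝ) (ht : 0 < t) :
      Continuous fun x : ℝ => e (-n * x) * H (x + t * Complex.I) :=
    (continuous_e_mul _).mul (continuous_horizontal hH ht)
  -- Compactness of `[0, 1] × [y/2, 2y]` gives the constant dominating the differentiated integrand
  -- near `y`.
  obtain ⟨C, hC⟩ := (isCompact_Icc.prod isCompact_Icc :
    IsCompact (Set.Icc (0 : ℝ) 1 ×ˢ Set.Icc (y / 2) (2 * y))).exists_bound_of_continuousOn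
    (f := fun q : ℝ × ℝ => e (-n * q.1) * partialY G (q.1 + q.2 * Complex.I)) (by
      refine ContinuousOn.mul ?_ ((contDiffOn_partialY hG).continuousOn.comp ?_ ?_)
      · exact ((continuous_e_mul (-n)).comp continuous_fst).continuousOn
      · fun_prop
      · rintro ⟨a, b⟩ ⟨-, hb⟩
        have : 0 < b := lt_of_lt_of_le (by positivity) hb.1
        simpa using this)
  refine (intervalIntegral.hasDerivAt_integral_of_dominated_loc_of_deriv_le (s := Set.Icc (y / 2) (2 * y))
    (bound := fun _ => C) (F := fun (t : ℝ) (x : ℝ) => e (-n * x) * G (x + t * Complex.I))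
    (F' := fun (t : ℝ) (x : ℝ) => e (-n * x) * partialY G (x + t * Complex.I))
    (Icc_mem_nhds (half_lt_self hy) (lt_two_mul_self hy)) ?_ ?_ ?_ ?_ ?_ ?_).2
  · filter_upwards [lt_mem_nhds hy] with t ht
    exact (hcont G hG t ht).aestronglyMeasurable
  · exact (hcont G hG y hy).intervalIntegrable _ _
  · exact (hcont _ (contDiffOn_partialY hG) y hy).aestronglyMeasurable
  · refine Filter.Eventually.of_forall fun x hx t ht => hC (x, t) ⟨?_, ht⟩
    rw [Set.uIoc_of_le zero_le_one] at hx
    exact Set.Ioc_subset_Icc_self hx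
  · exact _root_.intervalIntegrable_const
  · refine Filter.Eventually.of_forall fun x hx t ht => ?_
    have ht0 : 0 < t := lt_of_lt_of_le (by positivity) ht.1
    exact (hasDerivAt_vertical hG x ht0).const_mul _

/-- Integration by parts; the boundary terms cancel by periodicity. -/
theorem fourierMode_partialX {G : ℂ → ℂ} (hG : ContDiffOn ℝ ∞ G {z : ℂ | 0 < z.im})
    (hper : ∀ z : ℂ, 0 < z.im → G (z + 1) = G z) (n : ℤ) {y : ℝ} (hy : 0 < y) :
    fourierMode n (partialX G) y = 2 * Real.pi * Complex.I * n * fourierMode n G y := by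
  have h := integral_eq_sub_of_hasDerivAt (a := 0) (b := 1)
    (f := fun x : ℝ => e (-n * x) * G (x + y * Complex.I))
    (fun x _ => (hasDerivAt_e_mul (-n) x).mul (hasDerivAt_horizontal hG x hy))
    ((((continuous_const.mul (continuous_e_mul _)).mul (continuous_horizontal hG hy)).add
      ((continuous_e_mul _).mul (continuous_horizontal (contDiffOn_partialX hG) hy))).intervalIntegrable
      _ _)
  have h0 : e (-(n : ℂ) * ((1 : ℝ) : ℂ)) * G (((1 : ℝ) : ℂ) + y * Complex.I)
      - e (-(n : ℂ) * ((0 : ℝ) : ℂ)) * G (((0 : ℝ) : ℂ) + y * Complex.I) = 0 := by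
    rw [Complex.ofReal_one, Complex.ofReal_zero, mul_one, mul_zero, e_zero, e_neg, e_intCast, inv_one,
      zero_add, add_comm, hper _ (by simpa using hy), sub_self]
  rw [h0, intervalIntegral.integral_add] at h
  · rw [fourierMode, fourierMode, ← intervalIntegral.integral_const_mul]
    rw [add_comm] at h
    rw [eq_neg_of_add_eq_zero_left h, ← intervalIntegral.integral_neg]
    congr 1
    funext x
    ring
  · exact ((continuous_const.mul (continuous_e_mul _)).mul
      (continuous_horizontal hG hy)).intervalIntegrable _ _
  · exact ((continuous_e_mul _).mul
      (continuous_horizontal (contDiffOn_partialX hG) hy)).intervalIntegrable _ _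

theorem partialX_add_one {G : ℂ → ℂ} (hper : ∀ z : ℂ, 0 < z.im → G (z + 1) = G z) (z : ℂ)
    (hz : 0 < z.im) : partialX G (z + 1) = partialX G z := by
  have h : (fun w => G (w + 1)) =ᶠ[nhds z] G := by
    filter_upwards [isOpen_im_pos.mem_nhds hz] with w hw using hper w hw
  rw [partialX, partialX, ← fderiv_comp_add_right, h.fderiv_eq]

theorem norm_e_ofReal (x : ℝ) : ‖e x‖ = 1 := by
  rw [e, show 2 * Real.pi * Complex.I * (x : ℂ)
      = ((2 * Real.pi * x : ℝ) : ℂ) * Complex.I by push_cast; ring, Complex.norm_exp_ofReal_mul_I]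

theorem norm_fourierMode_le {G : ℂ → ℂ} {y C : ℝ}
    (hC : ∀ x ∈ Set.Ioc (0 : ℝ) 1, ‖G (x + y * Complex.I)‖ ≤ C) (n : ℤ) :
    ‖fourierMode n G y‖ ≤ C := by
  have h := intervalIntegral.norm_integral_le_of_norm_le_const (a := 0) (b := 1) (C := C)
    (f := fun x : ℝ => e (-n * x) * G (x + y * Complex.I)) (fun x hx => by
      rw [Set.uIoc_of_le zero_le_one] at hx
      rw [norm_mul, show (-(n : ℂ) * (x : ℂ)) = ((-n * x : ℝ) : ℂ) by push_cast; ring, norm_e_ofReal,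
        one_mul]
      exact hC x hx)
  rwa [sub_zero, abs_one, mul_one] at h

theorem exists_bound_fourierMode {G : ℂ → ℂ} (hG : ContDiffOn ℝ ∞ G {z : ℂ | 0 < z.im}) {y : ℝ}
    (hy : 0 < y) : ∃ C : ℝ, ∀ n : ℤ, ‖fourierMode n G y‖ ≤ C := by
  obtain ⟨C, hC⟩ := (isCompact_Icc : IsCompact (Set.Icc (0 : ℝ) 1)).exists_bound_of_continuousOn
    (continuous_horizontal hG hy).continuousOn
  exact ⟨C, norm_fourierMode_le fun x hx => hC x (Set.Ioc_subset_Icc_self hx)⟩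

/-- Two integrations by parts bound the `n`-th mode by a constant times `n⁻²`. -/
theorem summable_fourierMode {G : ℂ → ℂ} (hG : ContDiffOn ℝ ∞ G {z : ℂ | 0 < z.im})
    (hper : ∀ z : ℂ, 0 < z.im → G (z + 1) = G z) {y : ℝ} (hy : 0 < y) :
    Summable fun n : ℤ => fourierMode n G y := by
  obtain ⟨C, hC⟩ := exists_bound_fourierMode (contDiffOn_partialX (contDiffOn_partialX hG)) hy
  have hs := (Real.summable_one_div_int_pow (p := 2)).mpr one_lt_two
  refine Summable.of_norm_bounded_eventually (hs.mul_left C) ?_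
  rw [Filter.eventually_cofinite]
  refine (Set.finite_singleton (0 : ℤ)).subset fun n hn => ?_
  by_contra hn0
  rw [Set.mem_singleton_iff] at hn0
  refine hn ?_
  have h1 := hC n
  rw [fourierMode_partialX (contDiffOn_partialX hG) (partialX_add_one hper) n hy,
    fourierMode_partialX hG hper n hy, ← mul_assoc, norm_mul] at h1
  have h2 : ‖(2 * Real.pi * Complex.I * n * (2 * Real.pi * Complex.I * n) : ℂ)‖
      = (2 * Real.pi) ^ 2 * (n : ℝ) ^ 2 := by
    simp only [norm_mul, Complex.norm_I, Complex.norm_intCast, Complex.norm_real, Complex.norm_ofNat,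
      Real.norm_of_nonneg Real.pi_pos.le, ← sq_abs (n : ℝ)]
    ring
  rw [h2] at h1
  have hn2 : 0 < (n : ℝ) ^ 2 := by positivity
  rw [mul_one_div, le_div_iff₀ hn2]
  refine le_trans ?_ h1
  have h3 : 1 ≤ (2 * Real.pi) ^ 2 := by nlinarith [Real.pi_gt_three]
  have h4 : 0 ≤ ‖fourierMode n G y‖ * (n : ℝ) ^ 2 := by positivity
  nlinarith

theorem hasSum_fourierMode {G : ℂ → ℂ} (hG : ContDiffOn ℝ ∞ G {z : ℂ | 0 < z.im})
    (hper : ∀ z : ℂ, 0 < z.im → G (z + 1) = G z) (x : ℝ) {y : ℝ} (hy : 0 < y) :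
    HasSum (fun n : ℤ => fourierMode n G y * e (n * x)) (G (x + y * Complex.I)) := by
  have : Fact ((0 : ℝ) < 1) := ⟨one_pos⟩
  have hp : Function.Periodic (fun x : ℝ => G (x + y * Complex.I)) 1 := by
    intro x
    have := hper (x + y * Complex.I) (by rwa [im_add_mul_I])
    refine Eq.trans (congrArg G ?_) this
    push_cast
    ring
  let f : C(UnitAddCircle, ℂ) := ⟨hp.lift, (continuous_horizontal hG hy).quotient_lift _⟩
  have hcoeff (n : ℤ) : fourierCoeff f n = fourierMode n G y := by
    rw [fourierCoeff_eq_intervalIntegral _ n 0, fourierMode]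
    simp only [zero_add, div_one, one_smul]
    refine intervalIntegral.integral_congr fun t _ => ?_
    change fourier (-n) (t : AddCircle (1 : ℝ)) • G (t + y * Complex.I) = _
    rw [fourier_coe_apply, smul_eq_mul, e]
    congr 2
    push_cast
    ring
  have hs : Summable (fourierCoeff f) :=
    (summable_fourierMode hG hper hy).congr fun n => (hcoeff n).symm
  have key := has_pointwise_sum_fourier_series_of_summable hs (x : UnitAddCircle)
  have hfun : (fun n : ℤ => fourierCoeff f n • fourier n (x : UnitAddCircle))
      = fun n : ℤ => fourierMode n G y * e (n * x) := by
    funext n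
    rw [hcoeff, fourier_coe_apply, smul_eq_mul, e]
    congr 2
    push_cast
    ring
  rw [hfun] at key
  exact key

end FourierMode

/-! ### The incomplete Gamma function -/

section IncGamma

open MeasureTheory Filter Topology

theorem continuousOn_incGamma_integrand (s : ℝ) :
    ContinuousOn (fun t : ℝ => Real.exp (-t) * t ^ (s - 1)) (Set.Ioi 0) :=
  (Real.continuous_exp.comp continuous_neg).continuousOn.mul
    (continuousOn_id.rpow_const fun _ hx => Or.inl (ne_of_gt hx))

theorem integrableOn_incGamma (s : ℝ) {y : ℝ} (hy : 0 < y) :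
    IntegrableOn (fun t : ℝ => Real.exp (-t) * t ^ (s - 1)) (Set.Ioi y) := by
  refine integrable_of_isBigO_exp_neg (b := 1 / 2) (by norm_num)
    ((continuousOn_incGamma_integrand s).mono fun _ hx => lt_of_lt_of_le hy hx) ?_
  exact (Real.Gamma_integrand_isLittleO (s - 1)).isBigO

theorem incGamma_eq_sub (s : ℝ) {y u : ℝ} (hy : 0 < y) (hu : 0 < u) :
    incGamma s u = incGamma s y - ∫ t in y..u, Real.exp (-t) * t ^ (s - 1) := by
  rw [incGamma, incGamma, eq_sub_iff_add_eq, add_comm]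
  exact intervalIntegral.integral_interval_add_Ioi (integrableOn_incGamma s hy)
    (integrableOn_incGamma s hu)

theorem hasDerivAt_incGamma (s : ℝ) {y : ℝ} (hy : 0 < y) :
    HasDerivAt (incGamma s) (-(Real.exp (-y) * y ^ (s - 1))) y := by
  have hc := (continuousOn_incGamma_integrand s).continuousAt (Ioi_mem_nhds hy)
  have h := intervalIntegral.integral_hasDerivAt_right (a := y) (b := y)
    (f := fun t : ℝ => Real.exp (-t) * t ^ (s - 1)) (by simp)
    ((continuousOn_incGamma_integrand s).stronglyMeasurableAtFilter isOpen_Ioi _ hy) hc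
  refine (h.const_sub (incGamma s y)).congr_of_eventuallyEq ?_
  filter_upwards [lt_mem_nhds hy] with u hu using incGamma_eq_sub s hy hu

theorem tendsto_incGamma (s : ℝ) : Tendsto (incGamma s) atTop (𝓝 0) := by
  have h := intervalIntegral_tendsto_integral_Ioi 1 (integrableOn_incGamma s one_pos) tendsto_id
  have h1 := h.const_sub (incGamma s 1)
  rw [show incGamma s 1 - ∫ x in Set.Ioi 1, Real.exp (-x) * x ^ (s - 1) = 0 from sub_self _] at h1
  refine h1.congr' ?_
  filter_upwards [eventually_gt_atTop 0] with u hu using (incGamma_eq_sub s one_pos hu).symm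

end IncGamma

/-! ### The differential equation of the Fourier modes -/

section ModeODE

open Filter Topology

/-- Harmonicity says that `y^k ∂f/∂τ̄` is antiholomorphic. On the `n`-th mode this reads:
`exp(-2πny) y^k (a' + 2πn a)` is constant, a first integral that reduces the order of the equation
to one. -/
theorem exists_hasDerivAt_exp_mul (n k : ℤ) {a a' a'' : ℝ → ℂ}
    (h1 : ∀ y, 0 < y → HasDerivAt a (a' y) y) (h2 : ∀ y, 0 < y → HasDerivAt a' (a'' y) y)
    (hode : ∀ y : ℝ, 0 < y → -(y : ℂ) ^ 2 * ((2 * Real.pi * Complex.I * n) ^ 2 * a y + a'' y)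
      + Complex.I * k * y * (2 * Real.pi * Complex.I * n * a y + Complex.I * a' y) = 0) :
    ∃ C : ℂ, ∀ y : ℝ, 0 < y → HasDerivAt (fun y : ℝ => Complex.exp ((2 * Real.pi * n * y : ℝ)) * a y)
      (C * ((Real.exp (4 * Real.pi * n * y) * y ^ (-k) : ℝ) : ℂ)) y := by
  have hexp (c : ℝ) (y : ℝ) : HasDerivAt (fun y : ℝ => Complex.exp ((c * y : ℝ)))
      (c * Complex.exp ((c * y : ℝ))) y := by
    have h := ((hasDerivAt_id y).const_mul c).ofReal_comp.cexp
    refine h.congr_deriv ?_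
    rw [mul_one, mul_comm]
    rfl
  have hpow (y : ℝ) (hy : 0 < y) : HasDerivAt (fun y : ℝ => ((y : ℂ)) ^ k)
      (k * (y : ℂ) ^ (k - 1)) y := by
    have h := (hasDerivAt_zpow k (y : ℂ) (Or.inl (by exact_mod_cast hy.ne'))).comp_ofReal
    exact h
  have hB (y : ℝ) (hy : 0 < y) : HasDerivAt (fun y : ℝ => Complex.exp ((-(2 * Real.pi * n) * y : ℝ))
      * (y : ℂ) ^ k * (a' y + 2 * Real.pi * n * a y)) 0 y := by
    have hy0 : (y : ℂ) ≠ 0 := by exact_mod_cast hy.ne'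
    refine (((hexp (-(2 * Real.pi * n)) y).mul (hpow y hy)).mul
      ((h2 y hy).add ((h1 y hy).const_mul (2 * Real.pi * n : ℂ)))).congr_deriv ?_
    simp only [Pi.add_apply, Pi.mul_apply]
    have h := hode y hy
    have h3 : (y : ℂ) ^ 2 * (a'' y + 2 * Real.pi * n * a' y) + (k * y - 2 * Real.pi * n * y ^ 2)
        * (a' y + 2 * Real.pi * n * a y) = 0 := by
      linear_combination -h - (4 * Real.pi ^ 2 * n ^ 2 * y ^ 2 * a y - k * y * a' y - 2 * Real.pi * n * k * y * a y) * Complex.I_sq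
    have h4 : (y : ℂ) ^ k = (y : ℂ) ^ (k - 1) * y := by
      rw [← zpow_add_one₀ hy0, sub_add_cancel]
    rw [h4]
    have h5 : (y : ℂ) * ((-(2 * Real.pi * n) * y + k) * (a' y + 2 * Real.pi * n * a y)
      + y * (a'' y + 2 * Real.pi * n * a' y)) = 0 := by linear_combination h3
    have h6 := (mul_eq_zero.mp h5).resolve_left hy0
    push_cast
    linear_combination (Complex.exp (-(2 * Real.pi * n) * y) * (y : ℂ) ^ (k - 1)) * h6
  obtain ⟨C, hC⟩ := isOpen_Ioi.exists_is_const_of_deriv_eq_zero isPreconnected_Ioi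
    (fun y hy => (hB y hy).differentiableAt.differentiableWithinAt) (fun y hy => (hB y hy).deriv)
  refine ⟨C, fun y hy => ?_⟩
  have hy0 : (y : ℂ) ≠ 0 := by exact_mod_cast hy.ne'
  refine ((hexp (2 * Real.pi * n) y).mul (h1 y hy)).congr_deriv ?_
  have h2 : ((Real.exp (4 * Real.pi * n * y) * y ^ (-k) : ℝ) : ℂ)
      = ((Real.exp (4 * Real.pi * n * y) : ℝ) : ℂ) * ((y : ℂ) ^ k)⁻¹ := by
    rw [Complex.ofReal_mul, Complex.ofReal_zpow, zpow_neg]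
  rw [← hC y hy, h2]
  have h3 : ((Real.exp (4 * Real.pi * n * y) : ℝ) : ℂ)
      = Complex.exp ((2 * Real.pi * n * y : ℝ)) * Complex.exp ((2 * Real.pi * n * y : ℝ)) := by
    rw [← Complex.exp_add, Complex.ofReal_exp]
    congr 1
    push_cast
    ring
  have h4 : Complex.exp ((-(2 * Real.pi * n) * y : ℝ)) = (Complex.exp ((2 * Real.pi * n * y : ℝ)))⁻¹ := by
    rw [← Complex.exp_neg]
    congr 1
    push_cast
    ring
  have h5 := Complex.exp_ne_zero ((2 * Real.pi * n * y : ℝ) : ℂ)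
  have h6 : (y : ℂ) ^ k ≠ 0 := zpow_ne_zero _ hy0
  rw [h3, h4]
  field_simp
  push_cast
  ring

/-- If `C ≠ 0`, the mean value theorem on `[y, y + 1]` makes `A / C` increase by at least `exp(2πny)
(y + 1)^(-|k|)`, while `hbound` allows only `O(exp((2πn - ε) y))`. The real part is taken because
the mean value theorem needs a real function. -/
theorem mode_const_eq_zero {n k : ℤ} (hn : 0 ≤ n) {A : ℝ → ℂ} {C c : ℂ} {K Y ε : ℝ} (hε : 0 < ε)
    (hA : ∀ y : ℝ, 0 < y →
      HasDerivAt A (C * ((Real.exp (4 * Real.pi * n * y) * y ^ (-k) : ℝ) : ℂ)) y)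
    (hbound : ∀ y, Y ≤ y → ‖A y - c‖ ≤ K * Real.exp ((2 * Real.pi * n - ε) * y)) : C = 0 := by
  by_contra hC
  have hn' : (0 : ℝ) ≤ 2 * Real.pi * n := by positivity
  set d : ℝ := 2 * Real.pi * n with hd
  have key : ∀ y, max 1 Y ≤ y →
      ‖C‖ ≤ (K * (1 + Real.exp d)) * (Real.exp (-ε * y) * (y + 1) ^ k.natAbs) := by
    intro y hy
    have hy1 : 1 ≤ y := (le_max_left _ _).trans hy
    have hyY : Y ≤ y := (le_max_right _ _).trans hy
    have hg (t : ℝ) (ht : 0 < t) : HasDerivAt (fun t => (A t / C).re)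
        (Real.exp (4 * Real.pi * n * t) * t ^ (-k)) t := by
      have h := (hA t ht).div_const C
      rw [mul_div_cancel_left₀ _ hC] at h
      have h2 := Complex.reCLM.hasFDerivAt.comp_hasDerivAt t h
      exact h2.congr_deriv (Complex.ofReal_re _)
    obtain ⟨ξ, hξ, hslope⟩ := exists_hasDerivAt_eq_slope (fun t => (A t / C).re)
      (fun t => Real.exp (4 * Real.pi * n * t) * t ^ (-k)) (a := y) (b := y + 1) (by linarith)
      (fun t ht => (hg t (by linarith [ht.1])).continuousAt.continuousWithinAt)
      (fun t ht => hg t (by linarith [ht.1]))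
    have hξ1 : 1 ≤ ξ := by linarith [hξ.1]
    have hK : 0 ≤ K := by
      have := (norm_nonneg _).trans (hbound y hyY)
      exact nonneg_of_mul_nonneg_left this (Real.exp_pos _)
    have hupper : ‖C‖ * (Real.exp (4 * Real.pi * n * ξ) * ξ ^ (-k))
        ≤ K * (1 + Real.exp d) * Real.exp ((d - ε) * y) := by
      rw [hslope, add_sub_cancel_left, div_one, ← Complex.sub_re, ← sub_div]
      have h1 : ((A (y + 1) - A y) / C).re ≤ ‖A (y + 1) - A y‖ / ‖C‖ :=
        (Complex.re_le_norm _).trans (norm_div _ _).le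
      have h2 : ‖A (y + 1) - A y‖ ≤ ‖A (y + 1) - c‖ + ‖A y - c‖ := by
        rw [show A (y + 1) - A y = (A (y + 1) - c) - (A y - c) by ring]
        exact norm_sub_le _ _
      have h3 := hbound y hyY
      have h4 := hbound (y + 1) (by linarith)
      have h5 : Real.exp ((d - ε) * (y + 1)) ≤ Real.exp d * Real.exp ((d - ε) * y) := by
        rw [← Real.exp_add, Real.exp_le_exp]
        linarith
      have hC0 : 0 < ‖C‖ := norm_pos_iff.mpr hC
      calc ‖C‖ * ((A (y + 1) - A y) / C).re ≤ ‖C‖ * (‖A (y + 1) - A y‖ / ‖C‖) := by gcongr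
        _ = ‖A (y + 1) - A y‖ := by field_simp
        _ ≤ K * (Real.exp d * Real.exp ((d - ε) * y)) + K * Real.exp ((d - ε) * y) := by
            refine h2.trans (add_le_add (h4.trans ?_) h3)
            gcongr
        _ = _ := by ring
    -- For `n > 0` the exponent `4πnξ` would give more, but `d y` suffices and also covers `n = 0`,
    -- where the contradiction comes from `exp(-εy)` alone.
    have hlower : Real.exp (d * y) * ((y + 1) ^ k.natAbs)⁻¹
        ≤ Real.exp (4 * Real.pi * n * ξ) * ξ ^ (-k) := by
      have hpow : ((y + 1) ^ k.natAbs)⁻¹ ≤ ξ ^ (-k) := by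
        rw [zpow_neg]
        refine inv_anti₀ (by positivity) ?_
        calc ξ ^ k ≤ ξ ^ ((k.natAbs : ℕ) : ℤ) := zpow_le_zpow_right₀ hξ1 Int.le_natAbs
          _ = ξ ^ k.natAbs := zpow_natCast _ _
          _ ≤ _ := by
            have := hξ.2.le
            gcongr
      refine mul_le_mul (Real.exp_le_exp.mpr ?_) hpow (by positivity) (Real.exp_pos _).le
      have := hξ.1.le
      rw [show 4 * Real.pi * n * ξ = d * (2 * ξ) by rw [hd]; ring]
      exact mul_le_mul_of_nonneg_left (by linarith) hn'
    have hpos : 0 < Real.exp (d * y) * ((y + 1) ^ k.natAbs)⁻¹ := by positivity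
    have h7 := (mul_le_mul_of_nonneg_left hlower (norm_nonneg C)).trans hupper
    rw [← le_div_iff₀ hpos] at h7
    refine h7.trans (le_of_eq ?_)
    have h8 : Real.exp ((d - ε) * y) = Real.exp (d * y) * Real.exp (-ε * y) := by
      rw [← Real.exp_add]; congr 1; ring
    rw [h8]
    field_simp
  have hlim : Tendsto (fun y : ℝ => (K * (1 + Real.exp d))
      * (Real.exp (-ε * y) * (y + 1) ^ k.natAbs)) atTop (𝓝 0) := by
    have h1 := (Real.tendsto_pow_mul_exp_neg_atTop_nhds_zero k.natAbs).comp
      ((tendsto_atTop_add_const_right atTop 1 tendsto_id).const_mul_atTop hε)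
    have h2 := h1.const_mul (K * (1 + Real.exp d) * (ε ^ k.natAbs)⁻¹ * Real.exp ε)
    rw [mul_zero] at h2
    refine h2.congr fun y => ?_
    simp only [Function.comp_apply, id_eq]
    rw [mul_pow, show -(ε * (y + 1)) = -ε * y + -ε by ring, Real.exp_add, Real.exp_neg ε]
    have := Real.exp_pos ε
    field_simp
  have := ge_of_tendsto hlim ((eventually_ge_atTop (max 1 Y)).mono fun y hy => key y hy)
  exact hC (norm_le_zero_iff.mp this)

/-- Integrating the reduced equation. For `n ≥ 0` growth kills the nonconstant solution; for `n < 0`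
the second solution is the incomplete Gamma function. -/
theorem exists_mode_coeffs (n k : ℤ) {a a' a'' : ℝ → ℂ} {c : ℂ} {K Y ε : ℝ} (hε : 0 < ε)
    (h1 : ∀ y, 0 < y → HasDerivAt a (a' y) y) (h2 : ∀ y, 0 < y → HasDerivAt a' (a'' y) y)
    (hode : ∀ y : ℝ, 0 < y → -(y : ℂ) ^ 2 * ((2 * Real.pi * Complex.I * n) ^ 2 * a y + a'' y)
      + Complex.I * k * y * (2 * Real.pi * Complex.I * n * a y + Complex.I * a' y) = 0)
    (hbound : ∀ y, Y ≤ y →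
      ‖a y - c * Complex.exp ((-(2 * Real.pi * n * y) : ℝ))‖ ≤ K * Real.exp (-ε * y)) :
    ∃ cp cm : ℂ, (0 ≤ n → cm = 0) ∧ (n < 0 → c = 0 → cp = 0) ∧
      ((∀ y, 0 < y → a y = 0) → cp = 0 ∧ cm = 0) ∧
      ∀ y : ℝ, 0 < y → a y = (cp + cm * (incGamma (1 - k) (4 * Real.pi * |(n : ℝ)| * y) : ℂ))
        * Complex.exp ((-(2 * Real.pi * n * y) : ℝ)) := by
  -- An identically vanishing mode receives zero coefficients outright; this is how the plus
  -- condition passes from modes to coefficients.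
  by_cases hzero : ∀ y, 0 < y → a y = 0
  · exact ⟨0, 0, fun _ => rfl, fun _ _ => rfl, fun _ => ⟨rfl, rfl⟩, fun y hy => by
      rw [hzero y hy]; simp⟩
  obtain ⟨C, hC⟩ := exists_hasDerivAt_exp_mul n k h1 h2 hode
  set A : ℝ → ℂ := fun y => Complex.exp ((2 * Real.pi * n * y : ℝ)) * a y with hA
  have haA (y : ℝ) : a y = A y * Complex.exp ((-(2 * Real.pi * n * y) : ℝ)) := by
    rw [hA, mul_right_comm, ← Complex.exp_add, ← Complex.ofReal_add, add_neg_cancel,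
      Complex.ofReal_zero, Complex.exp_zero, one_mul]
  have hAbound (y : ℝ) (hy : Y ≤ y) : ‖A y - c‖ ≤ K * Real.exp ((2 * Real.pi * n - ε) * y) := by
    have h3 : A y - c = Complex.exp ((2 * Real.pi * n * y : ℝ))
        * (a y - c * Complex.exp ((-(2 * Real.pi * n * y) : ℝ))) := by
      rw [mul_sub, mul_left_comm, ← Complex.exp_add, ← Complex.ofReal_add, add_neg_cancel,
        Complex.ofReal_zero, Complex.exp_zero, mul_one]
    rw [h3, norm_mul, ← Complex.ofReal_exp, Complex.norm_real, Real.norm_of_nonneg (Real.exp_pos _).le,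
      show (2 * Real.pi * n - ε) * y = 2 * Real.pi * n * y + -ε * y by ring, Real.exp_add,
      mul_left_comm]
    exact mul_le_mul_of_nonneg_left (hbound y hy) (Real.exp_pos _).le
  rcases le_or_gt 0 n with hn | hn
  · have hC0 := mode_const_eq_zero hn hε hC hAbound
    obtain ⟨b, hb⟩ := isOpen_Ioi.exists_is_const_of_deriv_eq_zero (f := A) isPreconnected_Ioi
      (fun y hy => (hC y hy).differentiableAt.differentiableWithinAt)
      (fun y hy => by rw [(hC y hy).deriv, hC0, zero_mul]; rfl)
    refine ⟨b, 0, fun _ => rfl, fun h => absurd hn h.not_ge, fun h => absurd h hzero, fun y hy => ?_⟩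
    rw [haA, hb y hy, zero_mul, add_zero]
  · have hnR : (n : ℝ) < 0 := by exact_mod_cast hn
    have habs : 0 < |(n : ℝ)| := abs_pos.mpr hnR.ne
    set d : ℝ := 4 * Real.pi * |(n : ℝ)| with hd
    have hd0 : 0 < d := by positivity
    -- The derivative of `Γ(1 - k, d y)` is `-d^(1-k) exp(4πny) y^(-k)`, so this multiple of it
    -- accounts for the whole derivative of `A`.
    set cm : ℂ := -C * ((d ^ (k - 1) : ℝ) : ℂ) with hcm
    have hG (y : ℝ) (hy : 0 < y) : HasDerivAt (fun y : ℝ => (incGamma (1 - k) (d * y) : ℂ))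
        ((-(d ^ (1 - k) * (Real.exp (4 * Real.pi * n * y) * y ^ (-k))) : ℝ) : ℂ) y := by
      have h3 := ((hasDerivAt_incGamma (1 - k) (mul_pos hd0 hy)).comp y
        ((hasDerivAt_id y).const_mul d)).ofReal_comp
      refine h3.congr_deriv ?_
      congr 1
      rw [show (1 - (k : ℝ) - 1) = ((-k : ℤ) : ℝ) by push_cast; ring, Real.rpow_intCast, mul_zpow,
        show -(d * y) = 4 * Real.pi * n * y by rw [hd, abs_of_neg hnR]; ring,
        show (1 - k) = -k + 1 by ring, zpow_add_one₀ hd0.ne']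
      ring
    have hD (y : ℝ) (hy : 0 < y) :
        HasDerivAt (fun y : ℝ => A y - cm * (incGamma (1 - k) (d * y) : ℂ)) 0 y := by
      refine ((hC y hy).sub ((hG y hy).const_mul cm)).congr_deriv ?_
      have h3 : d ^ (k - 1) * d ^ (1 - k) = 1 := by
        rw [← zpow_add₀ hd0.ne']; simp
      have h3' : ((d ^ (k - 1) : ℝ) : ℂ) * ((d ^ (1 - k) : ℝ) : ℂ) = 1 := by
        rw [← Complex.ofReal_mul, h3, Complex.ofReal_one]
      rw [hcm, Complex.ofReal_neg, Complex.ofReal_mul (d ^ (1 - k))]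
      linear_combination (-C * ((Real.exp (4 * Real.pi * n * y) * y ^ (-k) : ℝ) : ℂ)) * h3'
    obtain ⟨b, hb⟩ := isOpen_Ioi.exists_is_const_of_deriv_eq_zero
      (f := fun y : ℝ => A y - cm * (incGamma (1 - k) (d * y) : ℂ)) isPreconnected_Ioi
      (fun y hy => (hD y hy).differentiableAt.differentiableWithinAt)
      (fun y hy => (hD y hy).deriv)
    -- Both `A - c` and the Gamma term tend to 0, so the integration constant is the coefficient of
    -- the principal part. This yields `c_f⁺(n) = 0` for `n ≪ 0`.
    have hbc : b = c := by
      have hneg : 2 * Real.pi * n - ε < 0 := by nlinarith [Real.pi_pos]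
      have h3 : Tendsto A atTop (𝓝 c) := by
        rw [tendsto_iff_norm_sub_tendsto_zero]
        refine squeeze_zero' (Eventually.of_forall fun _ => norm_nonneg _)
          ((eventually_ge_atTop Y).mono fun y hy => hAbound y hy) ?_
        have := (Real.tendsto_exp_atBot.comp
          (tendsto_id.const_mul_atTop_of_neg hneg)).const_mul K
        rwa [mul_zero] at this
      have h4 : Tendsto (fun y : ℝ => (incGamma (1 - k) (d * y) : ℂ)) atTop (𝓝 0) := by
        have := (Complex.continuous_ofReal.tendsto 0).comp
          ((tendsto_incGamma (1 - k)).comp (tendsto_id.const_mul_atTop hd0))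
        simpa using! this
      have h5 := h3.sub (h4.const_mul cm)
      rw [mul_zero, sub_zero] at h5
      refine tendsto_nhds_unique (tendsto_const_nhds.congr' ?_) h5
      filter_upwards [eventually_gt_atTop 0] with y hy using (hb y hy).symm
    refine ⟨b, cm, fun h => absurd hn h.not_gt, fun _ h => hbc.trans h, fun h => absurd h hzero,
      fun y hy => ?_⟩
    rw [haA, ← hb y hy]
    ring

end ModeODE

/-! ### Fourier expansions of harmonic weak Maass forms -/

section FourierExpansion

open Filter Topology

theorem contDiff_e_mul (c : ℂ) : ContDiff ℝ ∞ fun z : ℂ => e (c * z) := by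
  unfold e
  fun_prop

theorem partialX_e_mul (c z : ℂ) :
    partialX (fun z : ℂ => e (c * z)) z = 2 * Real.pi * Complex.I * c * e (c * z) := by
  have h1 : HasDerivAt (fun z : ℂ => e (c * z)) (2 * Real.pi * Complex.I * c * e (c * z)) z := by
    have := ((((hasDerivAt_id z).const_mul c).const_mul (2 * Real.pi * Complex.I)).cexp)
    refine this.congr_deriv ?_
    simp only [e, id_eq]
    ring
  have h2 := (h1.hasFDerivAt.restrictScalars ℝ).fderiv
  rw [partialX, h2]
  simp

/-- For `m ≠ n`, the mode of `∂/∂x e(m z)` is both `2πi m` and `2πi n` times the mode of `e(m z)`.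
-/
theorem fourierMode_e (n m : ℤ) {y : ℝ} (hy : 0 < y) :
    fourierMode n (fun z => e (m * z)) y
      = if m = n then Complex.exp ((-(2 * Real.pi * n * y) : ℝ)) else 0 := by
  split_ifs with h
  · subst h
    have h1 (x : ℝ) : e (-m * x) * e (m * (x + y * Complex.I))
        = Complex.exp ((-(2 * Real.pi * m * y) : ℝ)) := by
      rw [← e_add, e]
      congr 1
      push_cast
      linear_combination (2 * Real.pi * m * y : ℂ) * Complex.I_sq
    rw [fourierMode, intervalIntegral.integral_congr fun x _ => h1 x]
    simp
  · have hper (z : ℂ) (_ : 0 < z.im) : e ((m : ℂ) * (z + 1)) = e (m * z) := by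
      rw [mul_add, mul_one, e_add, e_intCast, mul_one]
    have h1 := fourierMode_partialX (contDiff_e_mul m).contDiffOn hper n hy
    have h2 : partialX (fun z : ℂ => e (m * z))
        = fun z => 2 * Real.pi * Complex.I * m * e (m * z) := funext (partialX_e_mul m)
    have h3 : fourierMode n (fun z => 2 * Real.pi * Complex.I * m * e (m * z)) y
        = 2 * Real.pi * Complex.I * m * fourierMode n (fun z => e (m * z)) y := by
      rw [fourierMode, fourierMode, ← intervalIntegral.integral_const_mul]
      congr 1
      funext x
      ring
    rw [h2, h3] at h1
    have h4 : (2 * Real.pi * Complex.I : ℂ) * (m - n) * fourierMode n (fun z => e (m * z)) y = 0 := by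
      linear_combination h1
    refine (mul_eq_zero.mp h4).resolve_left (mul_ne_zero Complex.two_pi_I_ne_zero ?_)
    rw [sub_ne_zero]
    exact_mod_cast h

theorem fourierMode_principalPart (c : ℝ →₀ ℂ) (hc : ∀ m ∈ c.support, m ∈ Set.range fun n : ℤ => (n : ℝ))
    (n : ℤ) {y : ℝ} (hy : 0 < y) :
    fourierMode n (fun z => c.sum fun m a => a * e (m * z)) y
      = c n * Complex.exp ((-(2 * Real.pi * n * y) : ℝ)) := by
  have h1 : fourierMode n (fun z => c.sum fun m a => a * e (m * z)) y
      = ∑ m ∈ c.support, c m * fourierMode n (fun z => e (m * z)) y := by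
    simp only [fourierMode, Finsupp.sum, Finset.mul_sum]
    rw [intervalIntegral.integral_finsetSum]
    · refine Finset.sum_congr rfl fun m _ => ?_
      rw [← intervalIntegral.integral_const_mul]
      congr 1
      funext x
      ring
    · intro m _
      refine Continuous.intervalIntegrable ?_ _ _
      unfold e
      fun_prop
  have h2 : ∀ m ∈ c.support, c m * fourierMode n (fun z => e (m * z)) y
      = if m = n then c n * Complex.exp ((-(2 * Real.pi * n * y) : ℝ)) else 0 := by
    intro m hm
    obtain ⟨j, rfl⟩ := hc m hm
    have := fourierMode_e n j hy
    simp only [Complex.ofReal_intCast, Int.cast_inj]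
    rw [this]
    split_ifs with h
    · rw [h]
    · simp
  rw [h1, Finset.sum_congr rfl h2, Finset.sum_ite_eq']
  split_ifs with h
  · rfl
  · rw [Finsupp.notMem_support_iff.mp h, zero_mul]

theorem coe_eq_re_add_im (τ : ℍ) : (τ : ℂ) = (τ.re : ℂ) + τ.im * Complex.I :=
  (Complex.re_add_im (τ : ℂ)).symm

theorem comp_ofComplex_add_one {f : ℍ → ℂ} (hper : ∀ τ : ℍ, f ((1 : ℝ) +ᵥ τ) = f τ) (z : ℂ)
    (hz : 0 < z.im) : (f ∘ ofComplex) (z + 1) = (f ∘ ofComplex) z := by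
  have h1 : ofComplex (z + 1) = (1 : ℝ) +ᵥ ofComplex z := by
    rw [ofComplex_apply_of_im_pos hz, ofComplex_apply_of_im_pos (by simpa using hz)]
    ext1
    rw [coe_vadd]
    simp [add_comm]
  rw [Function.comp_apply, Function.comp_apply, h1, hper]

/-- Applying the Fourier integral to `Δ_k f = 0` and to the growth condition gives, for each mode,
the hypotheses of `exists_mode_coeffs`. -/
theorem exists_isFourierExpansion {k : ℤ} {f : ℍ → ℂ} (hs : IsSmooth f)
    (hper : ∀ τ : ℍ, f ((1 : ℝ) +ᵥ τ) = f τ) (hΔ : ∀ τ, laplace k f τ = 0)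
    (hpp : HasPrincipalPart (Set.range fun n : ℤ => (n : ℝ)) f) :
    ∃ cp cm : ℤ → ℂ, IsFourierExpansion k f cp cm ∧
      ∀ n, (∀ y, 0 < y → fourierMode n (f ∘ ofComplex) y = 0) → cp n = 0 ∧ cm n = 0 := by
  set F : ℂ → ℂ := f ∘ ofComplex with hF
  have hperF : ∀ z : ℂ, 0 < z.im → F (z + 1) = F z := comp_ofComplex_add_one hper
  have hs : ContDiffOn ℝ ∞ F {z : ℂ | 0 < z.im} := hs
  have hX := contDiffOn_partialX hs
  have hY := contDiffOn_partialY hs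
  obtain ⟨c, hc, ε, hε, hO⟩ := hpp
  obtain ⟨K, hK⟩ := hO.bound
  obtain ⟨Y, hYmem⟩ := (atImInfty_mem _).mp hK
  have hode (n : ℤ) (y : ℝ) (hy : 0 < y) :
      -(y : ℂ) ^ 2 * ((2 * Real.pi * Complex.I * n) ^ 2 * fourierMode n F y
        + fourierMode n (partialY (partialY F)) y)
      + Complex.I * k * y * (2 * Real.pi * Complex.I * n * fourierMode n F y
        + Complex.I * fourierMode n (partialY F) y) = 0 := by
    have hXX := fourierMode_partialX hX (partialX_add_one hperF) n hy
    have hX1 := fourierMode_partialX hs hperF n hy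
    have h9 : (2 * Real.pi * Complex.I * n) ^ 2 * fourierMode n F y
        = fourierMode n (partialX (partialX F)) y := by
      rw [hXX, hX1]
      ring
    rw [h9, ← hX1]
    simp only [fourierMode]
    have hint {G : ℂ → ℂ} (hG : ContDiffOn ℝ ∞ G {z : ℂ | 0 < z.im}) (d : ℂ) : IntervalIntegrable
        (fun x : ℝ => d * (e (-n * x) * G (x + y * Complex.I))) MeasureTheory.volume 0 1 :=
      (continuous_const.mul ((continuous_e_mul _).mul (continuous_horizontal hG hy))).intervalIntegrable
        _ _
    have h0 : ∫ x in (0 : ℝ)..1, ((-(y : ℂ) ^ 2 * (e (-n * x) * partialX (partialX F) (x + y * Complex.I))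
        + -(y : ℂ) ^ 2 * (e (-n * x) * partialY (partialY F) (x + y * Complex.I)))
        + (Complex.I * k * y * (e (-n * x) * partialX F (x + y * Complex.I))
        + Complex.I * k * y * Complex.I * (e (-n * x) * partialY F (x + y * Complex.I)))) = 0 := by
      refine (intervalIntegral.integral_congr (g := fun _ => 0) fun x _ => ?_).trans (by simp)
      have hz : 0 < ((x : ℂ) + y * Complex.I).im := by rwa [im_add_mul_I]
      have h1 := hΔ ⟨x + y * Complex.I, hz⟩
      rw [laplace] at h1
      have h2 : (UpperHalfPlane.im ⟨x + y * Complex.I, hz⟩ : ℝ) = y := im_add_mul_I x y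
      rw [h2] at h1
      change -(y : ℂ) ^ 2 * (partialX (partialX F) (x + y * Complex.I)
        + partialY (partialY F) (x + y * Complex.I)) + Complex.I * k * y *
        (partialX F (x + y * Complex.I) + Complex.I * partialY F (x + y * Complex.I)) = 0 at h1
      linear_combination (e (-n * x)) * h1
    rw [intervalIntegral.integral_add ((hint (contDiffOn_partialX hX) _).add
      (hint (contDiffOn_partialY hY) _)) ((hint hX _).add (hint hY _)),
      intervalIntegral.integral_add (hint (contDiffOn_partialX hX) _) (hint (contDiffOn_partialY hY) _),
      intervalIntegral.integral_add (hint hX _) (hint hY _)] at h0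
    simp only [intervalIntegral.integral_const_mul] at h0
    linear_combination h0
  have hbound (n : ℤ) (y : ℝ) (hy : max Y 1 ≤ y) :
      ‖fourierMode n F y - c n * Complex.exp ((-(2 * Real.pi * n * y) : ℝ))‖
        ≤ K * Real.exp (-ε * y) := by
    have hy0 : 0 < y := lt_of_lt_of_le one_pos ((le_max_right _ _).trans hy)
    rw [← fourierMode_principalPart c (fun m hm => (hc m hm).1) n hy0]
    have h1 : fourierMode n F y - fourierMode n (fun z => c.sum fun m a => a * e (m * z)) y
        = fourierMode n (fun z => F z - c.sum fun m a => a * e (m * z)) y := by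
      simp only [fourierMode, mul_sub]
      rw [intervalIntegral.integral_sub]
      · exact ((continuous_e_mul _).mul (continuous_horizontal hs hy0)).intervalIntegrable _ _
      · refine Continuous.intervalIntegrable ?_ _ _
        unfold e
        simp only [Finsupp.sum]
        fun_prop
    rw [h1]
    refine norm_fourierMode_le (fun x _ => ?_) n
    have hz : 0 < ((x : ℂ) + y * Complex.I).im := by rwa [im_add_mul_I]
    have h2 := hYmem ⟨x + y * Complex.I, hz⟩ (by
      change Y ≤ ((x : ℂ) + y * Complex.I).im
      rw [im_add_mul_I]; exact (le_max_left _ _).trans hy)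
    have h3 : (UpperHalfPlane.im ⟨x + y * Complex.I, hz⟩ : ℝ) = y := im_add_mul_I x y
    simp only [Set.mem_ofPred_eq, h3, Real.norm_eq_abs, Real.abs_exp] at h2
    rw [hF, Function.comp_apply, ofComplex_apply_of_im_pos hz]
    exact h2
  have hmain (n : ℤ) := exists_mode_coeffs n k hε
    (fun y hy => hasDerivAt_fourierMode hs n hy) (fun y hy => hasDerivAt_fourierMode hY n hy)
    (hode n) (hbound n)
  choose cp cm h1 h2 h3 h4 using hmain
  have hexp (n : ℤ) (τ : ℍ) : e (n * τ)
      = Complex.exp ((-(2 * Real.pi * n * τ.im) : ℝ)) * e (n * τ.re) := by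
    rw [e, e, ← Complex.exp_add, coe_eq_re_add_im τ]
    congr 1
    push_cast
    linear_combination (2 * Real.pi * n * τ.im : ℂ) * Complex.I_sq
  have hsum (τ : ℍ) : HasSum (fun n : ℤ =>
      (cp n + cm n * (incGamma (1 - k) (4 * Real.pi * |(n : ℝ)| * τ.im) : ℂ)) * e (n * τ)) (f τ) := by
    have h5 := hasSum_fourierMode hs hperF τ.re τ.im_pos
    have h6 : F ((τ.re : ℂ) + τ.im * Complex.I) = f τ := by
      rw [← coe_eq_re_add_im, hF, Function.comp_apply, ofComplex_apply]
    rw [h6] at h5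
    convert! h5 using 1
    funext n
    rw [h4 n _ τ.im_pos, hexp]
    ring
  have hn₀ : ∃ n₀ : ℤ, n₀ ≤ 0 ∧ ∀ n < n₀, c n = 0 := by
    obtain ⟨B, hB⟩ := c.support.finite_toSet.bddBelow
    refine ⟨min 0 ⌊B⌋, min_le_left _ _, fun n hn => ?_⟩
    by_contra h
    have h5 : B ≤ n := hB (Finsupp.mem_support_iff.mpr h)
    have h6 := Int.floor_le B
    have h7 : n < ⌊B⌋ := lt_of_lt_of_le hn (min_le_right _ _)
    have h8 : (n : ℝ) < (⌊B⌋ : ℝ) := by exact_mod_cast h7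
    linarith
  obtain ⟨n₀, hn₀, hcn₀⟩ := hn₀
  have hcp (n : ℤ) (hn : n < n₀) : cp n = 0 := h2 n (lt_of_lt_of_le hn hn₀) (hcn₀ n hn)
  -- For `n ≥ 0` the terms are those of the full series, for `n < n₀` they vanish, and only finitely
  -- many `n` remain; hence `f⁺` and `f⁻` converge separately.
  have hsp (τ : ℍ) : Summable fun n : ℤ => cp n * e (n * τ) := by
    refine ((hsum τ).summable.indicator (Set.Ici 0)).congr_cofinite ?_
    rw [EventuallyEq, eventually_cofinite]
    refine (Set.finite_Ico n₀ 0).subset fun n hn => ?_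
    by_contra hn'
    rw [Set.mem_Ico, not_and_or, not_le, not_lt] at hn'
    refine hn ?_
    rcases hn' with h | h
    · rw [hcp n h, Set.indicator_of_notMem (by simpa using h.trans_le hn₀), zero_mul]
    · rw [Set.indicator_of_mem (by simpa using h), h1 n h]
      simp
  refine ⟨cp, cm, ⟨⟨n₀, hcp⟩, h1, fun τ => ∑' n : ℤ, cp n * e (n * τ),
    fun τ => f τ - ∑' n : ℤ, cp n * e (n * τ), fun τ => (hsp τ).hasSum, fun τ => ?_,
    fun τ => by ring⟩, h3⟩
  convert! (hsum τ).sub (hsp τ).hasSum using 1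
  funext n
  ring

end FourierExpansion

/-! ### Affine substitutions -/

section Affine

open Filter Topology

/-- `τ ↦ a τ + b` on the upper half plane, for `a > 0`. -/
def aff (a : ℝ) (ha : 0 < a) (b : ℝ) (τ : ℍ) : ℍ :=
  ⟨a * τ + b, by simpa using mul_pos ha τ.im_pos⟩

variable {a : ℝ} {ha : 0 < a} {b : ℝ}

theorem coe_aff (τ : ℍ) : (aff a ha b τ : ℂ) = a * τ + b := rfl

theorem aff_im (τ : ℍ) : (aff a ha b τ).im = a * τ.im := by
  change ((a : ℂ) * τ + b).im = _
  simp

theorem comp_aff_comp_ofComplex (f : ℍ → ℂ) :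
    Set.EqOn ((f ∘ aff a ha b) ∘ ofComplex) (fun z => (f ∘ ofComplex) (a * z + b))
      {z : ℂ | 0 < z.im} := by
  intro z (hz : 0 < z.im)
  have hz' : 0 < ((a : ℂ) * z + b).im := by simpa using mul_pos ha hz
  simp only [Function.comp_apply, ofComplex_apply_of_im_pos hz, ofComplex_apply_of_im_pos hz']
  rfl

include ha in
theorem im_affine_pos {z : ℂ} (hz : 0 < z.im) : 0 < ((a : ℂ) * z + b).im := by
  simpa using mul_pos ha hz

theorem IsSmooth.comp_aff {f : ℍ → ℂ} (hf : IsSmooth f) : IsSmooth (f ∘ aff a ha b) := by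
  refine ContDiffOn.congr ?_ (comp_aff_comp_ofComplex f)
  have hf' : ContDiffOn ℝ ∞ (f ∘ ofComplex) {z : ℂ | 0 < z.im} := hf
  refine ContDiffOn.comp (g := f ∘ ofComplex) hf' (ContDiff.contDiffOn (by fun_prop)) fun z hz => ?_
  exact im_affine_pos (ha := ha) hz

include ha in
theorem fderiv_comp_affine {F G : ℂ → ℂ} (hF : ContDiffOn ℝ ∞ F {z : ℂ | 0 < z.im}) {c : ℂ}
    (h : Set.EqOn G (fun z => c * F (a * z + b)) {z : ℂ | 0 < z.im}) (v : ℂ) :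
    Set.EqOn (fun z => fderiv ℝ G z v) (fun z => c * a * fderiv ℝ F (a * z + b) v)
      {z : ℂ | 0 < z.im} := by
  intro z hz
  have h1 : HasFDerivAt F (fderiv ℝ F (a * z + b)) (a * z + b) :=
    ((hF.contDiffAt (isOpen_im_pos.mem_nhds (im_affine_pos (ha := ha) hz))).differentiableAt
      (by simp)).hasFDerivAt
  have h2 : HasFDerivAt (fun z : ℂ => (a : ℂ) * z + b) (a • ContinuousLinearMap.id ℝ ℂ) z := by
    have := ((hasFDerivAt_id (𝕜 := ℝ) z).const_smul a).add_const (b : ℂ)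
    simpa using! this
  have h3 := (h1.comp z h2).const_mul c
  have h4 : HasFDerivAt G _ z :=
    h3.congr_of_eventuallyEq (h.eventuallyEq_of_mem (isOpen_im_pos.mem_nhds hz))
  simp only [h4.fderiv]
  simp [mul_assoc]

/-- Every derivative in `Δ_k` is matched by one power of `y`, so the scalings `a` cancel. -/
theorem laplace_comp_aff (k : ℤ) {f : ℍ → ℂ} (hf : IsSmooth f) (τ : ℍ) :
    laplace k (f ∘ aff a ha b) τ = laplace k f (aff a ha b τ) := by
  have h0 : Set.EqOn ((f ∘ aff a ha b) ∘ ofComplex) (fun z => 1 * (f ∘ ofComplex) (a * z + b))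
      {z : ℂ | 0 < z.im} := by
    simpa using comp_aff_comp_ofComplex f
  have hX := fderiv_comp_affine (ha := ha) hf h0 1
  have hY := fderiv_comp_affine (ha := ha) hf h0 Complex.I
  have hXX := fderiv_comp_affine (ha := ha) (contDiffOn_fderiv_apply hf 1) hX 1
  have hYY := fderiv_comp_affine (ha := ha) (contDiffOn_fderiv_apply hf Complex.I) hY Complex.I
  have hτ : (τ : ℂ) ∈ {z : ℂ | 0 < z.im} := τ.im_pos
  have e1 := hX hτ
  have e2 := hY hτ
  have e3 := hXX hτ
  have e4 := hYY hτ
  simp only [laplace, coe_aff, aff_im]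
  unfold partialX partialY
  simp only at e1 e2 e3 e4
  rw [e1, e2, e3, e4]
  push_cast
  ring

theorem isSmooth_sum {ι : Type*} (s : Finset ι) {f : ι → ℍ → ℂ} (h : ∀ i ∈ s, IsSmooth (f i)) :
    IsSmooth (∑ i ∈ s, f i) := by
  classical
  induction s using Finset.induction_on with
  | empty => exact isSmooth_zero
  | insert i s hi ih =>
    rw [Finset.sum_insert hi]
    exact (h i (s.mem_insert_self i)).add (ih fun j hj => h j (Finset.mem_insert_of_mem hj))

theorem laplace_sum (k : ℤ) {ι : Type*} (s : Finset ι) {f : ι → ℍ → ℂ}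
    (h : ∀ i ∈ s, IsSmooth (f i)) (τ : ℍ) :
    laplace k (∑ i ∈ s, f i) τ = ∑ i ∈ s, laplace k (f i) τ := by
  classical
  induction s using Finset.induction_on with
  | empty => exact laplace_zero k τ
  | insert i s hi ih =>
    have h' : ∀ j ∈ s, IsSmooth (f j) := fun j hj => h j (Finset.mem_insert_of_mem hj)
    rw [Finset.sum_insert hi, Finset.sum_insert hi,
      laplace_add k (h i (s.mem_insert_self i)) (isSmooth_sum s h'), ih h']

/-! ### Principal parts -/

theorem hasPrincipalPart_sum {ι : Type*} (s : Finset ι) {E : Set ℝ} {f : ι → ℍ → ℂ}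
    (h : ∀ i ∈ s, HasPrincipalPart E (f i)) : HasPrincipalPart E (∑ i ∈ s, f i) := by
  classical
  induction s using Finset.induction_on with
  | empty => exact hasPrincipalPart_zero E
  | insert i s hi ih =>
    rw [Finset.sum_insert hi]
    exact (h i (s.mem_insert_self i)).add (ih fun j hj => h j (Finset.mem_insert_of_mem hj))

theorem hasPrincipalPart_e {E : Set ℝ} {n : ℝ} (hn : n ∈ E) (hn0 : n ≤ 0) :
    HasPrincipalPart E fun τ => e (n * τ) := by
  refine ⟨Finsupp.single n 1, fun m hm => ?_, 1, one_pos, ?_⟩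
  · rw [Finset.mem_singleton.mp (Finsupp.support_single_subset hm)]
    exact ⟨hn, hn0⟩
  · simpa using! Asymptotics.isBigO_zero _ _

theorem hasPrincipalPart_of_isBigO {E : Set ℝ} {f : ℍ → ℂ} {ε : ℝ} (hε : 0 < ε)
    (h : f =O[atImInfty] fun τ : ℍ => Real.exp (-ε * τ.im)) : HasPrincipalPart E f :=
  ⟨0, by simp, ε, hε, by simpa using h⟩

theorem HasPrincipalPart.mono {E E' : Set ℝ} (hE : E ⊆ E') {f : ℍ → ℂ}
    (h : HasPrincipalPart E f) : HasPrincipalPart E' f := by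
  obtain ⟨c, hc, h⟩ := h
  exact ⟨c, fun n hn => ⟨hE (hc n hn).1, (hc n hn).2⟩, h⟩

theorem HasPrincipalPart.exists_eq {E : Set ℝ} {f : ℍ → ℂ} (h : HasPrincipalPart E f) :
    ∃ (s : Finset ℝ) (c : ℝ → ℂ) (r : ℍ → ℂ) (ε : ℝ), (∀ n ∈ s, n ∈ E ∧ n ≤ 0) ∧ 0 < ε ∧
      r =O[atImInfty] (fun τ : ℍ => Real.exp (-ε * τ.im)) ∧
      ∀ τ, f τ = ∑ n ∈ s, c n * e (n * τ) + r τ := by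
  obtain ⟨c, hc, ε, hε, h⟩ := h
  exact ⟨c.support, c, _, ε, hc, hε, h, fun τ => by simp [Finsupp.sum]⟩

theorem tendsto_aff : Tendsto (aff a ha b) atImInfty atImInfty := by
  rw [atImInfty, tendsto_comap_iff]
  have : UpperHalfPlane.im ∘ aff a ha b = fun τ => a * τ.im := funext fun τ => aff_im τ
  rw [this]
  exact tendsto_comap.const_mul_atTop ha

theorem isBigO_comp_aff {r : ℍ → ℂ} {ε : ℝ}
    (h : r =O[atImInfty] fun τ : ℍ => Real.exp (-ε * τ.im)) :
    (r ∘ aff a ha b) =O[atImInfty] fun τ : ℍ => Real.exp (-(ε * a) * τ.im) := by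
  refine (h.comp_tendsto (tendsto_aff (ha := ha) (b := b))).congr_right fun τ => ?_
  rw [Function.comp_apply, aff_im]
  congr 1
  ring

theorem HasPrincipalPart.comp_aff {E E' : Set ℝ} (hE : ∀ n ∈ E, a * n ∈ E') {f : ℍ → ℂ}
    (h : HasPrincipalPart E f) : HasPrincipalPart E' (f ∘ aff a ha b) := by
  obtain ⟨s, c, r, ε, hs, hε, hr, hf⟩ := h.exists_eq
  have h1 : f ∘ aff a ha b
      = ∑ n ∈ s, (c n * e (n * b)) • (fun τ : ℍ => e ((a * n : ℝ) * τ)) + r ∘ aff a ha b := by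
    funext τ
    simp only [Function.comp_apply, hf, Pi.add_apply, Finset.sum_apply, Pi.smul_apply, smul_eq_mul]
    congr 1
    refine Finset.sum_congr rfl fun n _ => ?_
    rw [mul_assoc, ← e_add, coe_aff]
    congr 2
    push_cast
    ring
  rw [h1]
  refine (hasPrincipalPart_sum s fun n hn => (hasPrincipalPart_e (hE n (hs n hn).1) ?_).smul _).add
    (hasPrincipalPart_of_isBigO (mul_pos hε ha) (isBigO_comp_aff hr))
  exact mul_nonpos_of_nonneg_of_nonpos ha.le (hs n hn).2

end Affine

/-! ### The functions `f((τ + j) / p)` -/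

section Translates

variable {p : ℕ} [Fact p.Prime]

local notation "ψ" => ZMod.stdAddChar

variable (p) in
theorem inv_natCast_prime_pos : 0 < (p : ℝ)⁻¹ := by
  exact_mod_cast inv_pos.mpr (Nat.cast_pos.mpr (Fact.out : p.Prime).pos)

variable (p) in
theorem natCast_prime_pos : 0 < (p : ℝ) := Nat.cast_pos.mpr (Fact.out : p.Prime).pos

/-- `τ ↦ f((τ + j) / p)`, for the representative `0 ≤ j < p` of a residue class mod `p`. -/
def translate (f : ℍ → ℂ) (j : ZMod p) : ℍ → ℂ :=
  f ∘ aff (p : ℝ)⁻¹ (inv_natCast_prime_pos p) (j.val / p)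

/-- `τ ↦ ∑ ψ(-j r) f((τ + j) / p)`, the sum of the Fourier terms of `p f(τ / p)` with exponents
`n / p`, `n ≡ r mod p`. -/
def translateSum (f : ℍ → ℂ) (r : ZMod p) : ℍ → ℂ :=
  ∑ j : ZMod p, ψ (-(j * r)) • translate f j

theorem translateSum_apply (f : ℍ → ℂ) (r : ZMod p) (τ : ℍ) :
    translateSum f r τ = ∑ j : ZMod p, ψ (-(j * r)) * translate f j τ := by
  simp [translateSum, Finset.sum_apply]

theorem e_translate (n : ℤ) (j : ZMod p) (τ : ℍ) :
    e (n * (aff (p : ℝ)⁻¹ (inv_natCast_prime_pos p) (j.val / p) τ : ℂ))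
      = ψ (j * (n : ZMod p)) * e ((n : ℂ) / p * τ) := by
  have h : j * (n : ZMod p) = (((j.val : ℤ) * n : ℤ) : ZMod p) := by
    push_cast
    rw [ZMod.natCast_zmod_val]
  rw [h, stdAddChar_intCast, ← e_add, coe_aff]
  congr 1
  push_cast
  ring

theorem sum_e_translate (n : ℤ) (r : ZMod p) (τ : ℍ) :
    ∑ j : ZMod p, ψ (-(j * r)) * e (n * (aff (p : ℝ)⁻¹ (inv_natCast_prime_pos p) (j.val / p) τ : ℂ))
      = if (n : ZMod p) = r then p * e ((n : ℂ) / p * τ) else 0 := by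
  have h (j : ZMod p) : ψ (-(j * r)) * e (n * (aff (p : ℝ)⁻¹ (inv_natCast_prime_pos p) (j.val / p) τ : ℂ))
      = ψ (((n : ZMod p) - r) * j) * e ((n : ℂ) / p * τ) := by
    rw [e_translate, ← mul_assoc, ← AddChar.map_add_eq_mul]
    congr 2
    ring
  rw [Finset.sum_congr rfl fun j _ => h j, ← Finset.sum_mul, sum_stdAddChar_mul]
  simp only [sub_eq_zero]
  split_ifs <;> simp

theorem IsSmooth.translateSum {f : ℍ → ℂ} (hf : IsSmooth f) (r : ZMod p) :
    IsSmooth (translateSum f r) :=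
  isSmooth_sum _ fun _ _ => hf.comp_aff.smul _

theorem laplace_translateSum {k : ℤ} {f : ℍ → ℂ} (hf : IsSmooth f) (h : ∀ τ, laplace k f τ = 0)
    (r : ZMod p) (τ : ℍ) : laplace k (translateSum f r) τ = 0 := by
  rw [MaassLift.translateSum, laplace_sum k (f := fun j : ZMod p => ψ (-(j * r)) • translate f j) _
    fun _ _ => hf.comp_aff.smul _]
  refine Finset.sum_eq_zero fun j _ => ?_
  rw [laplace_smul, translate, laplace_comp_aff k hf, h, mul_zero]

/-- The exponents `n / p` with `n ≡ r mod p`. -/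
def exponents (r : ZMod p) : Set ℝ := {x : ℝ | ∃ n : ℤ, (n : ZMod p) = r ∧ x = n / p}

theorem HasPrincipalPart.translateSum {f : ℍ → ℂ}
    (h : HasPrincipalPart (Set.range fun n : ℤ => (n : ℝ)) f) (r : ZMod p) :
    HasPrincipalPart (exponents r) (translateSum f r) := by
  obtain ⟨s, c, R, ε, hs, hε, hr, hf⟩ := h.exists_eq
  have hp0 := natCast_prime_pos p
  have h1 : MaassLift.translateSum f r
      = ∑ n ∈ s, c n • (fun τ : ℍ => ∑ j : ZMod p, ψ (-(j * r)) *
          e (n * (aff (p : ℝ)⁻¹ (inv_natCast_prime_pos p) (j.val / p) τ : ℂ)))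
        + ∑ j : ZMod p, ψ (-(j * r)) • MaassLift.translate R j := by
    funext τ
    simp only [translateSum_apply, MaassLift.translate, Function.comp_apply, hf, Pi.add_apply,
      Finset.sum_apply, Pi.smul_apply, smul_eq_mul, mul_add, Finset.sum_add_distrib, Finset.mul_sum]
    congr 1
    rw [Finset.sum_comm]
    refine Finset.sum_congr rfl fun n _ => Finset.sum_congr rfl fun j _ => ?_
    ring
  rw [h1]
  refine (hasPrincipalPart_sum s fun n hn => HasPrincipalPart.smul _ ?_).add
    (hasPrincipalPart_sum _ fun j _ => HasPrincipalPart.smul _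
      (hasPrincipalPart_of_isBigO (mul_pos hε (inv_natCast_prime_pos p)) (isBigO_comp_aff hr)))
  obtain ⟨⟨m, rfl⟩, hm⟩ := hs n hn
  simp only [Complex.ofReal_intCast, sum_e_translate]
  split_ifs with hmr
  · have h2 := (hasPrincipalPart_e (E := exponents r)
      (n := (m : ℝ) / p) ⟨m, hmr, rfl⟩ (div_nonpos_of_nonpos_of_nonneg hm hp0.le)).smul (p : ℂ)
    convert h2 using 1
    funext τ
    simp
  · exact hasPrincipalPart_zero _

theorem IsFourierExpansion.hasSum {k : ℤ} {f : ℍ → ℂ} {cp cm : ℤ → ℂ}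
    (h : IsFourierExpansion k f cp cm) (τ : ℍ) :
    HasSum (fun n : ℤ => coeff k cp cm n τ.im * e (n * τ)) (f τ) := by
  obtain ⟨-, -, fp, fm, h1, h2, h3⟩ := h
  rw [h3]
  convert! (h1 τ).add (h2 τ) using 1
  funext n
  rw [coeff]
  ring

/-- All the points `(τ + j) / p` have the same imaginary part `y / p`, so the coefficient leaves the
sum over `j`, and orthogonality selects `n ≡ r`. -/
theorem IsFourierExpansion.hasSum_translateSum {k : ℤ} {f : ℍ → ℂ} {cp cm : ℤ → ℂ}
    (h : IsFourierExpansion k f cp cm) (r : ZMod p) (τ : ℍ) :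
    HasSum (fun n : ℤ => if (n : ZMod p) = r then
      p * (coeff k cp cm n (τ.im / p) * e ((n : ℂ) / p * τ)) else 0) (translateSum f r τ) := by
  rw [translateSum_apply]
  have h1 := hasSum_sum (s := Finset.univ) fun (j : ZMod p) _ =>
    (h.hasSum (aff (p : ℝ)⁻¹ (inv_natCast_prime_pos p) (j.val / p) τ)).mul_left (ψ (-(j * r)))
  convert! h1 using 1
  funext n
  have h2 (j : ZMod p) : ψ (-(j * r)) * (coeff k cp cm n
        (aff (p : ℝ)⁻¹ (inv_natCast_prime_pos p) (j.val / p) τ).im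
        * e (n * (aff (p : ℝ)⁻¹ (inv_natCast_prime_pos p) (j.val / p) τ : ℂ)))
      = coeff k cp cm n (τ.im / p) * (ψ (-(j * r)) *
        e (n * (aff (p : ℝ)⁻¹ (inv_natCast_prime_pos p) (j.val / p) τ : ℂ))) := by
    rw [aff_im, inv_mul_eq_div, mul_left_comm]
  rw [Finset.sum_congr rfl fun j _ => h2 j, ← Finset.mul_sum, sum_e_translate]
  split_ifs
  · ring
  · ring

theorem translateSum_eq_zero {k : ℤ} {f : ℍ → ℂ} {cp cm : ℤ → ℂ}
    (h : IsFourierExpansion k f cp cm) {r : ZMod p}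
    (hr : ∀ n : ℤ, (n : ZMod p) = r → cp n = 0 ∧ cm n = 0) (τ : ℍ) : translateSum f r τ = 0 := by
  refine (h.hasSum_translateSum r τ).unique ?_
  convert! hasSum_zero using 1
  funext n
  split_ifs with hn
  · rw [coeff, (hr n hn).1, (hr n hn).2]
    simp
  · rfl

end Translates

/-! ### The components of the lift -/

section Lift

variable {p : ℕ} [Fact p.Prime]

local notation "ψ" => ZMod.stdAddChar
local notation "χ" => legendreChar p

/-- Covariance of weight `k` and Nebentypus `(· / p)` under `Γ₀(p)`. -/
def IsCovariant (p : ℕ) [Fact p.Prime] (k : ℤ) (f : ℍ → ℂ) : Prop :=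
  ∀ M ∈ CongruenceSubgroup.Gamma0 p, ∀ τ : ℍ,
    f (M • τ) = legendreChar p ((M 1 1 : ℤ) : ZMod p) * cocyc M τ ^ k * f τ

theorem IsCovariant.int_vadd {k : ℤ} {f : ℍ → ℂ} (hf : IsCovariant p k f) (n : ℤ) (τ : ℍ) :
    f ((n : ℝ) +ᵥ τ) = f τ := by
  have h1 : ModularGroup.T ^ n ∈ CongruenceSubgroup.Gamma0 p := by
    rw [CongruenceSubgroup.Gamma0_mem, ModularGroup.coe_T_zpow]
    simp
  have h2 := hf _ h1 τ
  rw [modular_T_zpow_smul] at h2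
  rw [h2, cocyc, ModularGroup.coe_T_zpow]
  simp

theorem translate_intCast {k : ℤ} {f : ℍ → ℂ} (hf : IsCovariant p k f) (j : ℤ) (τ : ℍ) :
    translate f (j : ZMod p) τ = f (aff (p : ℝ)⁻¹ (inv_natCast_prime_pos p) (j / p) τ) := by
  have hp0 : (p : ℂ) ≠ 0 := by exact_mod_cast (Fact.out : p.Prime).ne_zero
  have h1 : (((j : ZMod p).val : ℤ) : ZMod p) = (j : ZMod p) := by
    rw [Int.cast_natCast, ZMod.natCast_zmod_val]
  obtain ⟨m, hm⟩ := (ZMod.intCast_eq_intCast_iff_dvd_sub _ _ p).mp h1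
  rw [translate, Function.comp_apply, ← hf.int_vadd m]
  congr 1
  ext1
  rw [coe_vadd, coe_aff, coe_aff]
  have hm' : (j : ℂ) - (((j : ZMod p).val : ℕ) : ℂ) = p * m := by exact_mod_cast hm
  push_cast
  field_simp
  linear_combination -hm'

theorem translate_T {k : ℤ} {f : ℍ → ℂ} (hf : IsCovariant p k f) (j : ZMod p) (τ : ℍ) :
    translate f j (ModularGroup.T • τ) = translate f (j + 1) τ := by
  have h1 : j + 1 = (((j.val + 1 : ℕ) : ℤ) : ZMod p) := by
    push_cast
    rw [ZMod.natCast_zmod_val]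
  rw [h1, translate_intCast hf, translate, Function.comp_apply, modular_T_smul]
  congr 1
  ext1
  rw [coe_aff, coe_aff, coe_vadd]
  push_cast
  ring

theorem coe_S_smul (τ : ℍ) : ((ModularGroup.S • τ : ℍ) : ℂ) = -(τ : ℂ)⁻¹ := by
  rw [modular_S_smul]
  change (-(τ : ℂ))⁻¹ = _
  rw [inv_neg]

theorem S_smul_S_smul (τ : ℍ) : ModularGroup.S • ModularGroup.S • τ = τ := by
  ext1
  rw [coe_S_smul, coe_S_smul, inv_neg, neg_neg, inv_inv]

theorem coe_SL_smul (M : SL(2, ℤ)) (τ : ℍ) :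
    ((M • τ : ℍ) : ℂ) = ((M 0 0 : ℂ) * τ + M 0 1) / cocyc M τ := by
  rw [cocyc, specialLinearGroup_apply]
  simp

/-- With `j'` representing `-1/j` and `j j' + 1 = p b`, the matrix `(j, -b; p, -j') ∈ Γ₀(p)` sends
`(τ + j') / p` to `(-1/τ + j) / p`, with automorphy factor exactly `τ`. -/
theorem translate_S {k : ℤ} {f : ℍ → ℂ} (hf : IsCovariant p k f) {j : ZMod p} (hj : j ≠ 0)
    (τ : ℍ) : translate f j (ModularGroup.S • τ) = χ j * (τ : ℂ) ^ k * translate f (-j⁻¹) τ := by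
  have hp0 : (p : ℂ) ≠ 0 := by exact_mod_cast (Fact.out : p.Prime).ne_zero
  have h1 : (((j.val : ℤ) * ((-j⁻¹).val : ℤ) + 1 : ℤ) : ZMod p) = 0 := by
    push_cast
    rw [ZMod.natCast_zmod_val, ZMod.natCast_zmod_val, mul_neg, mul_inv_cancel₀ hj, neg_add_cancel]
  obtain ⟨b, hb⟩ := (ZMod.intCast_zmod_eq_zero_iff_dvd _ p).mp h1
  let M : SL(2, ℤ) := ⟨!![(j.val : ℤ), -b; (p : ℤ), -((-j⁻¹).val : ℤ)], by
    rw [Matrix.det_fin_two_of]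
    linear_combination -hb⟩
  have hM : M ∈ CongruenceSubgroup.Gamma0 p := by
    rw [CongruenceSubgroup.Gamma0_mem]
    simp [M]
  have hc : cocyc M (aff (p : ℝ)⁻¹ (inv_natCast_prime_pos p) ((-j⁻¹).val / p) τ) = τ := by
    rw [cocyc, coe_aff]
    simp only [M, Matrix.of_apply, Matrix.cons_val', Matrix.cons_val_zero, Matrix.cons_val_one,
    Matrix.cons_val_fin_one]
    push_cast
    field_simp
    ring
  have h2 := hf M hM (aff (p : ℝ)⁻¹ (inv_natCast_prime_pos p) ((-j⁻¹).val / p) τ)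
  rw [hc] at h2
  have h3 : (((M 1 1 : ℤ)) : ZMod p) = j⁻¹ := by
    change ((-((-j⁻¹).val : ℤ) : ℤ) : ZMod p) = _
    push_cast
    rw [ZMod.natCast_zmod_val, neg_neg]
  rw [h3, legendreChar_inv] at h2
  rw [translate, translate, Function.comp_apply, Function.comp_apply, ← h2]
  congr 1
  ext1
  rw [coe_SL_smul, hc, coe_aff, coe_aff, coe_S_smul]
  have hτ := τ.ne_zero
  have hb' : ((j.val : ℂ)) * (((-j⁻¹).val : ℕ) : ℂ) + 1 = p * b := by exact_mod_cast hb
  simp only [M, Matrix.of_apply, Matrix.cons_val', Matrix.cons_val_zero, Matrix.cons_val_one,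
    Matrix.cons_val_fin_one]
  generalize (-j⁻¹).val = j' at hb' ⊢
  push_cast
  field_simp
  linear_combination -hb'

/-- The condition that makes `f` an element of the `χ(l)`-subspace. -/
def IsPlus (l : ZMod p) (f : ℍ → ℂ) : Prop :=
  ∀ r : ZMod p, χ r = -χ l → ∀ τ, translateSum f r τ = 0

theorem translateSum_T {k : ℤ} {f : ℍ → ℂ} (hf : IsCovariant p k f) (r : ZMod p) (τ : ℍ) :
    translateSum f r (ModularGroup.T • τ) = ψ r * translateSum f r τ := by
  rw [translateSum_apply, translateSum_apply, Finset.mul_sum,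
    ← Equiv.sum_comp (Equiv.addRight (1 : ZMod p)) fun j => ψ r * (ψ (-(j * r)) * translate f j τ)]
  refine Finset.sum_congr rfl fun j _ => ?_
  rw [translate_T hf, ← mul_assoc, ← AddChar.map_add_eq_mul, Equiv.coe_addRight]
  congr 2
  ring

theorem sum_translateSum (f : ℍ → ℂ) (τ : ℍ) :
    ∑ r : ZMod p, translateSum f r τ = p * translate f (0 : ZMod p) τ := by
  simp only [translateSum_apply]
  rw [Finset.sum_comm]
  have h (j : ZMod p) : ∑ r : ZMod p, ψ (-(j * r)) * translate f j τ
      = if j = 0 then p * translate f (0 : ZMod p) τ else 0 := by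
    rw [← Finset.sum_mul]
    simp only [← neg_mul]
    rw [sum_stdAddChar_mul]
    simp only [neg_eq_zero]
    split_ifs with hj
    · rw [hj]
    · rw [zero_mul]
  rw [Finset.sum_congr rfl fun j _ => h j]
  simp

/-- After interchanging the sums, `j ≠ 0` gives a quadratic Gauss sum, while `j = 0` gives a linear
character sum that is nonzero only for `x = 0`. -/
theorem sum_translateSum_sq_mul (hp : p ≠ 2) {l : ZMod p} (hl : l ≠ 0) (f : ℍ → ℂ) (x : ZMod p)
    (τ : ℍ) : ∑ y : ZMod p, ψ (-(2 * l * x * y)) * translateSum f (l * y ^ 2) τ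
      = (if x = 0 then p * translate f (0 : ZMod p) τ else 0)
        + χ (-1) * quadGauss l * ∑ j : ZMod p, χ j * ψ (l * x ^ 2 * j⁻¹) * translate f j τ := by
  have h2 := two_ne_zero_zmod hp
  simp only [translateSum_apply, Finset.mul_sum]
  rw [Finset.sum_comm]
  have h (j : ZMod p) : ∑ y : ZMod p, ψ (-(2 * l * x * y)) * (ψ (-(j * (l * y ^ 2))) * translate f j τ)
      = (if j = 0 then (if x = 0 then p * translate f (0 : ZMod p) τ else 0) else 0)
        + χ (-1) * quadGauss l * (χ j * ψ (l * x ^ 2 * j⁻¹) * translate f j τ) := by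
    have h3 (y : ZMod p) : ψ (-(2 * l * x * y)) * (ψ (-(j * (l * y ^ 2))) * translate f j τ)
        = ψ (-j * l * y ^ 2 - 2 * l * x * y) * translate f j τ := by
      rw [← mul_assoc, ← AddChar.map_add_eq_mul]
      congr 2
      ring
    rw [Finset.sum_congr rfl fun y _ => h3 y, ← Finset.sum_mul]
    split_ifs with hj hx
    · subst hj hx
      simp [legendreChar_zero]
    · subst hj
      have h4 (y : ZMod p) : ψ (-0 * l * y ^ 2 - 2 * l * x * y) = ψ (-(2 * l * x) * y) := by
        congr 1
        ring
      rw [Finset.sum_congr rfl fun y _ => h4 y, sum_stdAddChar_mul, if_neg]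
      · simp [legendreChar_zero]
      · exact neg_ne_zero.mpr (mul_ne_zero (mul_ne_zero h2 hl) hx)
    · rw [sum_stdAddChar_quadratic hp hl (neg_ne_zero.mpr hj), ← neg_one_mul j, map_mul,
        mul_inv, inv_neg, inv_one, zero_add]
      have h5 : -(l * x ^ 2 * (-1 * j⁻¹)) = l * x ^ 2 * j⁻¹ := by ring
      rw [h5]
      ring
  rw [Finset.sum_congr rfl fun j _ => h j, Finset.sum_add_distrib]
  simp

theorem sum_translateSum_sq (hp : p ≠ 2) {l : ZMod p} (hl : l ≠ 0) {f : ℍ → ℂ} (hf : IsPlus l f)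
    (τ : ℍ) : ∑ y : ZMod p, translateSum f (l * y ^ 2) τ
      = 2 * (p * translate f (0 : ZMod p) τ) - translateSum f (0 : ZMod p) τ := by
  rw [sum_mul_sq_of_eq_zero hp hl (fun r => translateSum f r τ) fun r hr => hf r hr τ,
    sum_translateSum]

/-- The plus condition in usable form: equate the Gauss sum evaluation of `∑ s_{l y²}` at `x = 0`
with its evaluation by counting square roots. -/
theorem translateSum_zero_eq (hp : p ≠ 2) {l : ZMod p} (hl : l ≠ 0) {f : ℍ → ℂ} (hf : IsPlus l f)
    (τ : ℍ) : translateSum f (0 : ZMod p) τ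
      = p * translate f (0 : ZMod p) τ
        - χ (-1) * quadGauss l * ∑ j : ZMod p, χ j * translate f j τ := by
  have h1 := sum_translateSum_sq_mul hp hl f 0 τ
  have h2 := sum_translateSum_sq hp hl hf τ
  simp only [mul_zero, zero_mul, neg_zero, AddChar.map_zero_eq_one, one_mul, if_true, mul_one, ne_eq,
    OfNat.ofNat_ne_zero, not_false_eq_true, zero_pow] at h1
  rw [h1] at h2
  linear_combination h2

/-- The involution `j ↦ -1/j` permutes the nonzero classes; the class 0, which Γ₀(p) does not
control, stays as a separate term. -/
theorem sum_translate_S {k : ℤ} {f : ℍ → ℂ} (hf : IsCovariant p k f) (u : ZMod p → ℂ) (τ : ℍ) :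
    ∑ j : ZMod p, u j * translate f j (ModularGroup.S • τ)
      = u 0 * translate f (0 : ZMod p) (ModularGroup.S • τ)
        + χ (-1) * (τ : ℂ) ^ k * ∑ j : ZMod p, χ j * u (-j⁻¹) * translate f j τ := by
  have hinv (j : ZMod p) : -(-j⁻¹)⁻¹ = j := by rw [inv_neg, neg_neg, inv_inv]
  let σ : ZMod p ≃ ZMod p := ⟨fun j => -j⁻¹, fun j => -j⁻¹, hinv, hinv⟩
  have h1 (j : ZMod p) : u j * translate f j (ModularGroup.S • τ)
      = (if j = 0 then u 0 * translate f (0 : ZMod p) (ModularGroup.S • τ) else 0)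
        + χ (-1) * (τ : ℂ) ^ k * (χ (σ j) * u (-(σ j)⁻¹) * translate f (σ j) τ) := by
    have hσ : σ j = -j⁻¹ := rfl
    rw [hσ, hinv]
    split_ifs with hj
    · subst hj
      simp [legendreChar_zero]
    · have h2 := legendreChar_sq (p := p) (x := -1) (by simp)
      rw [translate_S hf hj, ← neg_one_mul j⁻¹, map_mul, legendreChar_inv]
      linear_combination -(u j * χ j * (τ : ℂ) ^ k * translate f (-1 * j⁻¹) τ) * h2
  rw [Finset.sum_congr rfl fun j _ => h1 j, Finset.sum_add_distrib, ← Finset.mul_sum,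
    Equiv.sum_comp σ fun j => χ j * u (-j⁻¹) * translate f j τ]
  simp

/-- The relation `translateSum_zero_eq` holds at `τ` and at `-1/τ`, and `translate_S` gives `∑ χ(j)
t_j(-1/τ) = τ^k (s_0 - t_0)(τ)`, and the same with the two points exchanged. Eliminating the
character sums and `s_0(-1/τ)` leaves one linear equation between `s_0(τ)` and `t_0(-1/τ)`. -/
theorem translate_zero_S (hp : p ≠ 2) {l : ZMod p} (hl : l ≠ 0) {k : ℤ}
    (hk : (-1 : ℂ) ^ k = χ (-1)) {f : ℍ → ℂ} (hf : IsCovariant p k f) (hf' : IsPlus l f) (τ : ℍ) :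
    translate f (0 : ZMod p) (ModularGroup.S • τ)
      = (τ : ℂ) ^ k * (quadGauss l)⁻¹ * translateSum f (0 : ZMod p) τ := by
  have hg := quadGauss_ne_zero hp hl
  have hgg := quadGauss_sq hp hl
  have hτ : (τ : ℂ) ^ k ≠ 0 := zpow_ne_zero _ τ.ne_zero
  have hκ := legendreChar_sq (p := p) (x := -1) (by simp)
  have hS (τ : ℍ) : ∑ j : ZMod p, χ j * translate f j (ModularGroup.S • τ)
      = (τ : ℂ) ^ k * (translateSum f (0 : ZMod p) τ - translate f (0 : ZMod p) τ) := by
    have h1 (j : ZMod p) : χ j * χ (-j⁻¹) * translate f j τ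
        = χ (-1) * (translate f j τ - if j = 0 then translate f (0 : ZMod p) τ else 0) := by
      split_ifs with hj
      · subst hj
        simp [legendreChar_zero]
      · rw [← neg_one_mul j⁻¹, map_mul, legendreChar_inv]
        linear_combination (χ (-1) * translate f j τ) * legendreChar_sq hj
    rw [sum_translate_S hf, Finset.sum_congr rfl fun j _ => h1 j, ← Finset.mul_sum,
      Finset.sum_sub_distrib, Finset.sum_ite_eq' Finset.univ (0 : ZMod p), legendreChar_zero,
      translateSum_apply]
    simp only [Finset.mem_univ, if_true, mul_zero, neg_zero, AddChar.map_zero_eq_one, one_mul,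
      zero_mul, zero_add]
    linear_combination ((τ : ℂ) ^ k * (∑ j : ZMod p, translate f j τ - translate f (0 : ZMod p) τ)) * hκ
  have h1 := hS τ
  have h2 := hS (ModularGroup.S • τ)
  have h3 := translateSum_zero_eq hp hl hf' τ
  have h4 := translateSum_zero_eq hp hl hf' (ModularGroup.S • τ)
  rw [S_smul_S_smul, coe_S_smul, ← neg_one_mul, mul_zpow, inv_zpow, hk] at h2
  rw [h1] at h4
  rw [h2, h4] at h3
  have hp1 : (p : ℂ) - 1 ≠ 0 := by
    rw [sub_ne_zero]
    exact_mod_cast (Fact.out : p.Prime).one_lt.ne'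
  generalize quadGauss l = g at *
  generalize translateSum f (0 : ZMod p) τ = s at *
  generalize translate f (0 : ZMod p) (ModularGroup.S • τ) = b at *
  generalize translate f (0 : ZMod p) τ = a at *
  generalize χ (-1) = κ at *
  generalize (τ : ℂ) ^ k = t at *
  have h5 : s = p * a - κ * κ * (g * t⁻¹ * (p - 1) * b)
      + κ * κ * κ * (g * g) * (t⁻¹ * t) * (s - a) := by linear_combination h3
  rw [hκ, hgg, inv_mul_cancel₀ hτ] at h5
  -- With `κ² = 1` and `g² = κ p` the terms in `a` cancel.
  have h6 : (p - 1) * s = g * t⁻¹ * (p - 1) * b := by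
    linear_combination -h5 - p * (s - a) * hκ
  refine mul_left_cancel₀ hp1 ?_
  have h7 : (p - 1) * (t * g⁻¹ * s) = t * g⁻¹ * ((p - 1) * s) := by ring
  rw [h7, h6]
  field_simp

/-- The component at `x` of the lift, as a function on `ℤ / p`. -/
def liftComp (l : ZMod p) (f : ℍ → ℂ) (x : ZMod p) : ℍ → ℂ :=
  ((if x = 0 then 2 else 1) * (p : ℂ)⁻¹) • translateSum f (l * x ^ 2)

theorem liftComp_T {k : ℤ} {f : ℍ → ℂ} (hf : IsCovariant p k f) (l x : ZMod p) (τ : ℍ) :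
    liftComp l f x (ModularGroup.T • τ) = ψ (l * x ^ 2) * liftComp l f x τ := by
  simp only [liftComp, Pi.smul_apply, smul_eq_mul, translateSum_T hf]
  ring

theorem sum_mul_liftComp (l : ZMod p) (f : ℍ → ℂ) (u : ZMod p → ℂ) (τ : ℍ) :
    ∑ y : ZMod p, u y * liftComp l f y τ
      = (p : ℂ)⁻¹ * (u 0 * translateSum f (0 : ZMod p) τ
        + ∑ y : ZMod p, u y * translateSum f (l * y ^ 2) τ) := by
  have h (y : ZMod p) : u y * liftComp l f y τ
      = (p : ℂ)⁻¹ * ((if y = 0 then u 0 * translateSum f (0 : ZMod p) τ else 0)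
        + u y * translateSum f (l * y ^ 2) τ) := by
    simp only [liftComp, Pi.smul_apply, smul_eq_mul]
    split_ifs with hy
    · subst hy
      simp only [ne_eq, OfNat.ofNat_ne_zero, not_false_eq_true, zero_pow, mul_zero]
      ring
    · ring
  rw [Finset.sum_congr rfl fun y _ => h y, ← Finset.mul_sum, Finset.sum_add_distrib]
  simp

/-- Both sides are expanded in the `t_j(τ)` and `s_0(τ)`. For `x ≠ 0` they agree by
`translate_zero_S`; for `x = 0` the doubled component requires the plus relation once more. -/
theorem liftComp_S (hp : p ≠ 2) {l : ZMod p} (hl : l ≠ 0) {k : ℤ}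
    (hk : (-1 : ℂ) ^ k = χ (-1)) {f : ℍ → ℂ} (hf : IsCovariant p k f) (hf' : IsPlus l f)
    (x : ZMod p) (τ : ℍ) :
    liftComp l f x (ModularGroup.S • τ)
      = (τ : ℂ) ^ k * ∑ y : ZMod p, (quadGauss l)⁻¹ * ψ (-(2 * l * x * y)) * liftComp l f y τ := by
  have hg := quadGauss_ne_zero hp hl
  have hp0 : (p : ℂ) ≠ 0 := by exact_mod_cast (Fact.out : p.Prime).ne_zero
  have h1 (y : ZMod p) : (quadGauss l)⁻¹ * ψ (-(2 * l * x * y)) * liftComp l f y τ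
      = (quadGauss l)⁻¹ * (ψ (-(2 * l * x * y)) * liftComp l f y τ) := mul_assoc _ _ _
  rw [Finset.sum_congr rfl fun y _ => h1 y, ← Finset.mul_sum, sum_mul_liftComp,
    sum_translateSum_sq_mul hp hl, liftComp, Pi.smul_apply, smul_eq_mul, translateSum_apply,
    sum_translate_S hf, translate_zero_S hp hl hk hf hf']
  have h2 (j : ZMod p) : χ j * ψ (-(-j⁻¹ * (l * x ^ 2))) * translate f j τ
      = χ j * ψ (l * x ^ 2 * j⁻¹) * translate f j τ := by
    congr 3
    ring
  rw [Finset.sum_congr rfl fun j _ => h2 j]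
  split_ifs with hx
  · subst hx
    have h3 := translateSum_zero_eq hp hl hf' τ
    simp only [mul_zero, zero_mul, neg_zero, AddChar.map_zero_eq_one, one_mul, mul_one, ne_eq,
      OfNat.ofNat_ne_zero, not_false_eq_true, zero_pow]
    field_simp
    linear_combination (τ : ℂ) ^ k * h3
  · simp only [mul_zero, zero_mul, neg_zero, AddChar.map_zero_eq_one, one_mul]
    field_simp
    ring

end Lift

/-! ### From vector valued forms to scalar valued forms -/

section Descend

variable {p : ℕ} [Fact p.Prime]

local notation "ψ" => ZMod.stdAddChar
local notation "χ" => legendreChar p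

/-- Equivariance of `G` under the generators `T` and `S`, for the Weil representation of the
discriminant form `x ↦ l x² / p`. -/
structure IsEquivariant (l : ZMod p) (k : ℤ) (G : ℍ → ZMod p → ℂ) : Prop where
  T_smul : ∀ τ x, G (ModularGroup.T • τ) x = ψ (l * x ^ 2) * G τ x
  S_smul : ∀ τ x, G (ModularGroup.S • τ) x
    = (τ : ℂ) ^ k * ∑ y : ZMod p, (quadGauss l)⁻¹ * ψ (-(2 * l * x * y)) * G τ y

/-- The pairing of `G` with the row vector attached to the bottom row of `N`. -/
def rowSum (l : ZMod p) (G : ℍ → ZMod p → ℂ) (N : SL(2, ℤ)) (τ : ℍ) : ℂ :=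
  ∑ x : ZMod p, weilRow l ((N 1 0 : ℤ) : ZMod p) ((N 1 1 : ℤ) : ZMod p) x * G τ x

/-- The function `τ ↦ (1 / 2) ∑ G_x(p τ)`. -/
def descend (G : ℍ → ZMod p → ℂ) : ℍ → ℂ :=
  (1 / 2 : ℂ) • ∑ x : ZMod p, (fun τ => G τ x) ∘ aff (p : ℝ) (natCast_prime_pos p) 0

theorem descend_apply (G : ℍ → ZMod p → ℂ) (τ : ℍ) :
    descend G τ = 1 / 2 * ∑ x : ZMod p, G (aff (p : ℝ) (natCast_prime_pos p) 0 τ) x := by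
  simp [descend, Finset.sum_apply]

theorem bottom_row_ne_zero (N : SL(2, ℤ)) :
    ((N 1 0 : ℤ) : ZMod p) ≠ 0 ∨ ((N 1 1 : ℤ) : ZMod p) ≠ 0 := by
  by_contra! h
  have h1 := congrArg (Int.cast : ℤ → ZMod p) N.det_coe
  rw [Matrix.det_fin_two] at h1
  push_cast at h1
  rw [h.1, h.2] at h1
  simp at h1

theorem SL_mul_apply (M N : SL(2, ℤ)) (i j : Fin 2) :
    (M * N) i j = M i 0 * N 0 j + M i 1 * N 1 j := by
  rw [Matrix.SpecialLinearGroup.coe_mul, Matrix.mul_apply, Fin.sum_univ_two]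

variable {l : ZMod p} {k : ℤ} {G : ℍ → ZMod p → ℂ}

theorem IsEquivariant.natCast_vadd (hG : IsEquivariant l k G) (m : ℕ) (τ : ℍ) (x : ZMod p) :
    G ((m : ℝ) +ᵥ τ) x = ψ ((m : ZMod p) * (l * x ^ 2)) * G τ x := by
  induction m with
  | zero => simp
  | succ m ih =>
    have h2 : ((m + 1 : ℕ) : ℝ) +ᵥ τ = ModularGroup.T • ((m : ℝ) +ᵥ τ) := by
      rw [modular_T_smul, vadd_vadd]
      push_cast
      rw [add_comm]
    rw [h2, hG.T_smul, ih, ← mul_assoc, ← AddChar.map_add_eq_mul]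
    congr 2
    push_cast
    ring

theorem IsEquivariant.rowSum_T (hG : IsEquivariant l k G) (N : SL(2, ℤ)) (τ : ℍ) :
    rowSum l G N (ModularGroup.T • τ) = rowSum l G (N * ModularGroup.T) τ := by
  have h0 : (N * ModularGroup.T) 1 0 = N 1 0 := by
    rw [SL_mul_apply]
    simp [ModularGroup.T]
  have h1 : (N * ModularGroup.T) 1 1 = N 1 0 + N 1 1 := by
    rw [SL_mul_apply]
    simp [ModularGroup.T]
  refine Finset.sum_congr rfl fun x _ => ?_
  rw [hG.T_smul, ← mul_assoc, weilRow_mul_T, h0, h1]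
  push_cast
  rfl

theorem IsEquivariant.rowSum_S (hp : p ≠ 2) (hl : l ≠ 0) (hG : IsEquivariant l k G)
    (N : SL(2, ℤ)) (τ : ℍ) : rowSum l G N (ModularGroup.S • τ)
      = (τ : ℂ) ^ k * rowSum l G (N * ModularGroup.S) τ := by
  have h0 : (N * ModularGroup.S) 1 0 = N 1 1 := by
    rw [SL_mul_apply]
    simp [ModularGroup.S]
  have h1 : (N * ModularGroup.S) 1 1 = -N 1 0 := by
    rw [SL_mul_apply]
    simp [ModularGroup.S]
  have h2 (x : ZMod p) : weilRow l ((N 1 0 : ℤ) : ZMod p) ((N 1 1 : ℤ) : ZMod p) x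
        * G (ModularGroup.S • τ) x
      = ∑ y : ZMod p, (τ : ℂ) ^ k * (weilRow l ((N 1 0 : ℤ) : ZMod p) ((N 1 1 : ℤ) : ZMod p) x
        * ((quadGauss l)⁻¹ * ψ (-(2 * l * y * x))) * G τ y) := by
    rw [hG.S_smul, Finset.mul_sum, Finset.mul_sum]
    refine Finset.sum_congr rfl fun y _ => ?_
    rw [mul_right_comm (2 * l) y x]
    ring
  rw [rowSum, rowSum, Finset.sum_congr rfl fun x _ => h2 x, Finset.sum_comm, Finset.mul_sum]
  refine Finset.sum_congr rfl fun y _ => ?_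
  rw [← Finset.mul_sum, ← Finset.sum_mul, weilRow_mul_S hp hl (bottom_row_ne_zero N), h0, h1]
  push_cast
  rfl

/-- Induction over words in `S` and `T`, with `N` arbitrary so that letters can be absorbed into it
one at a time. -/
theorem IsEquivariant.rowSum_smul (hp : p ≠ 2) (hl : l ≠ 0) (hG : IsEquivariant l k G)
    (M N : SL(2, ℤ)) (τ : ℍ) :
    rowSum l G N (M • τ) = cocyc M τ ^ k * rowSum l G (N * M) τ := by
  have hM : M ∈ Subgroup.closure {ModularGroup.S, ModularGroup.T} := by
    rw [SpecialLinearGroup.SL2Z_generators]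
    trivial
  induction hM using Subgroup.closure_induction generalizing N τ with
  | mem M hM =>
    rcases hM with rfl | hM
    · rw [hG.rowSum_S hp hl, cocyc_S]
    · rw [Set.mem_singleton_iff.mp hM, hG.rowSum_T, cocyc_T, one_zpow, one_mul]
  | one => simp [cocyc]
  | mul M M' _ _ h h' =>
    rw [mul_smul, h, h', cocyc_mul, mul_zpow, mul_assoc, mul_assoc]
  | inv M _ h =>
    have h1 := h (N * M⁻¹) (M⁻¹ • τ)
    have h2 := cocyc_mul M M⁻¹ τ
    rw [mul_inv_cancel, show cocyc 1 τ = 1 by simp [cocyc]] at h2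
    rw [smul_inv_smul, inv_mul_cancel_right] at h1
    rw [h1, ← mul_assoc, ← mul_zpow, mul_comm (cocyc M⁻¹ τ), ← h2, one_zpow, one_mul]

theorem rowSum_eq_of_zero (N : SL(2, ℤ)) (h : ((N 1 0 : ℤ) : ZMod p) = 0) (τ : ℍ) :
    rowSum l G N τ = χ ((N 1 1 : ℤ) : ZMod p) * G τ 0 := by
  simp [rowSum, weilRow, h]

theorem rowSum_eq_of_ne_zero (N : SL(2, ℤ)) (h : ((N 1 0 : ℤ) : ZMod p) ≠ 0)
    (h' : ((N 1 1 : ℤ) : ZMod p) = 0) (τ : ℍ) :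
    rowSum l G N τ = (quadGauss l)⁻¹ * χ ((N 1 0 : ℤ) : ZMod p) * ∑ x : ZMod p, G τ x := by
  simp [rowSum, weilRow, h, h', Finset.mul_sum]

/-- The row `𝔢₀ρ(S)` is constant, equal to `g⁻¹`. -/
theorem sum_eq_rowSum_S (hp : p ≠ 2) (hl : l ≠ 0) (G : ℍ → ZMod p → ℂ) (τ : ℍ) :
    ∑ x : ZMod p, G τ x = quadGauss l * rowSum l G ModularGroup.S τ := by
  rw [rowSum_eq_of_ne_zero _ (by simp [ModularGroup.S]) (by simp [ModularGroup.S])]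
  simp [ModularGroup.S, quadGauss_ne_zero hp hl]

theorem IsEquivariant.descend_isCovariant (hp : p ≠ 2) (hl : l ≠ 0) (hG : IsEquivariant l k G) :
    IsCovariant p k (descend G) := by
  intro M hM τ
  have hp0 : (p : ℂ) ≠ 0 := by exact_mod_cast (Fact.out : p.Prime).ne_zero
  rw [CongruenceSubgroup.Gamma0_mem] at hM
  obtain ⟨c, hc⟩ := (ZMod.intCast_zmod_eq_zero_iff_dvd _ p).mp hM
  have hdet : M 0 0 * M 1 1 - M 0 1 * M 1 0 = 1 := by
    rw [← Matrix.det_fin_two, M.det_coe]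
  -- Conjugation by `τ ↦ pτ` carries `M` to `M'`. The bottom row of `S M'` is `(a, p b)`, congruent
  -- to `(a, 0)`, which gives the factor `χ(a) = χ(d)`.
  let M' : SL(2, ℤ) := ⟨!![M 0 0, p * M 0 1; c, M 1 1], by
    rw [Matrix.det_fin_two_of]
    rw [hc] at hdet
    linear_combination hdet⟩
  have hcM : cocyc M' (aff (p : ℝ) (natCast_prime_pos p) 0 τ) = cocyc M τ := by
    rw [cocyc, cocyc, coe_aff, hc]
    simp only [M', Matrix.of_apply, Matrix.cons_val', Matrix.cons_val_zero, Matrix.cons_val_one,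
      Matrix.cons_val_fin_one]
    push_cast
    ring
  have h1 : aff (p : ℝ) (natCast_prime_pos p) 0 (M • τ)
      = M' • aff (p : ℝ) (natCast_prime_pos p) 0 τ := by
    ext1
    rw [coe_SL_smul, coe_aff, coe_SL_smul, hcM, coe_aff]
    simp only [M', Matrix.of_apply, Matrix.cons_val', Matrix.cons_val_zero, Matrix.cons_val_one,
      Matrix.cons_val_fin_one]
    push_cast
    ring
  have had : ((M 0 0 : ℤ) : ZMod p) * ((M 1 1 : ℤ) : ZMod p) = 1 := by
    have := congrArg (Int.cast : ℤ → ZMod p) hdet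
    push_cast at this
    rwa [hM, mul_zero, sub_zero] at this
  have ha : ((M 0 0 : ℤ) : ZMod p) ≠ 0 := left_ne_zero_of_mul_eq_one had
  have h20 : (ModularGroup.S * M') 1 0 = M 0 0 := by
    rw [SL_mul_apply]
    simp [ModularGroup.S, M']
  have h21 : (ModularGroup.S * M') 1 1 = p * M 0 1 := by
    rw [SL_mul_apply]
    simp [ModularGroup.S, M']
  have hχ : χ ((M 0 0 : ℤ) : ZMod p) = χ ((M 1 1 : ℤ) : ZMod p) := by
    rw [← legendreChar_inv, inv_eq_of_mul_eq_one_right had]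
  rw [descend_apply, descend_apply, h1, sum_eq_rowSum_S hp hl,
    hG.rowSum_smul hp hl, hcM, rowSum_eq_of_ne_zero _ (by rwa [h20]) (by rw [h21]; simp), h20, hχ]
  have := quadGauss_ne_zero hp hl
  field_simp

theorem IsEquivariant.descend_S (hp : p ≠ 2) (hl : l ≠ 0) (hG : IsEquivariant l k G) (τ : ℍ) :
    descend G (ModularGroup.S • τ) = (1 / 2 * quadGauss l * χ (-1) * (p : ℂ) ^ (-k)) * (τ : ℂ) ^ k *
      G (aff (p : ℝ)⁻¹ (inv_natCast_prime_pos p) 0 τ) 0 := by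
  have hp0 : (p : ℂ) ≠ 0 := by exact_mod_cast (Fact.out : p.Prime).ne_zero
  have h1 : aff (p : ℝ) (natCast_prime_pos p) 0 (ModularGroup.S • τ)
      = ModularGroup.S • aff (p : ℝ)⁻¹ (inv_natCast_prime_pos p) 0 τ := by
    ext1
    rw [coe_S_smul, coe_aff, coe_S_smul, coe_aff]
    push_cast
    simp [mul_comm]
  rw [descend_apply, h1, sum_eq_rowSum_S hp hl, hG.rowSum_S hp hl,
    rowSum_eq_of_zero]
  · have h2 : (((ModularGroup.S * ModularGroup.S) 1 1 : ℤ) : ZMod p) = -1 := by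
      rw [SL_mul_apply]
      simp [ModularGroup.S]
    rw [h2, coe_aff]
    push_cast
    rw [add_zero, mul_zpow, inv_zpow']
    ring
  · rw [SL_mul_apply]
    simp [ModularGroup.S]

/-- `M (S T^j)⁻¹` has lower left entry `c j - d`, which `j ≡ d / c` makes divisible by `p`. -/
theorem exists_Gamma0_mul_S_mul_T {M : SL(2, ℤ)} (h : M ∉ CongruenceSubgroup.Gamma0 p) :
    ∃ γ ∈ CongruenceSubgroup.Gamma0 p, ∃ j : ℤ,
      M = γ * (ModularGroup.S * ModularGroup.T ^ j) := by
  rw [CongruenceSubgroup.Gamma0_mem] at h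
  obtain ⟨j, hj⟩ := ZMod.intCast_surjective (((M 1 1 : ℤ) : ZMod p) * ((M 1 0 : ℤ) : ZMod p)⁻¹)
  refine ⟨M * (ModularGroup.S * ModularGroup.T ^ j)⁻¹, ?_, j, by group⟩
  have h1 : (M * (ModularGroup.S * ModularGroup.T ^ j)⁻¹) 1 0 = M 1 0 * j - M 1 1 := by
    rw [mul_inv_rev, ← zpow_neg]
    simp only [SL_mul_apply, ModularGroup.coe_T_zpow, Matrix.SpecialLinearGroup.coe_inv,
      Matrix.adjugate_fin_two]
    simp [ModularGroup.S]
    ring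
  rw [CongruenceSubgroup.Gamma0_mem, h1]
  push_cast
  rw [hj]
  field_simp
  ring

theorem slashSL_eq_of_mem_Gamma0 {f : ℍ → ℂ} (hf : IsCovariant p k f) {γ : SL(2, ℤ)}
    (hγ : γ ∈ CongruenceSubgroup.Gamma0 p) (N : SL(2, ℤ)) :
    slashSL k (γ * N) f = χ ((γ 1 1 : ℤ) : ZMod p) • slashSL k N f := by
  funext τ
  simp only [slashSL, Pi.smul_apply, smul_eq_mul]
  rw [mul_smul, hf γ hγ, cocyc_mul, mul_zpow, zpow_neg (cocyc γ _)]
  have := zpow_ne_zero k (cocyc_ne_zero γ (N • τ))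
  field_simp

theorem IsEquivariant.slashSL_S_mul_T (hp : p ≠ 2) (hl : l ≠ 0) (hG : IsEquivariant l k G)
    (j : ℤ) : slashSL k (ModularGroup.S * ModularGroup.T ^ j) (descend G)
      = (1 / 2 * quadGauss l * χ (-1) * (p : ℂ) ^ (-k)) •
        ((fun τ => G τ 0) ∘ aff (p : ℝ)⁻¹ (inv_natCast_prime_pos p) (j / p)) := by
  funext τ
  simp only [slashSL, Pi.smul_apply, smul_eq_mul, Function.comp_apply]
  have h1 : aff (p : ℝ)⁻¹ (inv_natCast_prime_pos p) 0 (ModularGroup.T ^ j • τ)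
      = aff (p : ℝ)⁻¹ (inv_natCast_prime_pos p) (j / p) τ := by
    ext1
    rw [coe_aff, coe_aff, modular_T_zpow_smul, coe_vadd]
    push_cast
    ring
  have h2 : cocyc (ModularGroup.T ^ j) τ = 1 := by
    rw [cocyc, ModularGroup.coe_T_zpow]
    simp
  rw [mul_smul, hG.descend_S hp hl, h1, cocyc_mul, h2, mul_one, cocyc_S, zpow_neg (_ : ℂ) k]
  have := zpow_ne_zero k (ModularGroup.T ^ j • τ : ℍ).ne_zero
  field_simp

/-! ### Principal parts of the descent at the cusps -/

theorem descend_hasPrincipalPart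
    (hpp : ∀ x, HasPrincipalPart (exponents (l * x ^ 2)) fun τ => G τ x) :
    HasPrincipalPart (Set.range fun n : ℤ => (n : ℝ)) (descend G) := by
  have hp0 := (natCast_prime_pos p).ne'
  refine (hasPrincipalPart_sum _ fun x _ => (hpp x).comp_aff ?_).smul _
  rintro _ ⟨n, -, rfl⟩
  exact ⟨n, by field_simp⟩

/-- Up to a constant, the slash by `M` is either the descent itself or `G_0((τ + j) / p)`. The
exponents of `G_0` are integers, so those of the latter lie in `ℤ / p`. -/
theorem IsEquivariant.slashSL_hasPrincipalPart (hp : p ≠ 2) (hl : l ≠ 0) (hG : IsEquivariant l k G)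
    (hpp : ∀ x, HasPrincipalPart (exponents (l * x ^ 2)) fun τ => G τ x) (M : SL(2, ℤ)) :
    HasPrincipalPart (Set.range fun n : ℤ => (n : ℝ) / p) (slashSL k M (descend G)) := by
  have hp0 := (natCast_prime_pos p).ne'
  have hcov := hG.descend_isCovariant hp hl
  by_cases hM : M ∈ CongruenceSubgroup.Gamma0 p
  · have h1 := slashSL_eq_of_mem_Gamma0 hcov hM 1
    have h2 : slashSL k 1 (descend G) = descend G := by
      funext τ
      simp [slashSL, cocyc]
    rw [mul_one, h2] at h1
    rw [h1]
    refine ((descend_hasPrincipalPart hpp).mono ?_).smul _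
    rintro _ ⟨n, rfl⟩
    exact ⟨n * p, by push_cast; field_simp⟩
  · obtain ⟨γ, hγ, j, rfl⟩ := exists_Gamma0_mul_S_mul_T hM
    rw [slashSL_eq_of_mem_Gamma0 hcov hγ, hG.slashSL_S_mul_T hp hl]
    refine (((hpp 0).comp_aff ?_).smul _).smul _
    rintro _ ⟨n, hn, rfl⟩
    rw [zero_pow two_ne_zero, mul_zero] at hn
    obtain ⟨m, rfl⟩ := (ZMod.intCast_zmod_eq_zero_iff_dvd n p).mp hn
    exact ⟨m, by push_cast; field_simp⟩

theorem IsEquivariant.descend_mem_maassForms (hp : p ≠ 2) (hl : l ≠ 0) (hG : IsEquivariant l k G)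
    (hs : ∀ x, IsSmooth fun τ => G τ x) (hΔ : ∀ x τ, laplace k (fun τ => G τ x) τ = 0)
    (hpp : ∀ x, HasPrincipalPart (exponents (l * x ^ 2)) fun τ => G τ x) :
    descend G ∈ maassForms p (legendreChar p) k := by
  refine ⟨(isSmooth_sum _ fun x _ => (hs x).comp_aff).smul _, hG.descend_isCovariant hp hl,
    fun τ => ?_, descend_hasPrincipalPart hpp,
    hG.slashSL_hasPrincipalPart hp hl hpp⟩
  rw [descend, laplace_smul, laplace_sum k _ fun x _ => (hs x).comp_aff,
    Finset.sum_eq_zero fun x _ => ?_, mul_zero]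
  rw [laplace_comp_aff k (hs x), hΔ]

/-! ### The plus condition for the descent -/

/-- Shifting the integral over a period by `d` multiplies the mode by `c e(-n d)`. -/
theorem fourierMode_eq_zero_of_quasiperiodic {F : ℂ → ℂ} {y d : ℝ} {n : ℤ} {c : ℂ}
    (hF : ∀ x : ℝ, F ((x + 1 : ℝ) + y * Complex.I) = F (x + y * Complex.I))
    (hd : ∀ x : ℝ, F ((x + d : ℝ) + y * Complex.I) = c * F (x + y * Complex.I))
    (hc : c ≠ e (n * d)) : fourierMode n F y = 0 := by
  have hper : Function.Periodic (fun x : ℝ => e (-n * x) * F (x + y * Complex.I)) 1 := by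
    intro x
    simp only
    rw [hF]
    congr 1
    have h : e (-(n : ℂ)) = 1 := by
      have := e_intCast (-n)
      push_cast at this
      exact this
    push_cast
    rw [mul_add, mul_one, e_add, h, mul_one]
  have h1 := intervalIntegral.integral_comp_add_right (a := 0) (b := 1)
    (fun x : ℝ => e (-n * x) * F (x + y * Complex.I)) d
  have h2 : ∫ x in (0 : ℝ) + d..1 + d, e (-n * x) * F (x + y * Complex.I) = fourierMode n F y := by
    have := hper.intervalIntegral_add_eq d 0
    rw [zero_add, add_comm 1 d, this, zero_add]
    rfl
  have h3 (x : ℝ) : e (-n * (x + d : ℝ)) * F ((x + d : ℝ) + y * Complex.I)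
      = e (-n * d) * c * (e (-n * x) * F (x + y * Complex.I)) := by
    rw [hd]
    push_cast
    rw [mul_add, e_add]
    ring
  rw [h2, intervalIntegral.integral_congr fun x _ => h3 x, intervalIntegral.integral_const_mul] at h1
  change e (-n * d) * c * fourierMode n F y = fourierMode n F y at h1
  have h4 : (e (-n * d) * c - 1) * fourierMode n F y = 0 := by linear_combination h1
  refine (mul_eq_zero.mp h4).resolve_left fun h5 => hc ?_
  have h6 : e (n * d) * e (-n * d) = 1 := by
    rw [← e_add, ← e_zero]
    congr 1
    ring
  linear_combination e (n * d) * h5 - c * h6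

/-- Under `τ ↦ τ + 1/p` the function `G_x(pτ)` picks up `ψ(l x²)`, so it has modes only at `n ≡ l
x²`; this congruence is impossible when `χ(n) = -χ(l)`. -/
theorem IsEquivariant.fourierMode_descend (hl : l ≠ 0) (hG : IsEquivariant l k G)
    (hs : ∀ x, IsSmooth fun τ => G τ x) {n : ℤ} (hn : χ (n : ZMod p) = -χ l) {y : ℝ} (hy : 0 < y) :
    fourierMode n (descend G ∘ ofComplex) y = 0 := by
  have hp0 : (p : ℂ) ≠ 0 := by exact_mod_cast (Fact.out : p.Prime).ne_zero
  have hcomp (x : ZMod p) : IsSmooth ((fun τ => G τ x) ∘ aff (p : ℝ) (natCast_prime_pos p) 0) :=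
    (hs x).comp_aff
  have h1 : fourierMode n (descend G ∘ ofComplex) y = ∑ x : ZMod p, (1 / 2 : ℂ) *
      fourierMode n (((fun τ => G τ x) ∘ aff (p : ℝ) (natCast_prime_pos p) 0) ∘ ofComplex) y := by
    simp only [fourierMode, ← intervalIntegral.integral_const_mul]
    rw [← intervalIntegral.integral_finsetSum]
    · congr 1
      funext x
      rw [Function.comp_apply, descend_apply, Finset.mul_sum, Finset.mul_sum]
      refine Finset.sum_congr rfl fun y _ => ?_
      simp only [Function.comp_apply]
      ring
    · intro x _
      exact (continuous_const.mul ((continuous_e_mul _).mul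
        (continuous_horizontal (hcomp x) hy))).intervalIntegrable _ _
  rw [h1]
  refine Finset.sum_eq_zero fun x _ => ?_
  have hshift (m : ℕ) (x' : ℝ) :
      (((fun τ => G τ x) ∘ aff (p : ℝ) (natCast_prime_pos p) 0) ∘ ofComplex)
        ((x' + (m / p : ℝ) : ℝ) + y * Complex.I)
      = ψ ((m : ZMod p) * (l * x ^ 2)) * (((fun τ => G τ x) ∘ aff (p : ℝ) (natCast_prime_pos p) 0) ∘ ofComplex)
        (x' + y * Complex.I) := by
    simp only [Function.comp_apply]
    rw [← hG.natCast_vadd, ofComplex_apply_of_im_pos (by rwa [im_add_mul_I]),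
      ofComplex_apply_of_im_pos (by rwa [im_add_mul_I])]
    congr 1
    ext1
    rw [coe_vadd, coe_aff, coe_aff]
    push_cast
    field_simp
    ring
  rw [fourierMode_eq_zero_of_quasiperiodic (d := ((1 : ℕ) / p : ℝ)) (c := ψ (((1 : ℕ) : ZMod p) * (l * x ^ 2)))
    ?_ (hshift 1) ?_, mul_zero]
  · intro x'
    have := hshift p x'
    rw [div_self (by exact_mod_cast hp0)] at this
    rw [this]
    simp
  · have h2 : ((n : ℂ) * (((1 : ℕ) / p : ℝ) : ℂ)) = ((n / p : ℝ) : ℂ) := by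
      push_cast
      ring
    rw [h2, ← stdAddChar_intCast, Nat.cast_one, one_mul]
    intro h3
    have h4 := ZMod.injective_stdAddChar h3
    rw [← h4, map_mul, map_pow] at hn
    have hχl := legendreChar_sq hl
    have hχl0 : χ l ≠ 0 := fun h0 => by simp [h0] at hχl
    have h5 : χ x ^ 2 = -1 := mul_left_cancel₀ hχl0 (by rw [hn]; ring)
    rcases eq_or_ne x 0 with rfl | hx
    · simp [legendreChar_zero] at h5
    · rw [sq, legendreChar_sq hx] at h5
      norm_num at h5

/-! ### The two constructions are mutually inverse -/

theorem descend_liftComp (hp : p ≠ 2) (hl : l ≠ 0) {f : ℍ → ℂ} (hf : IsPlus l f) :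
    descend (fun τ x => liftComp l f x τ) = f := by
  have hp0 : (p : ℂ) ≠ 0 := by exact_mod_cast (Fact.out : p.Prime).ne_zero
  funext τ
  have h1 := sum_mul_liftComp l f (fun _ => 1) (aff (p : ℝ) (natCast_prime_pos p) 0 τ)
  simp only [one_mul] at h1
  rw [descend_apply, h1, sum_translateSum_sq hp hl hf]
  have h2 : translate f (0 : ZMod p) (aff (p : ℝ) (natCast_prime_pos p) 0 τ) = f τ := by
    rw [translate, Function.comp_apply]
    congr 1
    ext1
    rw [coe_aff, coe_aff, ZMod.val_zero]
    push_cast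
    field_simp
    simp
  rw [h2]
  field_simp
  ring

/-- Applying the `S`-law twice returns to `τ`; orthogonality produces the index `-x` and the factor
`(-1)^k p / g²`, which is 1 by the parity of `k`. -/
theorem IsEquivariant.neg_apply (hp : p ≠ 2) (hl : l ≠ 0) (hk : (-1 : ℂ) ^ k = χ (-1))
    (hG : IsEquivariant l k G) (τ : ℍ) (x : ZMod p) : G τ (-x) = G τ x := by
  have hg := quadGauss_ne_zero hp hl
  have hgg := quadGauss_sq hp hl
  have hκ := legendreChar_sq (p := p) (x := -1) (by simp)
  have hp0 : (p : ℂ) ≠ 0 := by exact_mod_cast (Fact.out : p.Prime).ne_zero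
  have h2 := two_ne_zero_zmod hp
  have h1 := hG.S_smul (ModularGroup.S • τ) x
  have h3 (y : ZMod p) : (quadGauss l)⁻¹ * ψ (-(2 * l * x * y)) * G (ModularGroup.S • τ) y
      = ∑ z : ZMod p, (τ : ℂ) ^ k * ((quadGauss l)⁻¹ * (quadGauss l)⁻¹) *
        (ψ (-(2 * l * (x + z)) * y) * G τ z) := by
    rw [hG.S_smul, Finset.mul_sum, Finset.mul_sum]
    refine Finset.sum_congr rfl fun z _ => ?_
    have h4 : -(2 * l * (x + z)) * y = -(2 * l * x * y) + -(2 * l * y * z) := by ring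
    rw [h4, AddChar.map_add_eq_mul]
    ring
  have h5 (z : ZMod p) : ∑ y : ZMod p, ψ (-(2 * l * (x + z)) * y) * G τ z
      = if z = -x then p * G τ (-x) else 0 := by
    rw [← Finset.sum_mul, sum_stdAddChar_mul]
    have h6 : -(2 * l * (x + z)) = 0 ↔ z = -x := by
      rw [neg_eq_zero, mul_eq_zero, or_iff_right (mul_ne_zero h2 hl), add_comm, add_eq_zero_iff_eq_neg]
    simp only [h6]
    split_ifs with h7
    · rw [h7]
    · rw [zero_mul]
  rw [S_smul_S_smul, Finset.sum_congr rfl fun y _ => h3 y, Finset.sum_comm] at h1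
  simp only [← Finset.mul_sum] at h1
  rw [Finset.sum_congr rfl fun z _ => h5 z, Finset.sum_ite_eq' Finset.univ (-x), coe_S_smul,
    ← neg_one_mul, mul_zpow, hk, ← mul_inv, hgg, inv_zpow] at h1
  simp only [Finset.mem_univ, if_true] at h1
  have hτ : (τ : ℂ) ^ k ≠ 0 := zpow_ne_zero _ τ.ne_zero
  have hκ0 : χ (-1) ≠ 0 := fun h0 => by simp [h0] at hκ
  rw [h1]
  field_simp

theorem translateSum_descend (hG : IsEquivariant l k G) (r : ZMod p) (τ : ℍ) :
    translateSum (descend G) r τ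
      = 1 / 2 * p * ∑ x : ZMod p, if l * x ^ 2 = r then G τ x else 0 := by
  have hp0 : (p : ℂ) ≠ 0 := by exact_mod_cast (Fact.out : p.Prime).ne_zero
  have h1 (j : ZMod p) : ψ (-(j * r)) * translate (descend G) j τ
      = ∑ x : ZMod p, 1 / 2 * (ψ ((l * x ^ 2 - r) * j) * G τ x) := by
    have h2 : aff (p : ℝ) (natCast_prime_pos p) 0
        (aff (p : ℝ)⁻¹ (inv_natCast_prime_pos p) (j.val / p) τ) = (j.val : ℝ) +ᵥ τ := by
      ext1
      rw [coe_aff, coe_aff, coe_vadd]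
      push_cast
      field_simp
      ring
    rw [translate, Function.comp_apply, descend_apply, h2, Finset.mul_sum, Finset.mul_sum]
    refine Finset.sum_congr rfl fun x _ => ?_
    have h3 : (l * x ^ 2 - r) * j = -(j * r) + j * (l * x ^ 2) := by ring
    rw [hG.natCast_vadd, h3, AddChar.map_add_eq_mul, ZMod.natCast_zmod_val]
    ring
  rw [translateSum_apply, Finset.sum_congr rfl fun j _ => h1 j, Finset.sum_comm, Finset.mul_sum]
  refine Finset.sum_congr rfl fun x _ => ?_
  rw [← Finset.mul_sum, ← Finset.sum_mul, sum_stdAddChar_mul]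
  simp only [sub_eq_zero]
  split_ifs <;> ring

/-- The component at `x ≠ 0` collects `½ (G_x + G_{-x})`, the one at 0 collects `½ G_0`; evenness
and the factor `s(0) = 2` restore `G`. -/
theorem liftComp_descend (hp : p ≠ 2) (hl : l ≠ 0) (hk : (-1 : ℂ) ^ k = χ (-1))
    (hG : IsEquivariant l k G) (x : ZMod p) (τ : ℍ) : liftComp l (descend G) x τ = G τ x := by
  have hp0 : (p : ℂ) ≠ 0 := by exact_mod_cast (Fact.out : p.Prime).ne_zero
  have hxx (y : ZMod p) : l * y ^ 2 = l * x ^ 2 ↔ y = x ∨ y = -x := by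
    rw [mul_right_inj' hl, sq_eq_sq_iff_eq_or_eq_neg]
  rw [liftComp, Pi.smul_apply, smul_eq_mul, translateSum_descend hG]
  simp only [hxx]
  rcases eq_or_ne x 0 with rfl | hx
  · simp only [neg_zero, or_self, Finset.sum_ite_eq', Finset.mem_univ, if_true]
    field_simp
  · have hne : x ≠ -x := by
      intro h
      have h3 : (2 : ZMod p) * x = 0 := by linear_combination h
      exact mul_ne_zero (two_ne_zero_zmod hp) hx h3
    have h5 (y : ZMod p) : (if y = x ∨ y = -x then G τ y else 0)
        = (if y = x then G τ y else 0) + if y = -x then G τ y else 0 := by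
      by_cases h6 : y = x
      · have h7 : y ≠ -x := h6 ▸ hne
        simp [h6, hne]
      · simp [h6]
    rw [if_neg hx, Finset.sum_congr rfl fun y _ => h5 y, Finset.sum_add_distrib,
      Finset.sum_ite_eq' Finset.univ x, Finset.sum_ite_eq' Finset.univ (-x),
      hG.neg_apply hp hl hk]
    simp only [Finset.mem_univ, if_true]
    field_simp
    ring

end Descend

/-! ### The isomorphism -/

section Isomorphism

variable {p : ℕ} [Fact p.Prime]

local notation "ψ" => ZMod.stdAddChar
local notation "χ" => legendreChar p

variable {A : Type*} [AddCommGroup A] [Fintype A] {ι : A ≃+ ZMod p} {Q : A → UnitAddCircle}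
  {l : ZMod p} {sig k : ℤ}

theorem eCircle_injective : Function.Injective eCircle := fun _ _ h =>
  AddCircle.injective_toCircle one_ne_zero (Subtype.ext h)

theorem IsPrimeDisc.coe_div_eq_iff (h : IsPrimeDisc ι Q l sig) (n : ℤ) (γ : A) :
    (((n : ℝ) / p : ℝ) : UnitAddCircle) = Q γ ↔ (n : ZMod p) = l * ι γ ^ 2 := by
  rw [← eCircle_injective.eq_iff, h.eCircle_eq, eCircle_coe, ← stdAddChar_intCast,
    ZMod.injective_stdAddChar.eq_iff]

theorem IsPrimeDisc.setOf_eq_exponents (h : IsPrimeDisc ι Q l sig) (γ : A) :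
    {x : ℝ | (x : UnitAddCircle) = Q γ} = exponents (l * ι γ ^ 2) := by
  have hp0 := (natCast_prime_pos p).ne'
  ext x
  constructor
  · intro (hx : (x : UnitAddCircle) = Q γ)
    obtain ⟨v, hv⟩ := ZMod.intCast_surjective (l * ι γ ^ 2)
    rw [← (h.coe_div_eq_iff v γ).mpr hv, ← sub_eq_zero, ← AddCircle.coe_sub,
      AddCircle.coe_eq_zero_iff] at hx
    obtain ⟨m, hm⟩ := hx
    refine ⟨v + p * m, by simp [hv], ?_⟩
    rw [zsmul_eq_mul, mul_one] at hm
    push_cast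
    field_simp
    field_simp at hm
    linear_combination -hm
  · rintro ⟨n, hn, rfl⟩
    exact (h.coe_div_eq_iff n γ).mpr hn

/-- Squaring the normalising constant compares `e(-sig/4) / p` with `g⁻² = 1 / (χ(-1) p)`, and `sig
≡ 2k` mod 4 turns `e(-sig/4)` into `(-1)^k`. -/
theorem IsPrimeDisc.neg_one_zpow (h : IsPrimeDisc ι Q l sig) (hp : p ≠ 2) (hl : l ≠ 0)
    (hk : 2 * k ≡ sig [ZMOD 4]) : (-1 : ℂ) ^ k = χ (-1) := by
  have hp0 : (p : ℂ) ≠ 0 := by exact_mod_cast (Fact.out : p.Prime).ne_zero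
  have hcard : Fintype.card A = p := by rw [Fintype.card_congr ι.toEquiv, ZMod.card]
  have hκ := legendreChar_sq (p := p) (x := -1) (by simp)
  have hκ0 : χ (-1) ≠ 0 := fun h0 => by simp [h0] at hκ
  obtain ⟨m, hm⟩ := hk.dvd
  have h1 := congrArg (fun z : ℂ => z * z) h.const_eq
  have hsq : ((Real.sqrt p : ℝ) : ℂ) * ((Real.sqrt p : ℝ) : ℂ) = p := by
    rw [← Complex.ofReal_mul, Real.mul_self_sqrt (Nat.cast_nonneg p), Complex.ofReal_natCast]
  rw [hcard, div_mul_div_comm, hsq, ← mul_inv, quadGauss_sq hp hl, ← e_add] at h1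
  have h2 : -(sig : ℂ) / 8 + -(sig : ℂ) / 8 = ((-m : ℤ) : ℂ) + -(k : ℂ) / 2 := by
    have h3 : (sig : ℂ) - 2 * k = 4 * m := by exact_mod_cast hm
    push_cast
    linear_combination -h3 / 4
  have h4 : e (-(k : ℂ) / 2) = (-1) ^ k := by
    rw [← Complex.exp_neg_pi_mul_I, ← Complex.exp_int_mul, e]
    congr 1
    ring
  rw [h2, e_add, e_intCast, one_mul, h4] at h1
  field_simp at h1
  linear_combination χ (-1) * h1 - (-1 : ℂ) ^ k * hκ

/-- The lift as a linear map. -/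
def liftMap (ι : A ≃+ ZMod p) (l : ZMod p) : (ℍ → ℂ) →ₗ[ℂ] (ℍ → A → ℂ) where
  toFun f τ γ := liftComp l f (ι γ) τ
  map_add' f g := by
    funext τ γ
    simp only [liftComp, Pi.smul_apply, Pi.add_apply, translateSum_apply, translate,
      Function.comp_apply, smul_eq_mul, mul_add, Finset.sum_add_distrib]
  map_smul' c f := by
    funext τ γ
    simp only [liftComp, Pi.smul_apply, translateSum_apply, translate, Function.comp_apply,
      smul_eq_mul, RingHom.id_apply, Finset.mul_sum]
    exact Finset.sum_congr rfl fun j _ => by ring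

/-- The descent as a map on functions with values in `ℂ[A]`. -/
def descendMap (ι : A ≃+ ZMod p) (F : ℍ → A → ℂ) : ℍ → ℂ :=
  descend fun τ x => F τ (ι.symm x)

/-- The map is defined by finite sums of values of `f`, so the series formula holds for whichever
expansion is supplied and uniqueness of coefficients plays no role. -/
theorem liftMap_isLift (h : IsPrimeDisc ι Q l sig) (f : ℍ → ℂ) :
    IsLift p Q k f (liftMap ι l f) := by
  have hp0 : (p : ℂ) ≠ 0 := by exact_mod_cast (Fact.out : p.Prime).ne_zero
  classical
  intro cp cm hcc τ γ
  have h1 := (hcc.hasSum_translateSum (l * ι γ ^ 2) τ).mul_left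
    ((if ι γ = 0 then 2 else 1) * (p : ℂ)⁻¹)
  rw [← Function.comp_def (fun n : ℤ => (if γ = 0 then (2 : ℂ) else 1) *
    (coeff k cp cm n (τ.im / p) * e ((n : ℂ) / p * τ))) Subtype.val]
  refine (hasSum_subtype_iff_indicator (s := {n : ℤ | (((n : ℝ) / p : ℝ) : UnitAddCircle) = Q γ})).mpr ?_
  convert! h1 using 1
  funext n
  rw [Set.indicator_apply]
  simp only [Set.mem_ofPred_eq, h.coe_div_eq_iff, EmbeddingLike.map_eq_zero_iff]
  split_ifs <;> field_simp <;> ring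

/-- `W` is the space of vector valued forms for the Weil representation attached to `Q`. -/
def IsFormSpace (Q : A → UnitAddCircle) (sig k : ℤ) (W : Submodule ℂ (ℍ → A → ℂ)) : Prop :=
  ∀ F : ℍ → A → ℂ, F ∈ W ↔ (∀ γ, IsSmooth fun τ => F τ γ) ∧
    ((∀ τ : ℍ, F (ModularGroup.T • τ) = (weilT Q).mulVec (F τ)) ∧
      ∀ τ : ℍ, F (ModularGroup.S • τ) = (τ : ℂ) ^ k • (weilS Q sig).mulVec (F τ)) ∧
    (∀ γ τ, laplace k (fun τ => F τ γ) τ = 0) ∧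
    ∀ γ, HasPrincipalPart {n : ℝ | (n : UnitAddCircle) = Q γ} fun τ => F τ γ

theorem IsPrimeDisc.isEquivariant (h : IsPrimeDisc ι Q l sig) {F : ℍ → A → ℂ}
    (hT : ∀ τ : ℍ, F (ModularGroup.T • τ) = (weilT Q).mulVec (F τ))
    (hS : ∀ τ : ℍ, F (ModularGroup.S • τ) = (τ : ℂ) ^ k • (weilS Q sig).mulVec (F τ)) :
    IsEquivariant l k fun τ x => F τ (ι.symm x) := by
  refine ⟨fun τ x => ?_, fun τ x => ?_⟩
  · rw [hT, h.weilT_mulVec, ι.apply_symm_apply]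
  · rw [hS, Pi.smul_apply, smul_eq_mul, h.weilS_mulVec, ι.apply_symm_apply]

theorem isPlus_of_mem_maassPlus {lam : ℤ} {f : ℍ → ℂ}
    (hf : f ∈ maassPlus p k (legendreSym p lam)) : IsPlus (lam : ZMod p) f := by
  obtain ⟨-, cp, cm, hcc, hv⟩ := hf
  refine fun r hr τ => translateSum_eq_zero hcc (fun n hn => hv n ?_) τ
  rw [← hn, legendreChar_intCast, legendreChar_intCast] at hr
  exact_mod_cast hr

theorem IsPrimeDisc.liftMap_mem {W : Submodule ℂ (ℍ → A → ℂ)} {lam : ℤ} (hp : p ≠ 2)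
    (hl : (lam : ZMod p) ≠ 0) (h : IsPrimeDisc ι Q (lam : ZMod p) sig)
    (hk : (-1 : ℂ) ^ k = χ (-1)) (hW : IsFormSpace Q sig k W) {f : ℍ → ℂ}
    (hf : f ∈ maassPlus p k (legendreSym p lam)) : liftMap ι (lam : ZMod p) f ∈ W := by
  have hplus := isPlus_of_mem_maassPlus hf
  obtain ⟨⟨hs, hcov, hΔ, hpp, -⟩, -⟩ := hf
  have hcov : IsCovariant p k f := hcov
  refine (hW _).mpr ⟨fun γ => (hs.translateSum _).smul _, ⟨fun τ => ?_, fun τ => ?_⟩,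
    fun γ τ => ?_, fun γ => ?_⟩
  · funext γ
    rw [h.weilT_mulVec]
    exact liftComp_T hcov _ _ _
  · funext γ
    rw [Pi.smul_apply, smul_eq_mul, h.weilS_mulVec]
    refine (liftComp_S hp hl hk hcov hplus (ι γ) τ).trans ?_
    congr 1
    refine Finset.sum_congr rfl fun y _ => ?_
    change _ = _ * liftComp (lam : ZMod p) f (ι (ι.symm y)) τ
    rw [ι.apply_symm_apply]
  · refine (laplace_smul k _ _ τ).trans ?_
    rw [laplace_translateSum hs hΔ, mul_zero]
  · rw [h.setOf_eq_exponents]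
    exact (hpp.translateSum _).smul _

theorem IsPrimeDisc.descendMap_mem {W : Submodule ℂ (ℍ → A → ℂ)} {lam : ℤ} (hp : p ≠ 2)
    (hl : (lam : ZMod p) ≠ 0) (h : IsPrimeDisc ι Q (lam : ZMod p) sig)
    (hW : IsFormSpace Q sig k W) {F : ℍ → A → ℂ} (hF : F ∈ W) :
    descendMap ι F ∈ maassPlus p k (legendreSym p lam) := by
  obtain ⟨hs, ⟨hT, hS⟩, hΔ, hpp⟩ := (hW F).mp hF
  have hG := h.isEquivariant hT hS
  have hs' (x : ZMod p) : IsSmooth fun τ => F τ (ι.symm x) := hs _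
  have hmem : descendMap ι F ∈ maassForms p (legendreChar p) k :=
    hG.descend_mem_maassForms hp hl hs' (fun x => hΔ _) fun x => by
      have := hpp (ι.symm x)
      rwa [h.setOf_eq_exponents, ι.apply_symm_apply] at this
  refine ⟨hmem, ?_⟩
  obtain ⟨hs1, hcov, hΔ1, hpp1, -⟩ := hmem
  have hper (τ : ℍ) : descendMap ι F ((1 : ℝ) +ᵥ τ) = descendMap ι F τ := by
    have hcov : IsCovariant p k (descendMap ι F) := hcov
    simpa using hcov.int_vadd 1 τ
  obtain ⟨cp, cm, hcc, hv⟩ := exists_isFourierExpansion hs1 hper hΔ1 hpp1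
  refine ⟨cp, cm, hcc, fun n hn => hv n fun y hy => hG.fourierMode_descend hl hs' ?_ hy⟩
  rw [legendreChar_intCast, legendreChar_intCast, hn]
  push_cast
  rfl

theorem IsPrimeDisc.exists_linearEquiv {W : Submodule ℂ (ℍ → A → ℂ)} {lam : ℤ} (hp : p ≠ 2)
    (hl : (lam : ZMod p) ≠ 0) (h : IsPrimeDisc ι Q (lam : ZMod p) sig)
    (hk : 2 * k ≡ sig [ZMOD 4]) (hW : IsFormSpace Q sig k W) :
    ∃ Φ : ↥(maassPlus p k (legendreSym p lam)) ≃ₗ[ℂ] ↥W,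
      ∀ f : ↥(maassPlus p k (legendreSym p lam)),
        IsLift p Q k (f : ℍ → ℂ) (Φ f : ℍ → A → ℂ) := by
  have hk' := h.neg_one_zpow hp hl hk
  refine ⟨{ (liftMap ι (lam : ZMod p)).restrict fun f hf => h.liftMap_mem hp hl hk' hW hf with
    invFun := fun F => ⟨descendMap ι F, h.descendMap_mem hp hl hW F.2⟩
    left_inv := fun f => Subtype.ext ?_
    right_inv := fun F => Subtype.ext ?_ }, fun f => liftMap_isLift h f⟩
  · refine Eq.trans ?_ (descend_liftComp hp hl (isPlus_of_mem_maassPlus f.2))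
    change descend (fun τ x => liftComp (lam : ZMod p) (f : ℍ → ℂ) (ι (ι.symm x)) τ) = _
    simp only [ι.apply_symm_apply]
  · obtain ⟨-, ⟨hT, hS⟩, -⟩ := (hW F).mp F.2
    funext τ γ
    refine (liftComp_descend hp hl hk' (h.isEquivariant hT hS) (ι γ) τ).trans ?_
    rw [ι.symm_apply_apply]

end Isomorphism

end MaassLift

end

/-! ### The theorem for `ρ_L` and its dual -/

theorem mainTheorem3 (p : ℕ) [Fact p.Prime] (hp : p ≠ 2)
    {V : Type*} [AddCommGroup V] [Module ℚ V] (L : MaassLift.EvenLattice V)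
    (ι : L.Disc ≃+ ZMod p) (lam : ℤ)
    (hlam : ∀ γ : L.Disc,
      L.discQ γ = (((lam : ℝ) * ((ι γ).val : ℝ) ^ 2 / (p : ℝ) : ℝ) : UnitAddCircle))
    (k : ℤ) (hk : 2 * k ≡ (L.bPlus : ℤ) - (L.bMinus : ℤ) [ZMOD 4])
    (ε δ : ℤ) (hε : ε = legendreSym p lam) (hδ : δ = legendreSym p (-1) * ε) :
    (∃ Φ : ↥(MaassLift.maassPlus p k ε) ≃ₗ[ℂ] ↥(MaassLift.vectorMaass L k),
      ∀ f : ↥(MaassLift.maassPlus p k ε), MaassLift.IsLift p L.discQ k (f : UpperHalfPlane → ℂ)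
        (Φ f : UpperHalfPlane → L.Disc → ℂ)) ∧
    (∃ Φ : ↥(MaassLift.maassPlus p k δ) ≃ₗ[ℂ] ↥(MaassLift.vectorMaassDual L k),
      ∀ f : ↥(MaassLift.maassPlus p k δ), MaassLift.IsLift p (fun γ => -L.discQ γ) k (f : UpperHalfPlane → ℂ)
        (Φ f : UpperHalfPlane → L.Disc → ℂ)) := by
  have hl := L.intCast_ne_zero_of_disc ι lam hlam
  obtain ⟨r, hr, hgauss⟩ := L.exists_gauss_eq
  have h : MaassLift.IsPrimeDisc ι L.discQ (lam : ZMod p) ((L.bPlus : ℤ) - L.bMinus) :=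
    MaassLift.isPrimeDisc_of_sum hp hl
      (MaassLift.eCircle_eq_of_eq ι L.discQ lam hlam) hr hgauss
  -- The dual half is the first half for the form `-Q`, whose parameter is `-λ`; accordingly `δ` is
  -- the Legendre symbol of `-λ`.
  have hδ' : δ = legendreSym p (-lam) := by
    rw [hδ, hε, ← legendreSym.mul, neg_one_mul]
  have hl' : ((-lam : ℤ) : ZMod p) ≠ 0 := by simpa using hl
  have h' : MaassLift.IsPrimeDisc ι (fun γ => -L.discQ γ) ((-lam : ℤ) : ZMod p)
      (-((L.bPlus : ℤ) - L.bMinus)) := by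
    rw [Int.cast_neg]
    exact h.neg
  -- The signature is even by `hk`, so it is congruent to its negative mod 4.
  have hk' : 2 * k ≡ -((L.bPlus : ℤ) - L.bMinus) [ZMOD 4] := by
    rw [Int.modEq_iff_dvd] at hk ⊢
    omega
  rw [hε, hδ']
  refine ⟨h.exists_linearEquiv hp hl hk fun F => ?_, h'.exists_linearEquiv hp hl' hk' fun F => ?_⟩
  · rw [← MaassLift.isWeil_equivariant_iff]
    rfl
  · rw [← MaassLift.isWeilDual_equivariant_iff hp hl h]
    rfl
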